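/- Let $G$ be a compact connected Lie group with Lie algebra $\mathfrak g$, let $k\ge 1$, and let $f$ be a symmetric, $\mathrm{Ad}$-invariant, $k$-linear function $\mathfrak g^k\to\mathbb R$. Let $S^1=\mathbb R/2\pi\mathbb Z$ with base point $0$, let $\Omega G$ be the group of smooth loops $\gamma\colon S^1\to G$ with $\gamma(0)=1$, and let $\Omega\mathfrak g$ be the smooth maps $\xi\colon S^1\to\mathfrak g$ with $\xi(0)=0$. For an $\Omega G$-bundle $\pi\colon P\to M$, a connection is an $\Omega\mathfrak g$-valued connection $1$-form $A$ on $P$, and a Higgs field is a smooth map $\Phi\colon P\to C^\infty(S^1,\mathfrak g)$ with $\Phi(p\gamma)=\mathrm{Ad}(\gamma^{-1})\Phi(p)+\gamma^{-1}\partial\gamma$. The caloron transform of $P$ is the $G$-bundle $\mathcal C(P)=(P\times G\times S^1)/\Omega G\to M\times S^1$, where $(p,g,\theta)\gamma=(p\gamma,\gamma(\theta)^{-1}g,\theta)$, with the connection $\tilde A=\mathrm{Ad}(g^{-1})A(\theta)+\Theta+\mathrm{Ad}(g^{-1})\Phi\,d\theta$, where $\Theta$ is the left-invariant Maurer–Cartan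 form of $G$. With $\tilde F=d\tilde A+\tfrac12[\tilde A,\tilde A]$, the form $f(\tilde F,\dots,\tilde F)$ descends to $cw_f(\tilde A)\in\Omega^{2k}(M\times S^1)$, and the string form of $(A,\Phi)$ is $s_f(A,\Phi)=\int_{S^1}cw_f(\tilde A)\in\Omega^{2k-1}(M)$, where $\int_{S^1}\beta\wedge d\theta=\int_0^{2\pi}\beta\,d\theta$. The string class $s_f(P)\in H^{2k-1}(M;\mathbb R)$ is the de Rham class of $s_f(A,\Phi)$ for any choice of $A$ and $\Phi$. The path fibration is $\pi\colon PG\to G$, $\pi(p)=p(2\pi)$, where $PG$ is the space of smooth paths $p\colon\mathbb R\to G$ with $p(0)=1$ and $p^{-1}\partial p$ $2\pi$-periodic, and $\Omega G$ acts by pointwise multiplication on the right. Let $\alpha\colon\mathbb R\to\mathbb R$ be smooth with $\alpha(t)=0$ for $t\le 0$ and $\alpha(t)=1$ for $t\ge 2\pi$, and let $\widehat\Theta$ be the right-invariant Maurer–Cartan form. Then the path fibration is an $\Omega G$-bundle, and $$A=\Theta-\alpha\,\mathrm{Ad}(p^{-1})\,\pi^*\widehat\Theta\quad(\text{on }0\le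 t<2\pi,\text{ extended periodically}),\qquad \Phi(p)=p^{-1}\partial p$$ are a connection and a Higgs field for it (the standard ones). Their string form is $$s_f(A,\Phi)=\Bigl(-\frac12\Bigr)^{k-1}\frac{k!\,(k-1)!}{(2k-1)!}\;f(\Theta,[\Theta,\Theta],\dots,[\Theta,\Theta])\in\Omega^{2k-1}(G).$$ This form is closed, and its de Rham class is the string class $s_f(PG)\in H^{2k-1}(G;\mathbb R)$: for every connection $A'$ and every Higgs field $\Phi'$ on $PG$, the string form $s_f(A',\Phi')$ is closed and has this class. -/

import Mathlib

open scoped Manifold ContDiff Topology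

noncomputable section

namespace StringForm

/-! ## Diffeologies

`PG`, `ΩG`, `S¹ = ℝ/2πℤ` and the total space of the caloron transform are handled as diffeological
spaces; on finite-dimensional manifolds, and on Fréchet manifolds such as `PG`, the smooth maps and
the differential forms of the diffeology are the usual ones. -/

open Diffeology

/-- The domains `ℝⁿ` of plots. -/
abbrev Eu (n : ℕ) : Type := EuclideanSpace ℝ (Fin n)

/-- Around every point of an open set `s` of `ℝⁿ` the identity extends to a smooth map `ℝⁿ → s`. -/
theorem exists_smooth_retract {n : ℕ} {s : Set (Eu n)} (hs : IsOpen s) {x : Eu n} (hx : x ∈ s) :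
    ∃ ρ : Eu n → Eu n, ContDiff ℝ ∞ ρ ∧ (∀ y, ρ y ∈ s) ∧ ρ =ᶠ[𝓝 x] id := by
  obtain ⟨ε, hε, hball⟩ := Metric.isOpen_iff.mp hs x hx
  let χ : ContDiffBump x := ⟨ε / 2, ε, by positivity, by linarith⟩
  refine ⟨fun y => x + χ y • (y - x), ?_, ?_, ?_⟩
  · have h1 : ContDiff ℝ ∞ (fun y => χ y) := χ.contDiff
    exact contDiff_const.add (h1.smul (contDiff_id.sub contDiff_const))
  · intro y
    apply hball
    rw [Metric.mem_ball, dist_eq_norm, add_sub_cancel_left, norm_smul, Real.norm_eq_abs,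
      abs_of_nonneg χ.nonneg]
    by_cases hy : y ∈ Metric.ball x ε
    · have h2 : ‖y - x‖ < ε := by rwa [Metric.mem_ball, dist_eq_norm] at hy
      calc χ y * ‖y - x‖ ≤ 1 * ‖y - x‖ := by
            gcongr
            exact χ.le_one
        _ < ε := by simpa using h2
    · have : χ y = 0 := by
        apply χ.zero_of_le_dist
        simpa using hy
      simpa [this] using hε
  · have : ∀ᶠ y in 𝓝 x, y ∈ Metric.closedBall x χ.rIn :=
      Metric.closedBall_mem_nhds x (by show 0 < ε / 2; positivity)
    filter_upwards [this] with y hy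
    simp [χ.one_of_mem_closedBall hy]

/-- The diffeology of a smooth manifold (without boundary, modelled on `E`): the plots are the
smooth maps. -/
@[reducible]
def manifoldDiffeology (E : Type*) [NormedAddCommGroup E] [NormedSpace ℝ E]
    (M : Type*) [TopologicalSpace M] [ChartedSpace E M] : DiffeologicalSpace M where
  plots n := {p | ContMDiff 𝓘(ℝ, Eu n) 𝓘(ℝ, E) ∞ p}
  constant_plots _ := contMDiff_const
  plot_reparam hp hf := ContMDiff.comp hp hf.contMDiff
  locality {n p} hp := by
    intro x
    obtain ⟨u, hu, hxu, h⟩ := hp x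
    obtain ⟨ρ, hρ, hρu, hρx⟩ := exists_smooth_retract hu hxu
    have h1 : ContMDiff 𝓘(ℝ, Eu n) 𝓘(ℝ, E) ∞ (p ∘ ρ) := h hρu hρ
    refine (h1 x).congr_of_eventuallyEq ?_
    filter_upwards [hρx] with y hy
    simp [hy]

/-- The product diffeology. -/
instance prodDiffeology (X Y : Type*) [DiffeologicalSpace X] [DiffeologicalSpace Y] :
    DiffeologicalSpace (X × Y) where
  plots _ := {p | IsPlot (fun u => (p u).1) ∧ IsPlot (fun u => (p u).2)}
  constant_plots _ := ⟨isPlot_const, isPlot_const⟩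
  plot_reparam hp hf := ⟨isPlot_reparam hp.1 hf, isPlot_reparam hp.2 hf⟩
  locality {n p} hp := by
    constructor
    · refine DiffeologicalSpace.locality fun x => ?_
      obtain ⟨u, hu, hxu, h⟩ := hp x
      exact ⟨u, hu, hxu, fun hf hf' => (h hf hf').1⟩
    · refine DiffeologicalSpace.locality fun x => ?_
      obtain ⟨u, hu, hxu, h⟩ := hp x
      exact ⟨u, hu, hxu, fun hf hf' => (h hf hf').2⟩

/-- The quotient diffeology along a surjection `q : X → Y`: the plots are the maps that locally
lift to plots of `X`. -/
@[reducible]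
def quotientDiffeology {X Y : Type*} [DiffeologicalSpace X] (q : X → Y)
    (hq : Function.Surjective q) : DiffeologicalSpace Y where
  plots n := {p | ∀ x, ∃ r : Eu n → X, IsPlot r ∧ p =ᶠ[𝓝 x] q ∘ r}
  constant_plots y x := by
    obtain ⟨a, rfl⟩ := hq y
    exact ⟨fun _ => a, isPlot_const, Filter.EventuallyEq.rfl⟩
  plot_reparam {n m p f} hp hf x := by
    obtain ⟨r, hr, h⟩ := hp (f x)
    exact ⟨r ∘ f, isPlot_reparam hr hf, hf.continuous.continuousAt.eventually h⟩
  locality {n p} hp x := by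
    obtain ⟨u, hu, hxu, h⟩ := hp x
    obtain ⟨ρ, hρ, hρu, hρx⟩ := exists_smooth_retract hu hxu
    obtain ⟨r, hr, h1⟩ := h hρu hρ x
    refine ⟨r, hr, ?_⟩
    filter_upwards [hρx, h1] with y hy hy1
    rw [← hy1]
    simp [hy]

/-- The circle `S¹ = ℝ/2πℤ`, with base point `0`. -/
abbrev Circ : Type := Real.Angle

/-- The smooth structure of `S¹ = ℝ/2πℤ` as a quotient of `ℝ`. -/
instance circDiffeology : DiffeologicalSpace Circ :=
  quotientDiffeology (fun t : ℝ => (t : Real.Angle)) Quotient.mk_surjective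

/-- The form `dθ` on `S¹`, evaluated on a plot: `dθ = cos θ d(sin θ) - sin θ d(cos θ)`. -/
def dTheta {n : ℕ} (θ : Eu n → Circ) (u : Eu n) : Eu n →L[ℝ] ℝ :=
  (θ u).cos • fderiv ℝ (fun w => (θ w).sin) u - (θ u).sin • fderiv ℝ (fun w => (θ w).cos) u

/-- The representative in `[0, 2π)` of a point of `S¹`. -/
def angleRep (θ : Circ) : ℝ := (toIcoMod_periodic Real.two_pi_pos (0 : ℝ)).lift θ

/-! ## Differential forms -/

section Forms

variable (X : Type*) [DiffeologicalSpace X] (k : ℕ)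
  (V : Type*) [NormedAddCommGroup V] [NormedSpace ℝ V]

/-- The space `Ωᵏ(X, V)` of `V`-valued differential `k`-forms on a diffeological space `X`: a form
assigns to each plot `p : ℝⁿ → X` a smooth `k`-form on `ℝⁿ` (its pull-back along `p`), compatibly
with smooth changes of parameters. -/
def dFormSubmodule : Submodule ℝ
    (∀ n : ℕ, {p : Eu n → X // IsPlot p} → Eu n → Eu n [⋀^Fin k]→L[ℝ] V) where
  carrier := {η | (∀ n p, ContDiff ℝ ∞ (η n p)) ∧
    ∀ (n m : ℕ) (p : {p : Eu n → X // IsPlot p}) (ψ : Eu m → Eu n) (hψ : ContDiff ℝ ∞ ψ) (u : Eu m),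
      η m ⟨p.1 ∘ ψ, isPlot_reparam p.2 hψ⟩ u =
        (η n p (ψ u)).compContinuousLinearMap (fderiv ℝ ψ u)}
  add_mem' {a b} ha hb := by
    refine ⟨fun n p => (ha.1 n p).add (hb.1 n p), fun n m p ψ hψ u => ?_⟩
    simp only [Pi.add_apply, ha.2 n m p ψ hψ u, hb.2 n m p ψ hψ u]
    rfl
  zero_mem' := ⟨fun _ _ => contDiff_const, fun _ _ _ _ _ _ => rfl⟩
  smul_mem' c a ha := by
    refine ⟨fun n p => (ha.1 n p).const_smul c, fun n m p ψ hψ u => ?_⟩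
    simp only [Pi.smul_apply, ha.2 n m p ψ hψ u]
    rfl

/-- The space `Ωᵏ(X, V)` of `V`-valued differential `k`-forms, as a type. -/
def DForm : Type _ := dFormSubmodule X k V

instance : AddCommGroup (DForm X k V) := Submodule.addCommGroup (dFormSubmodule X k V)

instance : Module ℝ (DForm X k V) := Submodule.module (dFormSubmodule X k V)

variable {X k V}

/-- The pull-back `p^*η` of a form along a plot `p`. -/
def DForm.on (η : DForm X k V) {n : ℕ} (p : Eu n → X) (hp : IsPlot p) :
    Eu n → Eu n [⋀^Fin k]→L[ℝ] V :=
  η.1 n ⟨p, hp⟩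

variable (X k V)

/-- The exterior derivative `d : Ωᵏ(X, V) → Ωᵏ⁺¹(X, V)`. -/
def d : DForm X k V →ₗ[ℝ] DForm X (k + 1) V where
  toFun η := ⟨fun n p => extDeriv (η.1 n p), by
    refine ⟨fun n p => ?_, fun n m p ψ hψ u => ?_⟩
    · exact (ContinuousAlternatingMap.alternatizeUncurryFinCLM ℝ (Eu n) V).contDiff.comp
        ((η.2.1 n p).fderiv_right (m := ∞) (by simp))
    · have h : η.1 m ⟨p.1 ∘ ψ, isPlot_reparam p.2 hψ⟩ =
          fun u => (η.1 n p (ψ u)).compContinuousLinearMap (fderiv ℝ ψ u) :=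
        funext (η.2.2 n m p ψ hψ)
      show extDeriv (η.1 m ⟨p.1 ∘ ψ, isPlot_reparam p.2 hψ⟩) u = _
      rw [h]
      exact extDeriv_pullback (r := ∞) (((η.2.1 n p).differentiable (by simp)).differentiableAt)
        hψ.contDiffAt (by simpa using (WithTop.coe_le_coe.2 le_top : ((2:ℕ∞) : WithTop ℕ∞) ≤ ((⊤:ℕ∞): WithTop ℕ∞)))⟩
  map_add' a b := by
    apply Subtype.ext
    funext n p u
    exact extDeriv_add ((a.2.1 n p).differentiable (by simp)).differentiableAt
      ((b.2.1 n p).differentiable (by simp)).differentiableAt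
  map_smul' c a := by
    apply Subtype.ext
    funext n p u
    exact extDeriv_smul c (a.1 n p)

/-- The de Rham cohomology `Hᵏ⁺¹(X)` with real coefficients: closed `(k + 1)`-forms modulo the
exact ones. -/
abbrev DeRhamH : Type _ :=
  LinearMap.ker (d X (k + 1) ℝ) ⧸
    (LinearMap.range (d X k ℝ)).comap (LinearMap.ker (d X (k + 1) ℝ)).subtype

variable {X k}

/-- The de Rham class of a closed form. -/
def deRhamClass (η : DForm X (k + 1) ℝ) (hη : d X (k + 1) ℝ η = 0) : DeRhamH X k :=
  Submodule.Quotient.mk ⟨η, hη⟩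

end Forms

/-! ## Multilinear functions of vector valued forms -/

section Wedge

variable {U V W : Type*} [NormedAddCommGroup U] [NormedSpace ℝ U]
  [NormedAddCommGroup V] [NormedSpace ℝ V] [NormedAddCommGroup W] [NormedSpace ℝ W]

theorem formTensor_update {k : ℕ} {q : Fin k → ℕ} (η : ∀ i, U [⋀^Fin (q i)]→L[ℝ] V)
    (v : (i : Fin k) × Fin (q i) → U) (i : Fin k) (j : Fin (q i)) (x : U) :
    (fun i' => η i' fun j' => Function.update v ⟨i, j⟩ x ⟨i', j'⟩) =
      Function.update (fun i' => η i' fun j' => v ⟨i', j'⟩) i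
        (η i (Function.update (fun j' => v ⟨i, j'⟩) j x)) := by
  funext i'
  by_cases h : i' = i
  · subst h
    rw [Function.update_self]
    congr 1
    funext j'
    by_cases hj : j' = j
    · subst hj; simp
    · rw [Function.update_of_ne hj, Function.update_of_ne]
      simpa using hj
  · rw [Function.update_of_ne h]
    congr 1
    funext j'
    rw [Function.update_of_ne]
    intro h'
    exact h (congrArg Sigma.fst h')

/-- `(v_{ij}) ↦ f (η₁(v₁₁, …, v_{1q₁}), …, η_k(v_{k1}, …, v_{kq_k}))`. -/
def formTensor {k : ℕ} {q : Fin k → ℕ} (f : ContinuousMultilinearMap ℝ (fun _ : Fin k => V) W)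
    (η : ∀ i, U [⋀^Fin (q i)]→L[ℝ] V) :
    ContinuousMultilinearMap ℝ (fun _ : (i : Fin k) × Fin (q i) => U) W where
  toFun v := f fun i => η i fun j => v ⟨i, j⟩
  map_update_add' {inst} v a x y := by
    classical
    rw [Subsingleton.elim inst instDecidableEqSigma]
    obtain ⟨i, j⟩ := a
    simp only [formTensor_update, ContinuousAlternatingMap.map_update_add,
      ContinuousMultilinearMap.map_update_add]
  map_update_smul' {inst} v a c x := by
    classical
    rw [Subsingleton.elim inst instDecidableEqSigma]
    obtain ⟨i, j⟩ := a
    simp only [formTensor_update, ContinuousAlternatingMap.map_update_smul,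
      ContinuousMultilinearMap.map_update_smul]
  cont := by
    refine f.cont.comp (continuous_pi fun i => (η i).cont.comp (continuous_pi fun j => ?_))
    exact continuous_apply _

/-- The form `f(η₁, …, η_k)` of degree `N = q₁ + ⋯ + q_k` obtained from a multilinear function
`f` and `V`-valued forms `η_i` of degrees `q_i` by inserting the forms into `f` and wedging, with
the normalisation `(α ∧ β)(x, y) = α(x) β(y) - α(y) β(x)` for `1`-forms:
`f(η₁, …, η_k)(v₁, …, v_N) =
  (1 / (q₁! ⋯ q_k!)) ∑_σ sgn(σ) f(η₁(v_{σ1}, …, v_{σq₁}), …, η_k(…, v_{σN}))`. -/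
def formEval {k : ℕ} {q : Fin k → ℕ} (f : ContinuousMultilinearMap ℝ (fun _ : Fin k => V) W)
    (η : ∀ i, U [⋀^Fin (q i)]→L[ℝ] V) {N : ℕ} (hN : ∑ i, q i = N) : U [⋀^Fin N]→L[ℝ] W :=
  (∏ i, ((q i).factorial : ℝ))⁻¹ •
    ContinuousMultilinearMap.alternatization
      ((formTensor f η).domDomCongr (finSigmaFinEquiv.trans (finCongr hN)))

end Wedge

/-! ## Lie groups

`G` is a Lie group modelled on the finite-dimensional real vector space `E`. All tangent spaces
`T_gG`, and in particular the Lie algebra `𝔤 = T_1G`, are by definition copies of `E`. -/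

section LieGroups

variable {E : Type*} [NormedAddCommGroup E] [NormedSpace ℝ E]
  {G : Type*} [TopologicalSpace G] [ChartedSpace E G] [Group G]

/-- The adjoint action `Ad(g) : 𝔤 → 𝔤`, the derivative of `x ↦ g x g⁻¹` at the identity. -/
def Ad (g : G) : E →L[ℝ] E := mfderiv 𝓘(ℝ, E) 𝓘(ℝ, E) (fun x : G => g * x * g⁻¹) 1

/-- The left invariant Maurer-Cartan form `Θ_g : T_gG → 𝔤`, the derivative of `x ↦ g⁻¹ x` at
`g`. -/
def maurerCartan (g : G) : E →L[ℝ] E := mfderiv 𝓘(ℝ, E) 𝓘(ℝ, E) (fun x : G => g⁻¹ * x) g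

/-- The right invariant Maurer-Cartan form `Θ̂_g : T_gG → 𝔤`, the derivative of `x ↦ x g⁻¹` at
`g`. -/
def maurerCartanR (g : G) : E →L[ℝ] E := mfderiv 𝓘(ℝ, E) 𝓘(ℝ, E) (fun x : G => x * g⁻¹) g

/-- The pull-back `φ^*Θ = φ⁻¹ dφ` of the left invariant Maurer-Cartan form along `φ : U → G`. -/
def leftMC {U : Type*} [NormedAddCommGroup U] [NormedSpace ℝ U] (φ : U → G) (u : U) : U →L[ℝ] E :=
  (maurerCartan (φ u)).comp (mfderiv 𝓘(ℝ, U) 𝓘(ℝ, E) φ u : U →L[ℝ] E)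

/-- The pull-back `φ^*Θ̂ = dφ φ⁻¹` of the right invariant Maurer-Cartan form along `φ : U → G`. -/
def rightMC {U : Type*} [NormedAddCommGroup U] [NormedSpace ℝ U] (φ : U → G) (u : U) : U →L[ℝ] E :=
  (maurerCartanR (φ u)).comp (mfderiv 𝓘(ℝ, U) 𝓘(ℝ, E) φ u : U →L[ℝ] E)

/-- The logarithmic derivative `p⁻¹∂p : ℝ → 𝔤` of a path `p : ℝ → G`. -/
def logDeriv (p : ℝ → G) (t : ℝ) : E := leftMC p t 1

theorem logDeriv_add_const {p : ℝ → G} (hp : MDifferentiable 𝓘(ℝ, ℝ) 𝓘(ℝ, E) p) (c t : ℝ) :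
    logDeriv (E := E) (fun s => p (s + c)) t = logDeriv p (t + c) := by
  have h1 : HasMFDerivAt 𝓘(ℝ, ℝ) 𝓘(ℝ, ℝ) (fun s : ℝ => s + c) t (ContinuousLinearMap.id ℝ ℝ) :=
    ((hasFDerivAt_id t).add_const c).hasMFDerivAt
  have h2 := ((hp (t + c)).hasMFDerivAt.comp t h1).mfderiv
  exact congrArg (fun L : ℝ →L[ℝ] E => maurerCartan (E := E) (p (t + c)) (L 1)) h2

variable [LieGroup 𝓘(ℝ, E) ∞ G]

theorem mdiff_mul_left (a x : G) :
    MDifferentiableAt 𝓘(ℝ, E) 𝓘(ℝ, E) (fun y : G => a * y) x :=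
  (contMDiff_mul_left (I := 𝓘(ℝ, E)) (n := ∞) (a := a)).mdifferentiable (by simp) x

theorem mdiff_mul_right (a x : G) :
    MDifferentiableAt 𝓘(ℝ, E) 𝓘(ℝ, E) (fun y : G => y * a) x :=
  (contMDiff_mul_right (I := 𝓘(ℝ, E)) (n := ∞) (a := a)).mdifferentiable (by simp) x

/-- `(pq)⁻¹∂(pq) = Ad(q⁻¹)(p⁻¹∂p) + q⁻¹∂q`. -/
theorem logDeriv_mul {p q : ℝ → G} {t : ℝ} (hp : MDifferentiableAt 𝓘(ℝ, ℝ) 𝓘(ℝ, E) p t)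
    (hq : MDifferentiableAt 𝓘(ℝ, ℝ) 𝓘(ℝ, E) q t) :
    logDeriv (E := E) (fun s => p s * q s) t = Ad (q t)⁻¹ (logDeriv p t) + logDeriv q t := by
  have hm : MDifferentiableAt (𝓘(ℝ, E).prod 𝓘(ℝ, E)) 𝓘(ℝ, E) (fun x : G × G => x.1 * x.2)
      (p t, q t) := (contMDiff_mul 𝓘(ℝ, E) (n := ∞)).mdifferentiable (by simp) _
  have h1 : (mfderiv 𝓘(ℝ, ℝ) 𝓘(ℝ, E) (fun s => p s * q s) t (1 : ℝ) : E) =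
      (mfderiv 𝓘(ℝ, E) 𝓘(ℝ, E) (fun z => z * q t) (p t) (mfderiv 𝓘(ℝ, ℝ) 𝓘(ℝ, E) p t (1 : ℝ)) +
      mfderiv 𝓘(ℝ, E) 𝓘(ℝ, E) (fun z => p t * z) (q t) (mfderiv 𝓘(ℝ, ℝ) 𝓘(ℝ, E) q t (1 : ℝ)) : E) := by
    have h2 := mfderiv_comp_apply (I := 𝓘(ℝ, ℝ)) t (f := fun s => (p s, q s)) hm (hp.prodMk hq) (1 : ℝ)
    rw [mfderiv_prod_eq_add_apply hm, mfderiv_prodMk hp hq] at h2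
    exact h2
  have h3 : ∀ v : E, maurerCartan (E := E) (p t * q t)
      (mfderiv 𝓘(ℝ, E) 𝓘(ℝ, E) (fun z => z * q t) (p t) v : E) =
        Ad (q t)⁻¹ (maurerCartan (p t) v) := by
    intro v
    have e1 := mfderiv_comp_apply (I := 𝓘(ℝ, E)) (p t) (f := fun z => z * q t)
      (g := fun y => (p t * q t)⁻¹ * y) (mdiff_mul_left _ _) (mdiff_mul_right _ _) v
    have hc : MDifferentiableAt 𝓘(ℝ, E) 𝓘(ℝ, E) (fun x : G => (q t)⁻¹ * x * (q t)⁻¹⁻¹) 1 :=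
      MDifferentiableAt.comp (I' := 𝓘(ℝ, E)) (1 : G) (g := fun y : G => y * (q t)⁻¹⁻¹)
        (mdiff_mul_right _ _) (mdiff_mul_left _ _)
    have e2 := mfderiv_comp_apply_of_eq (I := 𝓘(ℝ, E)) (x := p t) (y := 1) (f := fun z => (p t)⁻¹ * z)
      (g := fun x => (q t)⁻¹ * x * (q t)⁻¹⁻¹) hc (mdiff_mul_left _ _) (by simp) v
    have e3 : (fun y => (p t * q t)⁻¹ * y) ∘ (fun z => z * q t) =
        (fun x => (q t)⁻¹ * x * (q t)⁻¹⁻¹) ∘ (fun z => (p t)⁻¹ * z) := by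
      funext z
      simp [mul_assoc]
    rw [e3] at e1
    exact e1.symm.trans e2
  have h4 : ∀ v : E, maurerCartan (E := E) (p t * q t)
      (mfderiv 𝓘(ℝ, E) 𝓘(ℝ, E) (fun z => p t * z) (q t) v : E) = maurerCartan (q t) v := by
    intro v
    have e1 := mfderiv_comp_apply (I := 𝓘(ℝ, E)) (q t) (f := fun z => p t * z)
      (g := fun y => (p t * q t)⁻¹ * y) (mdiff_mul_left _ _) (mdiff_mul_left _ _) v
    have e3 : (fun y => (p t * q t)⁻¹ * y) ∘ (fun z => p t * z) = fun z => (q t)⁻¹ * z := by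
      funext z
      simp [mul_assoc]
    rw [e3] at e1
    exact e1.symm
  change maurerCartan (E := E) (p t * q t) (mfderiv 𝓘(ℝ, ℝ) 𝓘(ℝ, E) (fun s => p s * q s) t (1 : ℝ) : E) = _
  refine (congrArg (maurerCartan (E := E) (p t * q t)) h1).trans ?_
  refine (map_add (maurerCartan (E := E) (p t * q t)) _ _).trans ?_
  exact congrArg₂ (· + ·) (h3 _) (h4 _)

variable (E G) in
theorem lieGroup_three : LieGroup 𝓘(ℝ, E) (minSmoothness ℝ 3) G :=
  LieGroup.of_le (n := ∞) (by
    simpa using (WithTop.coe_le_coe.2 le_top : ((3 : ℕ∞) : WithTop ℕ∞) ≤ ((⊤ : ℕ∞) : WithTop ℕ∞)))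

variable (E G) in
/-- The Lie bracket of `𝔤`, as a bilinear map `E × E → E`. -/
def lieBilin [FiniteDimensional ℝ E] : E →ₗ[ℝ] E →ₗ[ℝ] E :=
  haveI := lieGroup_three E G
  LinearMap.mk₂ ℝ (fun x y =>
    @Bracket.bracket (GroupLieAlgebra 𝓘(ℝ, E) G) (GroupLieAlgebra 𝓘(ℝ, E) G) _ x y)
    (fun x y z => add_lie (L := GroupLieAlgebra 𝓘(ℝ, E) G) (M := GroupLieAlgebra 𝓘(ℝ, E) G) x y z)
    (fun c x y => smul_lie (R := ℝ) (L := GroupLieAlgebra 𝓘(ℝ, E) G)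
      (M := GroupLieAlgebra 𝓘(ℝ, E) G) c x y)
    (fun x y z => lie_add (L := GroupLieAlgebra 𝓘(ℝ, E) G) (M := GroupLieAlgebra 𝓘(ℝ, E) G) x y z)
    (fun c x y => lie_smul (R := ℝ) (L := GroupLieAlgebra 𝓘(ℝ, E) G)
      (M := GroupLieAlgebra 𝓘(ℝ, E) G) c x y)

variable (E G) in
/-- The Lie bracket of `𝔤`, as a multilinear function of two variables. -/
def bracket [FiniteDimensional ℝ E] : ContinuousMultilinearMap ℝ (fun _ : Fin 2 => E) E where
  toFun v := lieBilin E G (v 0) (v 1)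
  map_update_add' {inst} v i x y := by
    rw [Subsingleton.elim inst (instDecidableEqFin 2)]
    fin_cases i <;> simp
  map_update_smul' {inst} v i c x := by
    rw [Subsingleton.elim inst (instDecidableEqFin 2)]
    fin_cases i <;> simp
  cont := by
    have h : ∀ v : Fin 2 → E, lieBilin E G (v 0) (v 1) =
        (lieBilin E G).toContinuousBilinearMap (v 0) (v 1) := fun v => rfl
    simp only [h]
    fun_prop

end LieGroups

/-! ## `ΩG`-bundles, connections and Higgs fields -/

theorem isPlot_of_locally {X : Type*} [DiffeologicalSpace X] {n : ℕ} {p : Eu n → X}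
    (h : ∀ x, ∃ r : Eu n → X, IsPlot r ∧ p =ᶠ[𝓝 x] r) : IsPlot p := by
  refine DiffeologicalSpace.locality fun x => ?_
  obtain ⟨r, hr, hpr⟩ := h x
  obtain ⟨u, hu, hou, hxu⟩ := eventually_nhds_iff.mp hpr
  refine ⟨u, hou, hxu, fun {m f} hf hf' => ?_⟩
  have : p ∘ f = r ∘ f := funext fun y => hu _ (hf y)
  rw [this]
  exact isPlot_reparam hr hf'

section Bundles

variable (E : Type*) [NormedAddCommGroup E] [NormedSpace ℝ E]
  (G : Type*) [TopologicalSpace G] [ChartedSpace E G] [Group G] [LieGroup 𝓘(ℝ, E) ∞ G]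

/-- The group `ΩG` of smooth maps `γ : S¹ → G` with `γ(0) = 1`. -/
def LoopGroup : Subgroup (Circ → G) where
  carrier := {γ | ContMDiff 𝓘(ℝ, ℝ) 𝓘(ℝ, E) ∞ (fun t : ℝ => γ (t : Circ)) ∧ γ 0 = 1}
  one_mem' := ⟨contMDiff_const, rfl⟩
  mul_mem' ha hb := ⟨ha.1.mul hb.1, by simp [ha.2, hb.2]⟩
  inv_mem' ha := ⟨ha.1.inv, by simp [ha.2]⟩

/-- The diffeology of a space of maps of a real variable: the plots are the families that are
jointly smooth in the parameter and in the variable. -/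
@[reducible]
def mapDiffeology {S : Type*} (ev : S → ℝ → G) (hev : ∀ s, ContMDiff 𝓘(ℝ, ℝ) 𝓘(ℝ, E) ∞ (ev s)) :
    DiffeologicalSpace S where
  plots n := {p | ContMDiff 𝓘(ℝ, Eu n × ℝ) 𝓘(ℝ, E) ∞ fun x : Eu n × ℝ => ev (p x.1) x.2}
  constant_plots s := (hev s).comp contDiff_snd.contMDiff
  plot_reparam {n m p f} hp hf := by
    have h : ContDiff ℝ ∞ (fun x : Eu n × ℝ => (f x.1, x.2)) :=
      (hf.comp contDiff_fst).prodMk contDiff_snd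
    exact ContMDiff.comp hp h.contMDiff
  locality {n p} hp := by
    rintro ⟨x, t⟩
    obtain ⟨u, hu, hxu, h⟩ := hp x
    obtain ⟨ρ, hρ, hρu, hρx⟩ := exists_smooth_retract hu hxu
    refine ((h hρu hρ) (x, t)).congr_of_eventuallyEq ?_
    have h2 : ∀ᶠ y : Eu n × ℝ in 𝓝 (x, t), ρ y.1 = id y.1 :=
      (continuous_fst.continuousAt (x := (x, t))).eventually hρx
    filter_upwards [h2] with y hy
    simp [hy]

instance loopDiffeology : DiffeologicalSpace (LoopGroup E G) :=
  mapDiffeology E G (fun γ t => γ.1 (t : Circ)) fun γ => γ.2.1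

/-- A smooth map `Total → Base` of diffeological spaces together with a smooth right action of `ΩG`
on its fibres. -/
structure OmegaSpace where
  Base : Type*
  Total : Type*
  [baseDiff : DiffeologicalSpace Base]
  [totalDiff : DiffeologicalSpace Total]
  proj : Total → Base
  act : Total → LoopGroup E G → Total
  proj_smooth : DSmooth proj
  act_smooth : DSmooth fun x : Total × LoopGroup E G => act x.1 x.2
  act_one : ∀ p, act p 1 = p
  act_mul : ∀ p γ δ, act (act p γ) δ = act p (γ * δ)
  proj_act : ∀ p γ, proj (act p γ) = proj p

attribute [instance] OmegaSpace.baseDiff OmegaSpace.totalDiff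

variable {E G}

/-- `P → M` is a principal `ΩG`-bundle: the action is free, points of a common fibre differ by a
loop depending smoothly on the points, and `P → M` has smooth local lifts. -/
structure OmegaSpace.IsBundle (P : OmegaSpace E G) : Prop where
  free : ∀ p γ, P.act p γ = p → γ = 1
  transitive : ∀ (n : ℕ) (p p' : Eu n → P.Total), IsPlot p → IsPlot p' →
    (∀ u, P.proj (p u) = P.proj (p' u)) →
      ∃ γ : Eu n → LoopGroup E G, IsPlot γ ∧ ∀ u, p' u = P.act (p u) (γ u)
  local_lift : ∀ (n : ℕ) (x : Eu n → P.Base), IsPlot x → ∀ u, ∃ p : Eu n → P.Total, IsPlot p ∧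
    (fun w => P.proj (p w)) =ᶠ[𝓝 u] x

/-- The data of a connection form: for a plot `p` of `P`, `A n p u θ v` is the value at `θ ∈ S¹` of
the loop `(p^*A)_u(v)` in the Lie algebra. -/
abbrev PreConnection (P : OmegaSpace E G) : Type _ :=
  ∀ n : ℕ, (Eu n → P.Total) → Eu n → Circ → (Eu n →L[ℝ] E)

/-- `A` is a connection of `P`: a smooth `1`-form on `P` with values in the Lie algebra
`Ω𝔤 = {ξ : S¹ → 𝔤 smooth, ξ(0) = 0}` of `ΩG`, equivariant under `ΩG` and reproducing the generators
of the vertical vectors. -/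
structure IsConnection (P : OmegaSpace E G) (A : PreConnection P) : Prop where
  smooth : ∀ (n : ℕ) (p : Eu n → P.Total), IsPlot p →
    ContDiff ℝ ∞ fun x : Eu n × ℝ => A n p x.1 (x.2 : Circ)
  natural : ∀ (n m : ℕ) (p : Eu n → P.Total), IsPlot p → ∀ ψ : Eu m → Eu n, ContDiff ℝ ∞ ψ →
    ∀ u θ, A m (p ∘ ψ) u θ = (A n p (ψ u) θ).comp (fderiv ℝ ψ u)
  based : ∀ (n : ℕ) (p : Eu n → P.Total), IsPlot p → ∀ u, A n p u 0 = 0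
  equivariant : ∀ (n : ℕ) (p : Eu n → P.Total), IsPlot p → ∀ (γ : LoopGroup E G) (u : Eu n) θ,
    A n (fun w => P.act (p w) γ) u θ = (Ad (γ.1 θ)⁻¹).comp (A n p u θ)
  vertical : ∀ (n : ℕ) (p : P.Total) (γ : Eu n → LoopGroup E G), IsPlot γ → ∀ u θ,
    A n (fun w => P.act p (γ w)) u θ = leftMC (fun w => (γ w).1 θ) u

/-- `Φ` is a Higgs field of `P`: a smooth map from `P` to the smooth maps `S¹ → 𝔤` with
`Φ(pγ) = Ad(γ⁻¹) Φ(p) + γ⁻¹∂γ`. -/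
structure IsHiggs (P : OmegaSpace E G) (Φ : P.Total → Circ → E) : Prop where
  smooth : ∀ (n : ℕ) (p : Eu n → P.Total), IsPlot p →
    ContDiff ℝ ∞ fun x : Eu n × ℝ => Φ (p x.1) (x.2 : Circ)
  equivariant : ∀ (p : P.Total) (γ : LoopGroup E G) (t : ℝ),
    Φ (P.act p γ) (t : Circ) =
      Ad (γ.1 (t : Circ))⁻¹ (Φ p (t : Circ)) + logDeriv (fun s : ℝ => γ.1 (s : Circ)) t

/-! ## The caloron transform -/

/-- The relation `(p, g, θ) ∼ (pγ, γ(θ)⁻¹ g, θ)` on `P × G × S¹`. -/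
def caloronRel (P : OmegaSpace E G) (x y : P.Total × G × Circ) : Prop :=
  ∃ γ : LoopGroup E G, y = (P.act x.1 γ, (γ.1 x.2.2)⁻¹ * x.2.1, x.2.2)

/-- The total space `(P × G × S¹)/ΩG` of the caloron transform `𝒞(P)`. -/
def Caloron (P : OmegaSpace E G) : Type _ := Quot (caloronRel P)

/-- The diffeology of `P × G × S¹`. -/
@[reducible]
def tripleDiffeology (P : OmegaSpace E G) : DiffeologicalSpace (P.Total × G × Circ) :=
  letI := manifoldDiffeology E G
  inferInstance

instance (P : OmegaSpace E G) : DiffeologicalSpace (Caloron P) :=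
  letI := tripleDiffeology P
  quotientDiffeology (Quot.mk (caloronRel P)) Quot.mk_surjective

/-- The class `[p, g, θ]`. -/
def Caloron.mk (P : OmegaSpace E G) (p : P.Total) (g : G) (θ : Circ) : Caloron P :=
  Quot.mk _ (p, g, θ)

theorem Caloron.isPlot_mk (P : OmegaSpace E G) {n : ℕ} {p : Eu n → P.Total} {g : Eu n → G}
    {θ : Eu n → Circ} (hp : IsPlot p) (hg : ContMDiff 𝓘(ℝ, Eu n) 𝓘(ℝ, E) ∞ g) (hθ : IsPlot θ) :
    IsPlot fun u => Caloron.mk P (p u) (g u) (θ u) :=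
  fun _ => ⟨fun u => (p u, g u, θ u), ⟨hp, hg, hθ⟩, Filter.EventuallyEq.rfl⟩

/-- The projection `𝒞(P) → M × S¹`, `[p, g, θ] ↦ (π(p), θ)`. -/
def Caloron.proj (P : OmegaSpace E G) : Caloron P → P.Base × Circ :=
  Quot.lift (fun x => (P.proj x.1, x.2.2)) (by
    rintro x y ⟨γ, rfl⟩
    simp [P.proj_act])

theorem Caloron.proj_smooth (P : OmegaSpace E G) : DSmooth (Caloron.proj P) := by
  intro n c hc
  refine isPlot_of_locally fun x => ?_
  obtain ⟨r, hr, h⟩ := hc x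
  refine ⟨fun u => (P.proj (r u).1, (r u).2.2), ⟨hr.1.dSmooth_comp P.proj_smooth, hr.2.2⟩, ?_⟩
  filter_upwards [h] with y hy
  simp only [Function.comp_apply, hy]
  rfl

/-- The connection form `Ã = Ad(g⁻¹) A(θ) + Θ + Ad(g⁻¹) Φ dθ` on `P × G × S¹` descends to the
`𝔤`-valued `1`-form `B` on `𝒞(P)`. -/
def IsCaloronConnection (P : OmegaSpace E G) (A : PreConnection P) (Φ : P.Total → Circ → E)
    (B : DForm (Caloron P) 1 E) : Prop :=
  ∀ (n : ℕ) (p : Eu n → P.Total) (g : Eu n → G) (θ : Eu n → Circ) (hp : IsPlot p)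
    (hg : ContMDiff 𝓘(ℝ, Eu n) 𝓘(ℝ, E) ∞ g) (hθ : IsPlot θ) (u v : Eu n),
    B.on (fun w => Caloron.mk P (p w) (g w) (θ w)) (Caloron.isPlot_mk P hp hg hθ) u (fun _ => v) =
      Ad (g u)⁻¹ (A n p u (θ u) v) + leftMC g u v + dTheta θ u v • Ad (g u)⁻¹ (Φ (p u) (θ u))

variable (E G) in
/-- An element of `I^k(𝔤)`: a symmetric, `Ad`-invariant multilinear function of `k` variables
on `𝔤`. -/
structure InvPoly (k : ℕ) where
  toFun : ContinuousMultilinearMap ℝ (fun _ : Fin k => E) ℝ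
  symm : ∀ (σ : Equiv.Perm (Fin k)) (v : Fin k → E), toFun (v ∘ σ) = toFun v
  inv : ∀ (g : G) (v : Fin k → E), toFun (fun i => Ad g (v i)) = toFun v

variable [FiniteDimensional ℝ E]

/-- The curvature `F = dB + ½[B, B]` of a `𝔤`-valued `1`-form `B`, on a plot. -/
def curvature {X : Type*} [DiffeologicalSpace X] (B : DForm X 1 E) {n : ℕ} (p : Eu n → X)
    (hp : IsPlot p) (u : Eu n) : Eu n [⋀^Fin 2]→L[ℝ] E :=
  (d X 1 E B).on p hp u +
    (1 / 2 : ℝ) • formEval (q := fun _ => 1) (bracket E G) (fun _ => B.on p hp u) (by simp)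

/-- `c` is the Chern-Weil form on `M × S¹` of the form `B` on `𝒞(P)`: its pull-back to `𝒞(P)` is
`f(F, …, F)` with `F` the curvature of `B`. -/
def IsChernWeilForm (P : OmegaSpace E G) (B : DForm (Caloron P) 1 E) {k : ℕ} (f : InvPoly E G k)
    (c : DForm (P.Base × Circ) (2 * k) ℝ) : Prop :=
  ∀ (n : ℕ) (p : Eu n → Caloron P) (hp : IsPlot p) (u : Eu n),
    c.on (Caloron.proj P ∘ p) (hp.dSmooth_comp (Caloron.proj_smooth P)) u =
      formEval (q := fun _ => 2) f.toFun (fun _ => curvature (G := G) B p hp u)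
        (by simp [mul_comm])

end Bundles

/-! ## Integration over the fibre `S¹` -/

section FibreIntegral

/-- `(u, t)` as a point of `ℝⁿ⁺¹`. -/
def snoc {n : ℕ} (u : Eu n) (t : ℝ) : Eu (n + 1) :=
  WithLp.toLp 2 (Fin.snoc (α := fun _ => ℝ) (fun i => u i) t)

/-- The first `n` coordinates of a point of `ℝⁿ⁺¹`. -/
def initial {n : ℕ} (w : Eu (n + 1)) : Eu n := WithLp.toLp 2 fun i => w (Fin.castSucc i)

/-- The plot `(u, t) ↦ (p(u), t mod 2π)` of `M × S¹`. -/
def cylinder {M : Type*} {n : ℕ} (p : Eu n → M) (w : Eu (n + 1)) : M × Circ :=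
  (p (initial w), (w (Fin.last n) : Circ))

theorem isPlot_cylinder {M : Type*} [DiffeologicalSpace M] {n : ℕ} {p : Eu n → M} (hp : IsPlot p) :
    IsPlot (cylinder p) := by
  refine ⟨isPlot_reparam hp (f := initial) ?_, fun _ => ⟨fun w => w (Fin.last n), ?_,
    Filter.EventuallyEq.rfl⟩⟩
  · unfold initial
    fun_prop
  · show ContDiff ℝ ∞ fun w : Eu (n + 1) => w (Fin.last n)
    fun_prop

/-- `η` is the integral of `c` over the fibre of `M × S¹ → M`:
`η(v₁, …, v_j) = ∫₀^{2π} c(v₁, …, v_j, ∂_θ) dθ`, so that `∫ β dθ = (∫ β) dθ` for forms `β` without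
`dθ`. -/
def IsFibreIntegral {M : Type*} [DiffeologicalSpace M] {j : ℕ} (c : DForm (M × Circ) (j + 1) ℝ)
    (η : DForm M j ℝ) : Prop :=
  ∀ (n : ℕ) (p : Eu n → M) (hp : IsPlot p) (u : Eu n) (v : Fin j → Eu n),
    η.on p hp u v = ∫ t in (0 : ℝ)..(2 * Real.pi),
      c.on (cylinder p) (isPlot_cylinder hp) (snoc u t)
        (Fin.snoc (α := fun _ => Eu (n + 1)) (fun i => snoc (v i) 0) (snoc 0 1))

end FibreIntegral

/-! ## String forms and string classes -/

section StringForms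

variable {E : Type*} [NormedAddCommGroup E] [NormedSpace ℝ E] [FiniteDimensional ℝ E]
  {G : Type*} [TopologicalSpace G] [ChartedSpace E G] [Group G] [LieGroup 𝓘(ℝ, E) ∞ G]

/-- `η` is the string form `s_f(A, Φ) = ∫_{S¹} cw_f(Ã)`, of degree `2k - 1` for an invariant
polynomial `f` of degree `k = m + 1`. -/
def IsStringForm (P : OmegaSpace E G) (A : PreConnection P) (Φ : P.Total → Circ → E) {m : ℕ}
    (f : InvPoly E G (m + 1)) (η : DForm P.Base (2 * m + 1) ℝ) : Prop :=
  ∃ (B : DForm (Caloron P) 1 E) (c : DForm (P.Base × Circ) (2 * (m + 1)) ℝ),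
    IsCaloronConnection P A Φ B ∧ IsChernWeilForm P B f c ∧ IsFibreIntegral (j := 2 * m + 1) c η

/-- `s ∈ H^{2k-1}(M)` is the string class `s_f(P)`: for every connection and Higgs field of `P` the
string form exists, is closed, and its de Rham class is `s`. -/
def IsStringClass (P : OmegaSpace E G) {m : ℕ} (f : InvPoly E G (m + 1))
    (s : DeRhamH P.Base (2 * m)) : Prop :=
  ∀ (A : PreConnection P) (Φ : P.Total → Circ → E), IsConnection P A → IsHiggs P Φ →
    (∃ η, IsStringForm P A Φ f η) ∧
      ∀ η, IsStringForm P A Φ f η → ∃ hη : d P.Base (2 * m + 1) ℝ η = 0, deRhamClass η hη = s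

end StringForms

/-! ## The path fibration -/

section PathFibration

variable (E : Type*) [NormedAddCommGroup E] [NormedSpace ℝ E]
  (G : Type*) [TopologicalSpace G] [ChartedSpace E G] [Group G] [LieGroup 𝓘(ℝ, E) ∞ G]

/-- The space `PG` of smooth paths `p : ℝ → G` with `p(0) = 1` and `p⁻¹∂p` periodic. -/
def PathSpace : Type _ :=
  {p : ℝ → G // ContMDiff 𝓘(ℝ, ℝ) 𝓘(ℝ, E) ∞ p ∧ p 0 = 1 ∧
    Function.Periodic (logDeriv (E := E) p) (2 * Real.pi)}

instance : DiffeologicalSpace (PathSpace E G) := mapDiffeology E G (fun p => p.1) fun p => p.2.1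

variable {E G} in
/-- The action `(pγ)(t) = p(t) γ(t)` of `ΩG` on `PG`. -/
def PathSpace.act (p : PathSpace E G) (γ : LoopGroup E G) : PathSpace E G :=
  ⟨fun t => p.1 t * γ.1 (t : Circ), p.2.1.mul γ.2.1, by simp [p.2.2.1, γ.2.2], by
    have hp : MDifferentiable 𝓘(ℝ, ℝ) 𝓘(ℝ, E) p.1 := p.2.1.mdifferentiable (by simp)
    have hγ : MDifferentiable 𝓘(ℝ, ℝ) 𝓘(ℝ, E) (fun t : ℝ => γ.1 (t : Circ)) :=
      γ.2.1.mdifferentiable (by simp)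
    have hc : ∀ s : ℝ, ((s + 2 * Real.pi : ℝ) : Circ) = (s : Circ) := fun s => by
      rw [Real.Angle.coe_add, Real.Angle.coe_two_pi, add_zero]
    intro t
    have h1 := logDeriv_add_const hγ (2 * Real.pi) t
    simp only [hc] at h1
    rw [logDeriv_mul (hp _) (hγ _), logDeriv_mul (hp _) (hγ _), p.2.2.2 t, hc, h1]⟩

/-- The path fibration `PG → G`, `p ↦ p(2π)`. -/
def pathFibration : OmegaSpace E G where
  Base := G
  Total := PathSpace E G
  baseDiff := manifoldDiffeology E G
  proj p := p.1 (2 * Real.pi)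
  act := PathSpace.act
  proj_smooth n p hp := by
    have h : ContDiff ℝ ∞ (fun u : Eu n => (u, 2 * Real.pi)) := contDiff_id.prodMk contDiff_const
    have hp' : ContMDiff 𝓘(ℝ, Eu n × ℝ) 𝓘(ℝ, E) ∞ (fun x : Eu n × ℝ => (p x.1).1 x.2) := hp
    exact hp'.comp h.contMDiff
  act_smooth _ _ hx := ContMDiff.mul hx.1 hx.2
  act_one p := Subtype.ext (funext fun t => by simp [PathSpace.act])
  act_mul p γ δ := Subtype.ext (funext fun t => by simp [PathSpace.act, mul_assoc])
  proj_act p γ := by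
    have : ((2 * Real.pi : ℝ) : Circ) = 0 := Real.Angle.coe_two_pi
    simp only [PathSpace.act, this, γ.2.2, mul_one]

variable {E G}

/-- The standard connection `A = Θ - α Ad(p⁻¹) π^*Θ̂` of the path fibration. The formula is used on
`[0, 2π)`, and `A` is extended periodically. -/
def stdConnection (α : ℝ → ℝ) : PreConnection (pathFibration E G) :=
  fun _ (p : _ → PathSpace E G) u θ =>
    leftMC (fun w => (p w).1 (angleRep θ)) u -
      α (angleRep θ) • (Ad ((p u).1 (angleRep θ))⁻¹).comp
        (rightMC (G := G) (fun w => (pathFibration E G).proj (p w)) u)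

variable (E G) in
/-- The standard Higgs field `Φ(p) = p⁻¹∂p` of the path fibration. -/
def stdHiggs : (pathFibration E G).Total → Circ → E :=
  fun (p : PathSpace E G) => p.2.2.2.lift

variable [FiniteDimensional ℝ E]

/-- The pull-back of `f(Θ, [Θ, Θ], …, [Θ, Θ])` along `p : ℝⁿ → G`, for an invariant polynomial `f`
of degree `m + 1`. -/
def mcPolynomial {m : ℕ} (f : InvPoly E G (m + 1)) {n : ℕ} (p : Eu n → G) (u : Eu n) :
    Eu n [⋀^Fin (2 * m + 1)]→L[ℝ] ℝ :=
  let Θ : Eu n [⋀^Fin 1]→L[ℝ] E :=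
    ContinuousAlternatingMap.ofSubsingleton ℝ (Eu n) E (0 : Fin 1) (leftMC p u)
  let ΘΘ : Eu n [⋀^Fin 2]→L[ℝ] E :=
    formEval (q := fun _ => 1) (bracket E G) (fun _ => Θ) (by simp)
  formEval (q := Fin.cons 1 fun _ => 2) f.toFun
    (Fin.cases (motive := fun i =>
      Eu n [⋀^Fin ((Fin.cons 1 fun _ => 2 : Fin (m + 1) → ℕ) i)]→L[ℝ] E) Θ fun _ => ΘΘ)
    (by simp [Fin.sum_univ_succ]; ring)

end PathFibration

end StringForm

end

open StringForm

open scoped Manifold ContDiff Topology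

noncomputable section

namespace StringForm

open Diffeology

set_option linter.unusedSectionVars false

/-! ## Calculus with maps into a Lie group -/

section LieCalculus

variable {E : Type*} [NormedAddCommGroup E] [NormedSpace ℝ E]
  {G : Type*} [TopologicalSpace G] [ChartedSpace E G] [Group G]
  {U : Type*} [NormedAddCommGroup U] [NormedSpace ℝ U]
  {U' : Type*} [NormedAddCommGroup U'] [NormedSpace ℝ U']

/-! All computations take place on plots, where a form on `𝒞(P)` or on `M × S¹` becomes an ordinary
form on some `ℝⁿ`. On a plot `(p, θ)` of `P × S¹` put `b = A(θ) + Φ dθ` (`caloronForm`). Replacing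
`p` by `pγ` replaces `b` by its gauge transform under `γ(θ)` (`caloronForm_act`): the Higgs
condition supplies exactly the term `γ⁻¹∂γ dθ`. The caloron connection is the gauge transform of `b`
by the coordinate `g`, so it descends to `𝒞(P)`. By `curv_gauge` curvature transforms by `Ad`, so
`f(F, …, F)` is gauge invariant (`cwForm_gauge`) and descends to `M × S¹`; `isChernWeilForm_iff`
then removes `𝒞(P)` from the discussion.

Chern-Weil forms are closed (`extDeriv_cwForm`): near a given point a gauge is chosen in which `b`
vanishes at that point, and there the Bianchi identity reduces to the symmetry of second
derivatives. The homotopy formula `d_integrate_add` on `M × ℝ` is used twice. Over `[0, 2π]` its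
boundary terms agree, so string forms are closed. Over `[0, 1]`, applied to the string form of an
affine interpolation on `P × ℝ`, it gives a primitive of the difference of two string forms, hence
independence of the choices (`deRhamClass_eq_of_isStringForm`).

For the path fibration, `p(t + 2π) = p(2π) p(t)`. This makes the quotient of two paths with equal
end points periodic, and makes the standard connection smooth across multiples of `2π`, where `α`
passes from `1` to `0`. Local lifts multiply a fixed path to a point of `G` by short paths that are
straight in the chart at `1`; connectedness provides the fixed path.

The string form itself is computed by one observation. Let `x = p(2π)`. By `caloronForm_std` the
standard `b` on `0 < t < 2π` is the gauge transform by `p(t)` of `-α(t) x^*Θ̂`. Its Chern-Weil form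
is therefore that of the gauge transform of the same form by `x`, which is `(1 - α) x^*Θ`, with
curvature `-α' dt ∧ Θ - ½ α(1 - α)[Θ, Θ]`. Contraction with `∂_t` gives `-(m + 1)(-½)^m α' (α(1 -
α))^m f(Θ, [Θ, Θ], …)` (`contractLast_cwForm_smul_leftMC`). The substitution by `α` turns the
integral over `t` into the Beta integral `m!²/(2m + 1)!`, and moving `∂_θ` from the first to the
last slot contributes the remaining sign. -/

/-- The chart at the identity, shifted so as to take the value `0` there. -/
def chartOne (g : G) : E := extChartAt 𝓘(ℝ, E) (1 : G) g - extChartAt 𝓘(ℝ, E) (1 : G) 1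

/-- The inverse of `chartOne`. -/
def chartOneInv (x : E) : G := (extChartAt 𝓘(ℝ, E) (1 : G)).symm (extChartAt 𝓘(ℝ, E) (1 : G) 1 + x)

@[simp] theorem chartOne_one : chartOne (1 : G) = (0 : E) := sub_self _

@[simp] theorem chartOneInv_zero : chartOneInv (0 : E) = (1 : G) := by simp [chartOneInv]

theorem chartOneInv_chartOne : ∀ᶠ g : G in 𝓝 1, chartOneInv (chartOne (E := E) g) = g := by
  filter_upwards [extChartAt_source_mem_nhds (I := 𝓘(ℝ, E)) (1 : G)] with g hg
  have h := (extChartAt 𝓘(ℝ, E) (1 : G)).left_inv hg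
  rwa [chartOneInv, chartOne, add_sub_cancel]

theorem chartOne_chartOneInv : ∀ᶠ x : E in 𝓝 0, chartOne (chartOneInv x : G) = x := by
  have h1 : Filter.Tendsto (fun x : E => extChartAt 𝓘(ℝ, E) (1 : G) 1 + x) (𝓝 0)
      (𝓝 (extChartAt 𝓘(ℝ, E) (1 : G) 1)) := by
    have : Continuous fun x : E => extChartAt 𝓘(ℝ, E) (1 : G) 1 + x := by fun_prop
    simpa using this.tendsto 0
  filter_upwards [h1 (extChartAt_target_mem_nhds (I := 𝓘(ℝ, E)) (1 : G))] with x hx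
  have h := (extChartAt 𝓘(ℝ, E) (1 : G)).right_inv hx
  rw [chartOneInv, chartOne, h, add_sub_cancel_left]

/-- `mfderiv` is read in the preferred charts at the point and at its image. When the image is `1`,
the target chart is the fixed chart at the identity, and the shift in `chartOne` does not affect
derivatives. -/
theorem fderiv_chartOne_comp_eq_mfderiv {N : U → G} {u : U} (hN : N u = 1)
    (h : MDifferentiableAt 𝓘(ℝ, U) 𝓘(ℝ, E) N u) :
    (mfderiv 𝓘(ℝ, U) 𝓘(ℝ, E) N u : U →L[ℝ] E) = fderiv ℝ (fun w => chartOne (E := E) (N w)) u := by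
  have h1 : (mfderiv 𝓘(ℝ, U) 𝓘(ℝ, E) N u : U →L[ℝ] E) =
      fderivWithin ℝ (writtenInExtChartAt 𝓘(ℝ, U) 𝓘(ℝ, E) u N) (Set.range 𝓘(ℝ, U))
        (extChartAt 𝓘(ℝ, U) u u) := if_pos h
  rw [h1]
  simp only [chartOne, fderiv_sub_const, writtenInExtChartAt, hN, extChartAt_model_space_eq_id,
    PartialEquiv.refl_symm, PartialEquiv.refl_coe, Function.comp_id, id,
    modelWithCornersSelf_coe, Set.range_id, fderivWithin_univ]
  rfl

variable [LieGroup 𝓘(ℝ, E) ∞ G]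

theorem contMDiffAt_chartOne {g : G} (hg : g ∈ (extChartAt 𝓘(ℝ, E) (1 : G)).source) :
    ContMDiffAt 𝓘(ℝ, E) 𝓘(ℝ, E) ∞ (chartOne (E := E) (G := G)) g := by
  have h1 : ContMDiffAt 𝓘(ℝ, E) 𝓘(ℝ, E) ∞ (extChartAt 𝓘(ℝ, E) (1 : G)) g :=
    contMDiffAt_extChartAt' (by simpa using hg)
  exact h1.sub contMDiffAt_const

theorem contMDiffAt_chartOne_one :
    ContMDiffAt 𝓘(ℝ, E) 𝓘(ℝ, E) ∞ (chartOne (E := E) (G := G)) 1 :=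
  contMDiffAt_chartOne (mem_extChartAt_source _)

theorem eventually_contMDiffAt_chartOneInv :
    ∀ᶠ x in 𝓝 (0 : E), ContMDiffAt 𝓘(ℝ, E) 𝓘(ℝ, E) ∞ (chartOneInv (E := E) (G := G)) x := by
  have h1 : Filter.Tendsto (fun x : E => extChartAt 𝓘(ℝ, E) (1 : G) 1 + x) (𝓝 0)
      (𝓝 (extChartAt 𝓘(ℝ, E) (1 : G) 1)) := by
    have : Continuous fun x : E => extChartAt 𝓘(ℝ, E) (1 : G) 1 + x := by fun_prop
    simpa using this.tendsto 0
  have h2 := (isOpen_extChartAt_target (I := 𝓘(ℝ, E)) (1 : G)).mem_nhds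
    (mem_extChartAt_target (I := 𝓘(ℝ, E)) (1 : G))
  filter_upwards [h1 h2] with x hx
  have h3 : ContMDiffAt 𝓘(ℝ, E) 𝓘(ℝ, E) ∞ (extChartAt 𝓘(ℝ, E) (1 : G)).symm
      (extChartAt 𝓘(ℝ, E) (1 : G) 1 + x) :=
    (contMDiffOn_extChartAt_symm (1 : G)).contMDiffAt
      ((isOpen_extChartAt_target (I := 𝓘(ℝ, E)) (1 : G)).mem_nhds hx)
  have h4 : ContMDiffAt 𝓘(ℝ, E) 𝓘(ℝ, E) ∞ (fun x : E => extChartAt 𝓘(ℝ, E) (1 : G) 1 + x) x :=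
    (contDiff_const.add contDiff_id).contMDiff x
  exact ContMDiffAt.comp x h3 h4

theorem contMDiffAt_chartOneInv :
    ContMDiffAt 𝓘(ℝ, E) 𝓘(ℝ, E) ∞ (chartOneInv (E := E) (G := G)) 0 :=
  eventually_contMDiffAt_chartOneInv.self_of_nhds

/-- The derivative of `φ` at `u` is taken in the chart at `φ u`, which depends on `u` in no
controlled way. After translation to `1` only the chart at the identity occurs, so the right-hand
side can be differentiated in `u`. -/
theorem leftMC_eq_fderiv {φ : U → G} {u : U} (h : MDifferentiableAt 𝓘(ℝ, U) 𝓘(ℝ, E) φ u) :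
    leftMC φ u = fderiv ℝ (fun w => chartOne (E := E) ((φ u)⁻¹ * φ w)) u := by
  have h1 : MDifferentiableAt 𝓘(ℝ, U) 𝓘(ℝ, E) (fun w => (φ u)⁻¹ * φ w) u :=
    MDifferentiableAt.comp u (mdiff_mul_left (φ u)⁻¹ (φ u)) h
  rw [← fderiv_chartOne_comp_eq_mfderiv (by simp) h1]
  exact (mfderiv_comp (I := 𝓘(ℝ, U)) u (g := fun y => (φ u)⁻¹ * y) (mdiff_mul_left _ _) h).symm

theorem leftMC_comp {φ : U → G} {ψ : U' → U} {u : U'}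
    (h : MDifferentiableAt 𝓘(ℝ, U) 𝓘(ℝ, E) φ (ψ u)) (hψ : DifferentiableAt ℝ ψ u) :
    leftMC (E := E) (fun w => φ (ψ w)) u = (leftMC φ (ψ u)).comp (fderiv ℝ ψ u) := by
  have h1 := mfderiv_comp (I := 𝓘(ℝ, U')) u h hψ.mdifferentiableAt
  rw [mfderiv_eq_fderiv] at h1
  exact congrArg (fun L : U' →L[ℝ] E => (maurerCartan (E := E) (φ (ψ u))).comp L) h1

theorem leftMC_congr {φ ψ : U → G} {u : U} (h : φ =ᶠ[𝓝 u] ψ) :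
    leftMC (E := E) φ u = leftMC ψ u := by
  have h1 : (mfderiv 𝓘(ℝ, U) 𝓘(ℝ, E) φ u : U →L[ℝ] E) = mfderiv 𝓘(ℝ, U) 𝓘(ℝ, E) ψ u :=
    h.mfderiv_eq
  unfold leftMC
  rw [h.self_of_nhds]
  exact congrArg _ h1

theorem leftMC_eq_logDeriv {φ : U → G} {u v : U} (h : MDifferentiableAt 𝓘(ℝ, U) 𝓘(ℝ, E) φ u) :
    leftMC (E := E) φ u v = logDeriv (fun s : ℝ => φ (u + s • v)) 0 := by
  have h1 : HasDerivAt (fun s : ℝ => u + s • v) v 0 := by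
    simpa using ((hasDerivAt_id (0 : ℝ)).smul_const v).const_add u
  rw [logDeriv, leftMC_comp (φ := φ) (ψ := fun s : ℝ => u + s • v) (by simpa using h)
    h1.differentiableAt, h1.hasFDerivAt.fderiv]
  simp

/-- Evaluated on `v`, both sides depend only on the line `u + s v`, where the identity is
`logDeriv_mul`. -/
theorem leftMC_mul {φ ψ : U → G} {u : U} (hφ : MDifferentiableAt 𝓘(ℝ, U) 𝓘(ℝ, E) φ u)
    (hψ : MDifferentiableAt 𝓘(ℝ, U) 𝓘(ℝ, E) ψ u) :
    leftMC (E := E) (fun w => φ w * ψ w) u = (Ad (ψ u)⁻¹).comp (leftMC φ u) + leftMC ψ u := by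
  ext v
  have hl : MDifferentiableAt 𝓘(ℝ, ℝ) 𝓘(ℝ, U) (fun s : ℝ => u + s • v) 0 := by
    apply DifferentiableAt.mdifferentiableAt
    fun_prop
  have h1 := MDifferentiableAt.comp (I' := 𝓘(ℝ, U)) (0 : ℝ) (g := φ) (by simpa using hφ) hl
  have h2 := MDifferentiableAt.comp (I' := 𝓘(ℝ, U)) (0 : ℝ) (g := ψ) (by simpa using hψ) hl
  have h3 : MDifferentiableAt 𝓘(ℝ, U) 𝓘(ℝ, E) (fun w => φ w * ψ w) u := by
    have hm : MDifferentiableAt (𝓘(ℝ, E).prod 𝓘(ℝ, E)) 𝓘(ℝ, E) (fun x : G × G => x.1 * x.2)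
      (φ u, ψ u) := (contMDiff_mul 𝓘(ℝ, E) (n := ∞)).mdifferentiable (by simp) _
    exact MDifferentiableAt.comp u hm (hφ.prodMk hψ)
  rw [leftMC_eq_logDeriv h3, add_apply, ContinuousLinearMap.comp_apply,
    leftMC_eq_logDeriv hφ, leftMC_eq_logDeriv hψ]
  have h4 := logDeriv_mul h1 h2
  simpa [Function.comp_def] using h4

theorem leftMC_const (g : G) (u : U) : leftMC (E := E) (fun _ : U => g) u = 0 := by
  have h : (mfderiv 𝓘(ℝ, U) 𝓘(ℝ, E) (fun _ : U => g) u : U →L[ℝ] E) = 0 := mfderiv_const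
  unfold leftMC
  exact (congrArg _ h).trans (ContinuousLinearMap.comp_zero _)

theorem rightMC_const (g : G) (u : U) : rightMC (E := E) (fun _ : U => g) u = 0 := by
  have h : (mfderiv 𝓘(ℝ, U) 𝓘(ℝ, E) (fun _ : U => g) u : U →L[ℝ] E) = 0 := mfderiv_const
  unfold rightMC
  exact (congrArg _ h).trans (ContinuousLinearMap.comp_zero _)

theorem mdiff_conj (g x : G) :
    MDifferentiableAt 𝓘(ℝ, E) 𝓘(ℝ, E) (fun y : G => g * y * g⁻¹) x :=
  MDifferentiableAt.comp (I' := 𝓘(ℝ, E)) x (g := fun y : G => y * g⁻¹)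
    (mdiff_mul_right _ _) (mdiff_mul_left _ _)

theorem Ad_mul (g h : G) : Ad (E := E) (g * h) = (Ad g).comp (Ad h) := by
  ext v
  have e := mfderiv_comp_apply_of_eq (I := 𝓘(ℝ, E)) (x := (1 : G)) (y := 1)
    (f := fun x => h * x * h⁻¹) (g := fun x => g * x * g⁻¹) (mdiff_conj g _) (mdiff_conj h _)
    (by simp) v
  have e3 : (fun x : G => g * x * g⁻¹) ∘ (fun x => h * x * h⁻¹) =
      fun x => g * h * x * (g * h)⁻¹ := by
    funext z
    simp [mul_assoc]
  rw [e3] at e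
  exact e

theorem Ad_one : Ad (E := E) (1 : G) = ContinuousLinearMap.id ℝ E := by
  have : (fun x : G => 1 * x * 1⁻¹) = id := by funext x; simp
  unfold Ad
  rw [this]
  exact mfderiv_id

@[simp] theorem Ad_inv_apply_Ad (g : G) (v : E) : Ad g⁻¹ (Ad g v) = v := by
  rw [← ContinuousLinearMap.comp_apply, ← Ad_mul]
  simp [Ad_one]

theorem leftMC_const_mul (g : G) {φ : U → G} {u : U}
    (hφ : MDifferentiableAt 𝓘(ℝ, U) 𝓘(ℝ, E) φ u) :
    leftMC (E := E) (fun w => g * φ w) u = leftMC φ u := by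
  rw [leftMC_mul mdifferentiableAt_const hφ, leftMC_const]
  simp

theorem leftMC_mul_const (g : G) {φ : U → G} {u : U}
    (hφ : MDifferentiableAt 𝓘(ℝ, U) 𝓘(ℝ, E) φ u) :
    leftMC (E := E) (fun w => φ w * g) u = (Ad g⁻¹).comp (leftMC φ u) := by
  rw [leftMC_mul hφ mdifferentiableAt_const, leftMC_const]
  simp

theorem mdifferentiableAt_inv {φ : U → G} {u : U}
    (hφ : MDifferentiableAt 𝓘(ℝ, U) 𝓘(ℝ, E) φ u) :
    MDifferentiableAt 𝓘(ℝ, U) 𝓘(ℝ, E) (fun w => (φ w)⁻¹) u :=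
  MDifferentiableAt.comp u (((contMDiff_inv 𝓘(ℝ, E) ∞).mdifferentiable (by simp)) (φ u)) hφ

theorem leftMC_inv {φ : U → G} {u : U} (hφ : MDifferentiableAt 𝓘(ℝ, U) 𝓘(ℝ, E) φ u) :
    leftMC (E := E) (fun w => (φ w)⁻¹) u = -(Ad (φ u)).comp (leftMC φ u) := by
  have h := leftMC_mul hφ (mdifferentiableAt_inv hφ)
  simp only [mul_inv_cancel, leftMC_const, inv_inv] at h
  exact eq_neg_of_add_eq_zero_right h.symm

/-- Chain rule for `x g⁻¹ = g (g⁻¹ x) g⁻¹` at `x = g`. -/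
theorem rightMC_eq (φ : U → G) (u : U) :
    rightMC (E := E) φ u = (Ad (φ u)).comp (leftMC φ u) := by
  ext v
  have key : ∀ (g : G) (v : E), maurerCartanR (E := E) g v = Ad g (maurerCartan g v) := by
    intro g v
    have e := mfderiv_comp_apply_of_eq (I := 𝓘(ℝ, E)) (x := g) (y := 1) (f := fun x => g⁻¹ * x)
      (g := fun x => g * x * g⁻¹) (mdiff_conj g _) (mdiff_mul_left _ _) (by simp) v
    have e3 : (fun x : G => g * x * g⁻¹) ∘ (fun x => g⁻¹ * x) = fun x => x * g⁻¹ := by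
      funext z
      simp
    rw [e3] at e
    exact e
  exact key _ _

/-! ### Smoothness -/

theorem mdifferentiableAt_of_contMDiffAt {φ : U → G} {u : U} (h : ContMDiffAt 𝓘(ℝ, U) 𝓘(ℝ, E) ∞ φ u) :
    MDifferentiableAt 𝓘(ℝ, U) 𝓘(ℝ, E) φ u := h.mdifferentiableAt (by simp)

theorem eventually_contMDiffAt {φ : U → G} {u : U} (h : ContMDiffAt 𝓘(ℝ, U) 𝓘(ℝ, E) ∞ φ u) :
    ∀ᶠ w in 𝓝 u, MDifferentiableAt 𝓘(ℝ, U) 𝓘(ℝ, E) φ w := by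
  have h1 : ContMDiffAt 𝓘(ℝ, U) 𝓘(ℝ, E) 1 φ u := h.of_le (by simp)
  have := (contMDiffAt_iff_contMDiffAt_nhds (I := 𝓘(ℝ, U)) (I' := 𝓘(ℝ, E)) (n := 1) (by simp)).1 h1
  exact this.mono fun w hw => hw.mdifferentiableAt (by simp)

/-- By `leftMC_eq_fderiv` the form at `w` is the partial derivative in `y`, at `y = w`, of the
function `chartOne (φ(w)⁻¹ φ(y))`, which is jointly smooth in `(w, y)` near the diagonal point. -/
theorem contDiffAt_leftMC {φ : U → G} {u : U} (h : ContMDiffAt 𝓘(ℝ, U) 𝓘(ℝ, E) ∞ φ u) :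
    ContDiffAt ℝ ∞ (fun w => leftMC (E := E) φ w) u := by
  have h1 : ContMDiffAt 𝓘(ℝ, U × U) 𝓘(ℝ, E) ∞ (fun x : U × U => φ x.1) (u, u) :=
    ContMDiffAt.comp (I' := 𝓘(ℝ, U)) (u, u) h contDiff_fst.contMDiff.contMDiffAt
  have h2 : ContMDiffAt 𝓘(ℝ, U × U) 𝓘(ℝ, E) ∞ (fun x : U × U => φ x.2) (u, u) :=
    ContMDiffAt.comp (I' := 𝓘(ℝ, U)) (u, u) h contDiff_snd.contMDiff.contMDiffAt
  have h3 : ContMDiffAt 𝓘(ℝ, U × U) 𝓘(ℝ, E) ∞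
      (fun x : U × U => chartOne (E := E) ((φ x.1)⁻¹ * φ x.2)) (u, u) := by
    refine ContMDiffAt.comp_of_eq (I' := 𝓘(ℝ, E)) (x := (u, u)) (y := (1 : G))
      (g := chartOne (E := E)) contMDiffAt_chartOne_one (h1.inv.mul h2) (by simp)
  have h4 : ContDiffAt ℝ ∞ (fun w : U => fderiv ℝ
      (fun y : U => chartOne (E := E) ((φ w)⁻¹ * φ y)) w) u :=
    ContDiffAt.fderiv (n := ∞) (f := fun w y => chartOne (E := E) ((φ w)⁻¹ * φ y))
      (g := fun w => w) h3.contDiffAt contDiffAt_id (by simp)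
  refine h4.congr_of_eventuallyEq ?_
  filter_upwards [eventually_contMDiffAt h] with w hw
  exact leftMC_eq_fderiv hw

/-- `chartOneInv` has derivative the identity at `0`, so conjugation may be differentiated in the
chart. The result is a partial derivative of a function jointly smooth in `g` and the chart
coordinate, which gives `contDiffAt_Ad`. -/
theorem Ad_eq_fderiv (g : G) :
    Ad (E := E) g = fderiv ℝ (fun x => chartOne (g * chartOneInv x * g⁻¹)) (0 : E) := by
  have h0 := contMDiffAt_chartOneInv (E := E) (G := G)
  have h1 : MDifferentiableAt 𝓘(ℝ, E) 𝓘(ℝ, E) (fun x : E => g * chartOneInv x * g⁻¹) 0 :=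
    MDifferentiableAt.comp (I' := 𝓘(ℝ, E)) (0 : E) (g := fun y : G => g * y * g⁻¹)
      (mdiff_conj g _) (h0.mdifferentiableAt (by simp))
  rw [← fderiv_chartOne_comp_eq_mfderiv (by simp) h1]
  have h2 : (mfderiv 𝓘(ℝ, E) 𝓘(ℝ, E) (chartOneInv (E := E) (G := G)) 0 : E →L[ℝ] E) =
      ContinuousLinearMap.id ℝ E := by
    rw [fderiv_chartOne_comp_eq_mfderiv (by simp) (h0.mdifferentiableAt (by simp))]
    have : (fun x => chartOne (chartOneInv x : G)) =ᶠ[𝓝 (0 : E)] id := chartOne_chartOneInv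
    rw [this.fderiv_eq, fderiv_id]
  ext v
  have h3 := mfderiv_comp_apply_of_eq (I := 𝓘(ℝ, E)) (x := (0 : E)) (y := (1 : G))
    (f := chartOneInv (E := E) (G := G)) (g := fun x => g * x * g⁻¹) (mdiff_conj g _)
    (h0.mdifferentiableAt (by simp)) (by simp) v
  refine Eq.trans ?_ h3.symm
  exact congrArg (Ad (E := E) g) (congrArg (fun L : E →L[ℝ] E => L v) h2).symm

theorem contDiffAt_Ad {g : U → G} {u : U} (h : ContMDiffAt 𝓘(ℝ, U) 𝓘(ℝ, E) ∞ g u) :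
    ContDiffAt ℝ ∞ (fun w => Ad (E := E) (g w)) u := by
  have h1 : ContMDiffAt 𝓘(ℝ, U × E) 𝓘(ℝ, E) ∞ (fun x : U × E => g x.1) (u, 0) :=
    ContMDiffAt.comp (I' := 𝓘(ℝ, U)) (u, (0 : E)) h contDiff_fst.contMDiff.contMDiffAt
  have h2 : ContMDiffAt 𝓘(ℝ, U × E) 𝓘(ℝ, E) ∞ (fun x : U × E => (chartOneInv x.2 : G)) (u, 0) :=
    ContMDiffAt.comp (I' := 𝓘(ℝ, E)) (u, (0 : E)) (g := chartOneInv) (f := Prod.snd)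
      contMDiffAt_chartOneInv
      contDiff_snd.contMDiff.contMDiffAt
  have h3 : ContMDiffAt 𝓘(ℝ, U × E) 𝓘(ℝ, E) ∞
      (fun x : U × E => chartOne (E := E) (g x.1 * chartOneInv x.2 * (g x.1)⁻¹)) (u, 0) := by
    refine ContMDiffAt.comp_of_eq (I' := 𝓘(ℝ, E)) (x := (u, (0 : E))) (y := (1 : G))
      (g := chartOne (E := E)) contMDiffAt_chartOne_one ((h1.mul h2).mul h1.inv) (by simp)
  have h4 : ContDiffAt ℝ ∞ (fun w : U => fderiv ℝ
      (fun y : E => chartOne (E := E) (g w * chartOneInv y * (g w)⁻¹)) 0) u :=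
    ContDiffAt.fderiv (n := ∞)
      (f := fun w y => chartOne (E := E) (g w * chartOneInv y * (g w)⁻¹))
      (g := fun w => 0) h3.contDiffAt contDiffAt_const (by simp)
  simpa only [← Ad_eq_fderiv] using h4

end LieCalculus

/-! ## The Maurer-Cartan equation -/

section MaurerCartan

variable {E : Type*} [NormedAddCommGroup E] [NormedSpace ℝ E] [FiniteDimensional ℝ E]
  {G : Type*} [TopologicalSpace G] [ChartedSpace E G] [Group G] [LieGroup 𝓘(ℝ, E) ∞ G]
  {U : Type*} [NormedAddCommGroup U] [NormedSpace ℝ U]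

theorem maurerCartan_mulInvariant (g : G) (X : E) :
    maurerCartan (E := E) g (mfderiv 𝓘(ℝ, E) 𝓘(ℝ, E) (fun x : G => g * x) 1 X) = X := by
  have e := mfderiv_comp_apply_of_eq (I := 𝓘(ℝ, E)) (x := (1 : G)) (y := g) (f := fun x => g * x)
    (g := fun x => g⁻¹ * x) (mdiff_mul_left _ _) (mdiff_mul_left _ _) (by simp) X
  have e3 : (fun x : G => g⁻¹ * x) ∘ (fun x => g * x) = id := by
    funext z
    simp
  rw [e3, mfderiv_id] at e
  exact e.symm

/-- The left invariant vector field with value `X` at `1`, in the chart at `1`. -/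
def chartField (G : Type*) [TopologicalSpace G] [ChartedSpace E G] [Group G] (X : E) : E → E :=
  VectorField.mpullbackWithin 𝓘(ℝ, E) 𝓘(ℝ, E) (extChartAt 𝓘(ℝ, E) (1 : G)).symm
    (mulInvariantVectorField (I := 𝓘(ℝ, E)) (G := G) X) (Set.range 𝓘(ℝ, E))

/-- The inverse chart pushes `chartField G X` forward to the left invariant field, on which the
Maurer-Cartan form is constant. -/
theorem leftMC_chartField (X : E) {x : E} (hx : x ∈ (extChartAt 𝓘(ℝ, E) (1 : G)).target) :
    leftMC (E := E) (extChartAt 𝓘(ℝ, E) (1 : G)).symm x (chartField G X x) = X := by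
  have : IsManifold 𝓘(ℝ, E) 1 G := IsManifold.of_le (n := ∞) (by simp)
  have hinv := isInvertible_mfderivWithin_extChartAt_symm (I := 𝓘(ℝ, E)) hx
  obtain ⟨e, he⟩ := hinv
  have h1 : ∀ w, (mfderiv 𝓘(ℝ, E) 𝓘(ℝ, E) (extChartAt 𝓘(ℝ, E) (1 : G)).symm x : E →L[ℝ] E)
      ((mfderivWithin 𝓘(ℝ, E) 𝓘(ℝ, E) (extChartAt 𝓘(ℝ, E) (1 : G)).symm
        (Set.range 𝓘(ℝ, E)) x).inverse w) = w := by
    intro w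
    have h2 : (mfderiv 𝓘(ℝ, E) 𝓘(ℝ, E) (extChartAt 𝓘(ℝ, E) (1 : G)).symm x) =
      mfderivWithin 𝓘(ℝ, E) 𝓘(ℝ, E) (extChartAt 𝓘(ℝ, E) (1 : G)).symm
        (Set.range 𝓘(ℝ, E)) x := by
      rw [show Set.range 𝓘(ℝ, E) = Set.univ by simp, mfderivWithin_univ]
    rw [h2, ← he, ContinuousLinearMap.inverse_equiv]
    exact e.apply_symm_apply w
  have h3 := congrArg (maurerCartan (E := E) ((extChartAt 𝓘(ℝ, E) (1 : G)).symm x))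
    (h1 (mulInvariantVectorField (I := 𝓘(ℝ, E)) (G := G) X _))
  exact h3.trans (maurerCartan_mulInvariant _ X)

theorem contMDiffAt_extChartAt_one_symm : ContMDiffAt 𝓘(ℝ, E) 𝓘(ℝ, E) ∞
    (extChartAt 𝓘(ℝ, E) (1 : G)).symm (extChartAt 𝓘(ℝ, E) (1 : G) 1) :=
  (contMDiffOn_extChartAt_symm (1 : G)).contMDiffAt
    ((isOpen_extChartAt_target (I := 𝓘(ℝ, E)) (1 : G)).mem_nhds (mem_extChartAt_target _))

theorem leftMC_extChartAt_one_symm :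
    leftMC (E := E) (extChartAt 𝓘(ℝ, E) (1 : G)).symm (extChartAt 𝓘(ℝ, E) (1 : G) 1) =
      ContinuousLinearMap.id ℝ E := by
  rw [leftMC_eq_fderiv (contMDiffAt_extChartAt_one_symm.mdifferentiableAt (by simp))]
  have : (fun w => chartOne (E := E)
      (((extChartAt 𝓘(ℝ, E) (1 : G)).symm (extChartAt 𝓘(ℝ, E) (1 : G) 1))⁻¹ *
        (extChartAt 𝓘(ℝ, E) (1 : G)).symm w)) =ᶠ[𝓝 (extChartAt 𝓘(ℝ, E) (1 : G) 1)]
      fun w => w - extChartAt 𝓘(ℝ, E) (1 : G) 1 := by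
    filter_upwards [extChartAt_target_mem_nhds (I := 𝓘(ℝ, E)) (1 : G)] with w hw
    have h := (extChartAt 𝓘(ℝ, E) (1 : G)).right_inv hw
    rw [extChartAt_to_inv, inv_one, one_mul, chartOne, h]
  rw [this.fderiv_eq, fderiv_sub_const, fderiv_fun_id]

/-- Near the centre of the chart the field is `θ(x)⁻¹ X`, with `θ` the Maurer-Cartan form in the
chart; this gives differentiability. The derivative then follows from the product rule applied to
the constant `θ(x)(chartField G X x) = X`, since `θ` is the identity at the centre. -/
theorem hasFDerivAt_chartField (X : E) : HasFDerivAt (chartField G X)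
    (-(fderiv ℝ (leftMC (E := E) (extChartAt 𝓘(ℝ, E) (1 : G)).symm)
      (extChartAt 𝓘(ℝ, E) (1 : G) 1)).flip X) (extChartAt 𝓘(ℝ, E) (1 : G) 1) := by
  set p := extChartAt 𝓘(ℝ, E) (1 : G) 1
  set θ := leftMC (E := E) (extChartAt 𝓘(ℝ, E) (1 : G)).symm with hθ
  have hs : ContDiffAt ℝ ∞ θ p := contDiffAt_leftMC contMDiffAt_extChartAt_one_symm
  have hid : θ p = ContinuousLinearMap.id ℝ E := leftMC_extChartAt_one_symm
  have hev : ∀ᶠ x in 𝓝 p, (θ x).IsInvertible := by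
    have h1 : Set.range ((↑) : (E ≃L[ℝ] E) → E →L[ℝ] E) ∈ 𝓝 (θ p) := by
      rw [hid]
      exact ContinuousLinearEquiv.nhds (ContinuousLinearEquiv.refl ℝ E)
    filter_upwards [hs.continuousAt h1] with x hx
    obtain ⟨e, he⟩ := hx
    exact ⟨e, he⟩
  have heq : chartField G X =ᶠ[𝓝 p] fun x => (θ x).inverse X := by
    filter_upwards [hev, extChartAt_target_mem_nhds (I := 𝓘(ℝ, E)) (1 : G)] with x hx ht
    obtain ⟨e, he⟩ := hx
    have h1 : θ x (chartField G X x) = X := leftMC_chartField X ht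
    rw [← he] at h1 ⊢
    rw [ContinuousLinearMap.inverse_equiv]
    exact ((e.symm_apply_eq).2 h1.symm).symm
  have hdiff : DifferentiableAt ℝ (chartField G X) p := by
    refine DifferentiableAt.congr_of_eventuallyEq ?_ heq
    have h1 : ContDiffAt ℝ ∞ (fun x => (θ x).inverse) p := by
      refine ContDiffAt.comp p (g := ContinuousLinearMap.inverse) ?_ hs
      rw [hid]
      exact contDiffAt_map_inverse (ContinuousLinearEquiv.refl ℝ E)
    exact (h1.differentiableAt (by simp)).clm_apply (differentiableAt_const X)
  have hval : chartField G X p = X := by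
    have := leftMC_chartField (G := G) X (mem_extChartAt_target (I := 𝓘(ℝ, E)) (1 : G))
    rw [leftMC_extChartAt_one_symm] at this
    exact this
  have h1 := (hs.differentiableAt (by simp)).hasFDerivAt.clm_apply hdiff.hasFDerivAt
  have h2 : (fun x => θ x (chartField G X x)) =ᶠ[𝓝 p] fun _ => X := by
    filter_upwards [extChartAt_target_mem_nhds (I := 𝓘(ℝ, E)) (1 : G)] with x ht
    exact leftMC_chartField X ht
  have h3 := (h1.congr_of_eventuallyEq h2.symm).unique (hasFDerivAt_const X p)
  have h4 : fderiv ℝ (chartField G X) p = -(fderiv ℝ θ p).flip X := by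
    rw [hid, hval] at h3
    refine eq_neg_of_add_eq_zero_left ?_
    simpa using h3
  rw [← h4]
  exact hdiff.hasFDerivAt

/-- The manifold bracket is the bracket of the pulled back fields in the chart, transported by the
derivative of that chart; at the centre of the chart this derivative is the identity. -/
theorem lieBilin_eq_lieBracket (X Y : E) : lieBilin E G X Y =
    VectorField.lieBracket ℝ (chartField G X) (chartField G Y) (extChartAt 𝓘(ℝ, E) (1 : G) 1) := by
  have : IsManifold 𝓘(ℝ, E) 1 G := IsManifold.of_le (n := ∞) (by simp)
  have h1 : lieBilin E G X Y = VectorField.mlieBracketWithin 𝓘(ℝ, E)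
    (mulInvariantVectorField (I := 𝓘(ℝ, E)) (G := G) X)
    (mulInvariantVectorField (I := 𝓘(ℝ, E)) (G := G) Y) Set.univ 1 := rfl
  have key : (mfderiv 𝓘(ℝ, E) 𝓘(ℝ, E) (extChartAt 𝓘(ℝ, E) (1 : G)) 1 : E →L[ℝ] E).inverse =
      ContinuousLinearMap.id ℝ E := by
    rw [show (mfderiv 𝓘(ℝ, E) 𝓘(ℝ, E) (extChartAt 𝓘(ℝ, E) (1 : G)) 1 : E →L[ℝ] E) =
      ContinuousLinearMap.id ℝ E from mfderiv_extChartAt_self]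
    exact ContinuousLinearMap.inverse_id
  rw [h1, VectorField.mlieBracketWithin_apply]
  refine (congrArg (fun L : E →L[ℝ] E => L _) key).trans ?_
  rw [ContinuousLinearMap.id_apply]
  have h2 : ((extChartAt 𝓘(ℝ, E) (1 : G)).symm ⁻¹' Set.univ ∩ Set.range 𝓘(ℝ, E)) = Set.univ := by
    simp
  rw [h2]
  have h3 := congrFun (VectorField.lieBracketWithin_univ (𝕜 := ℝ) (V := chartField G X)
    (W := chartField G Y)) (extChartAt 𝓘(ℝ, E) (1 : G) 1)
  exact h3

/-- The Maurer-Cartan equation at one point, for one map. The derivatives of the left invariant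
fields give the two terms of `dΘ`, and their commutator is the bracket. The general case follows by
translation and pull-back. -/
theorem maurerCartan_chart (X Y : E) :
    fderiv ℝ (leftMC (E := E) (extChartAt 𝓘(ℝ, E) (1 : G)).symm)
        (extChartAt 𝓘(ℝ, E) (1 : G) 1) X Y -
      fderiv ℝ (leftMC (E := E) (extChartAt 𝓘(ℝ, E) (1 : G)).symm)
        (extChartAt 𝓘(ℝ, E) (1 : G) 1) Y X + lieBilin E G X Y = 0 := by
  have hval : ∀ X, chartField G X (extChartAt 𝓘(ℝ, E) (1 : G) 1) = X := fun X => by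
    have := leftMC_chartField (G := G) X (mem_extChartAt_target (I := 𝓘(ℝ, E)) (1 : G))
    rw [leftMC_extChartAt_one_symm] at this
    exact this
  rw [lieBilin_eq_lieBracket, VectorField.lieBracket, (hasFDerivAt_chartField X).fderiv,
    (hasFDerivAt_chartField Y).fderiv, hval, hval]
  simp

/-- The curvature `db + ½[b, b]` of a `𝔤`-valued `1`-form, evaluated on two vectors. -/
def curv (G : Type*) [TopologicalSpace G] [ChartedSpace E G] [Group G] [LieGroup 𝓘(ℝ, E) ∞ G]
    (b : U → U →L[ℝ] E) (u v w : U) : E :=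
  fderiv ℝ b u v w - fderiv ℝ b u w v + lieBilin E G (b u v) (b u w)

/-- The Maurer-Cartan equation `dΘ + ½[Θ, Θ] = 0`. -/
theorem curv_leftMC {φ : U → G} {u : U} (h : ContMDiffAt 𝓘(ℝ, U) 𝓘(ℝ, E) ∞ φ u) (v w : U) :
    curv G (leftMC (E := E) φ) u v w = 0 := by
  set σ := (extChartAt 𝓘(ℝ, E) (1 : G)).symm with hσ
  set p := extChartAt 𝓘(ℝ, E) (1 : G) 1 with hp
  -- Left translation does not change the Maurer-Cartan form, so `φ` may be replaced by `φ(u)⁻¹ φ =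
  -- σ ∘ χ`, a map into the chart followed by the inverse chart.
  let χ : U → E := fun y => extChartAt 𝓘(ℝ, E) (1 : G) ((φ u)⁻¹ * φ y)
  have hχu : χ u = p := by simp only [χ, inv_mul_cancel, hp]
  have hN : ContMDiffAt 𝓘(ℝ, U) 𝓘(ℝ, E) ∞ (fun y => (φ u)⁻¹ * φ y) u := contMDiffAt_const.mul h
  have hχ : ContDiffAt ℝ ∞ χ u := by
    refine ContMDiffAt.contDiffAt ?_
    exact ContMDiffAt.comp_of_eq (I' := 𝓘(ℝ, E)) (x := u) (y := (1 : G))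
      (g := extChartAt 𝓘(ℝ, E) (1 : G)) contMDiffAt_extChartAt hN (by simp)
  have hσs : ContMDiffAt 𝓘(ℝ, E) 𝓘(ℝ, E) ∞ σ p := contMDiffAt_extChartAt_one_symm
  have hsrc : ∀ᶠ y in 𝓝 u, (φ u)⁻¹ * φ y = σ (χ y) := by
    have h1 : (extChartAt 𝓘(ℝ, E) (1 : G)).source ∈ 𝓝 ((φ u)⁻¹ * φ u) := by
      rw [inv_mul_cancel]
      exact extChartAt_source_mem_nhds _
    filter_upwards [hN.continuousAt h1] with y hy
    exact ((extChartAt 𝓘(ℝ, E) (1 : G)).left_inv hy).symm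
  have heq : leftMC (E := E) φ =ᶠ[𝓝 u] fun y => (leftMC σ (χ y)).comp (fderiv ℝ χ y) := by
    have hd : ∀ᶠ y in 𝓝 u, DifferentiableAt ℝ χ y :=
      (hχ.of_le (m := 1) (by simp)).eventually (by simp) |>.mono
        fun y hy => hy.differentiableAt (by simp)
    have hσd : ∀ᶠ y in 𝓝 u, MDifferentiableAt 𝓘(ℝ, E) 𝓘(ℝ, E) σ (χ y) := by
      refine hχ.continuousAt.eventually ?_
      rw [hχu]
      exact eventually_contMDiffAt hσs
    filter_upwards [hsrc.eventually_nhds, eventually_contMDiffAt h, hd, hσd] with y hy hφ hd hσd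
    rw [← leftMC_const_mul (φ u)⁻¹ hφ, leftMC_congr hy, leftMC_comp hσd hd]
  have hθ : HasFDerivAt (leftMC (E := E) σ) (fderiv ℝ (leftMC (E := E) σ) p) (χ u) := by
    rw [hχu]
    exact ((contDiffAt_leftMC hσs).differentiableAt (by simp)).hasFDerivAt
  have hdχ : HasFDerivAt χ (fderiv ℝ χ u) u := (hχ.differentiableAt (by simp)).hasFDerivAt
  have hdd : HasFDerivAt (fderiv ℝ χ) (fderiv ℝ (fderiv ℝ χ) u) u :=
    ((hχ.fderiv_right (m := ∞) (by simp)).differentiableAt (by simp)).hasFDerivAt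
  have hD := ((hθ.comp u hdχ).clm_comp hdd).congr_of_eventuallyEq heq
  -- Differentiating `(θ ∘ χ) dχ` produces a term in the second derivative of `χ`; its symmetry
  -- makes it cancel in the exterior derivative.
  have hsymm := (hχ.isSymmSndFDerivAt (by simpa using (WithTop.coe_le_coe.2 le_top :
    ((2 : ℕ∞) : WithTop ℕ∞) ≤ ((⊤ : ℕ∞) : WithTop ℕ∞)))).eq v w
  have hu : leftMC (E := E) φ u = fderiv ℝ χ u := by
    rw [heq.self_of_nhds]
    simp only [hχu]
    rw [hp, leftMC_extChartAt_one_symm, ContinuousLinearMap.id_comp]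
  have := maurerCartan_chart (G := G) (fderiv ℝ χ u v) (fderiv ℝ χ u w)
  rw [curv, hD.fderiv, hu, ← this]
  simp only [Function.comp_apply, hχu]
  rw [show leftMC (E := E) σ p = _ from leftMC_extChartAt_one_symm]
  simp only [add_apply, ContinuousLinearMap.comp_apply, ContinuousLinearMap.compL_apply,
    ContinuousLinearMap.flip_apply, ContinuousLinearMap.id_apply, hsymm]
  abel

theorem lieBilin_anti (x y : E) : lieBilin E G x y = -lieBilin E G y x := by
  have := lieGroup_three E G
  exact (lie_skew (L := GroupLieAlgebra 𝓘(ℝ, E) G) x y).symm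

/-- The derivative of the adjoint action: `d(Ad(g⁻¹)X) = -[g⁻¹dg, Ad(g⁻¹)X]`. -/
theorem fderiv_Ad_inv {g : U → G} {u : U} (h : ContMDiffAt 𝓘(ℝ, U) 𝓘(ℝ, E) ∞ g u) (v : U) (X : E) :
    fderiv ℝ (fun w => Ad (E := E) (g w)⁻¹) u v X =
      -lieBilin E G (leftMC g u v) (Ad (g u)⁻¹ X) := by
  let c : ℝ → G := fun s => chartOneInv (s • X)
  have hc0 : c 0 = 1 := by simp [c]
  have hc : ContMDiffAt 𝓘(ℝ, ℝ) 𝓘(ℝ, E) ∞ c 0 := by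
    refine ContMDiffAt.comp_of_eq (I' := 𝓘(ℝ, E)) (x := (0 : ℝ)) (y := (0 : E))
      (g := chartOneInv) (f := fun s : ℝ => s • X) contMDiffAt_chartOneInv ?_ (by simp)
    exact (contDiff_id.smul contDiff_const).contMDiff.contMDiffAt
  have hcX : leftMC (E := E) c 0 1 = X := by
    rw [leftMC_eq_fderiv (mdifferentiableAt_of_contMDiffAt hc), hc0]
    have h1 : (fun s : ℝ => chartOne ((1 : G)⁻¹ * c s)) =ᶠ[𝓝 0] fun s => s • X := by
      have h2 : Filter.Tendsto (fun s : ℝ => s • X) (𝓝 0) (𝓝 (0 : E)) := by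
        have : Continuous fun s : ℝ => s • X := by fun_prop
        simpa using this.tendsto 0
      filter_upwards [h2.eventually (chartOne_chartOneInv (G := G))] with s hs
      simpa [c] using hs
    rw [h1.fderiv_eq]
    have h3 : HasDerivAt (fun s : ℝ => s • X) ((1 : ℝ) • X) 0 := (hasDerivAt_id _).smul_const X
    rw [h3.hasFDerivAt.fderiv]
    simp
  -- The formula is the Maurer-Cartan equation of `c(s) g(w)` on the vectors `∂_s` and `v`, where
  -- `c` is a curve through `1` with velocity `X`: along `s = 0` the form takes the value `Ad(g⁻¹)X`
  -- on `∂_s`.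
  let φ : ℝ × U → G := fun x => c x.1 * g x.2
  have hc' : ContMDiffAt 𝓘(ℝ, ℝ × U) 𝓘(ℝ, E) ∞ (fun x : ℝ × U => c x.1) (0, u) :=
    ContMDiffAt.comp (I' := 𝓘(ℝ, ℝ)) ((0 : ℝ), u) (g := c) (f := Prod.fst) hc
      contDiff_fst.contMDiff.contMDiffAt
  have hg' : ContMDiffAt 𝓘(ℝ, ℝ × U) 𝓘(ℝ, E) ∞ (fun x : ℝ × U => g x.2) (0, u) :=
    ContMDiffAt.comp (I' := 𝓘(ℝ, U)) ((0 : ℝ), u) (g := g) (f := Prod.snd) h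
      contDiff_snd.contMDiff.contMDiffAt
  have hφ : ContMDiffAt 𝓘(ℝ, ℝ × U) 𝓘(ℝ, E) ∞ φ (0, u) := hc'.mul hg'
  have hmc := curv_leftMC hφ (1, 0) (0, v)
  have heq : leftMC (E := E) φ =ᶠ[𝓝 (0, u)] fun x =>
      (Ad (g x.2)⁻¹).comp ((leftMC c x.1).comp (ContinuousLinearMap.fst ℝ ℝ U)) +
        (leftMC g x.2).comp (ContinuousLinearMap.snd ℝ ℝ U) := by
    have h1 : ∀ᶠ x : ℝ × U in 𝓝 (0, u), MDifferentiableAt 𝓘(ℝ, ℝ) 𝓘(ℝ, E) c x.1 :=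
      continuousAt_fst.eventually (eventually_contMDiffAt hc)
    have h2 : ∀ᶠ x : ℝ × U in 𝓝 (0, u), MDifferentiableAt 𝓘(ℝ, U) 𝓘(ℝ, E) g x.2 :=
      continuousAt_snd.eventually (eventually_contMDiffAt h)
    filter_upwards [h1, h2, eventually_contMDiffAt hc', eventually_contMDiffAt hg']
      with x h1 h2 h3 h4
    rw [leftMC_mul h3 h4, leftMC_comp h1 differentiableAt_fst, leftMC_comp h2 differentiableAt_snd,
      fderiv_fst, fderiv_snd]
  have hda : DifferentiableAt ℝ (leftMC (E := E) φ) (0, u) :=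
    (contDiffAt_leftMC hφ).differentiableAt (by simp)
  have hA : DifferentiableAt ℝ (fun w => Ad (E := E) (g w)⁻¹) u :=
    (contDiffAt_Ad h.inv).differentiableAt (by simp)
  have hG : DifferentiableAt ℝ (leftMC (E := E) g) u :=
    (contDiffAt_leftMC h).differentiableAt (by simp)
  -- the derivative of `leftMC φ (0, v)` in the direction `(1, 0)` and vice versa
  have e1 : fderiv ℝ (leftMC (E := E) φ) (0, u) (1, 0) (0, v) = 0 := by
    have h1 : HasFDerivAt (fun x : ℝ × U => leftMC (E := E) φ x (0, v)) _ (0, u) :=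
      hda.hasFDerivAt.clm_apply (hasFDerivAt_const (0, v) _)
    have h2 : HasFDerivAt (fun x : ℝ × U => leftMC (E := E) g x.2 v)
        (((fderiv ℝ (leftMC (E := E) g) u).flip v).comp (ContinuousLinearMap.snd ℝ ℝ U)) (0, u) := by
      have h3 : HasFDerivAt (fun w : U => leftMC (E := E) g w v)
        ((fderiv ℝ (leftMC (E := E) g) u).flip v) u := by
        simpa using hG.hasFDerivAt.clm_apply (hasFDerivAt_const v _)
      exact HasFDerivAt.comp (0, u) (g := fun w : U => leftMC (E := E) g w v) h3 hasFDerivAt_snd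
    have h4 : (fun x : ℝ × U => leftMC (E := E) φ x (0, v)) =ᶠ[𝓝 (0, u)]
        fun x => leftMC (E := E) g x.2 v := by
      filter_upwards [heq] with x hx
      rw [hx]
      simp
    have h5 := congrArg (fun L : ℝ × U →L[ℝ] E => L (1, 0))
      ((h1.congr_of_eventuallyEq h4.symm).unique h2)
    simpa using h5
  have e2 : fderiv ℝ (leftMC (E := E) φ) (0, u) (0, v) (1, 0) =
      fderiv ℝ (fun w => Ad (E := E) (g w)⁻¹) u v X := by
    have h1 : HasFDerivAt (fun x : ℝ × U => leftMC (E := E) φ x (1, 0)) _ (0, u) :=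
      hda.hasFDerivAt.clm_apply (hasFDerivAt_const (1, 0) _)
    have hl : HasFDerivAt (fun y : U => ((0 : ℝ), y)) (ContinuousLinearMap.inr ℝ ℝ U) u :=
      hasFDerivAt_prodMk_right 0 u
    have h2 := HasFDerivAt.comp u h1 hl
    have h3 : HasFDerivAt (fun w : U => Ad (E := E) (g w)⁻¹ X)
        ((fderiv ℝ (fun w => Ad (E := E) (g w)⁻¹) u).flip X) u := by
      simpa using hA.hasFDerivAt.clm_apply (hasFDerivAt_const X _)
    have h4 : ((fun x : ℝ × U => leftMC (E := E) φ x (1, 0)) ∘ fun y : U => ((0 : ℝ), y)) =ᶠ[𝓝 u]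
        fun y => Ad (E := E) (g y)⁻¹ X := by
      filter_upwards [hl.continuousAt.eventually heq] with x hx
      rw [Function.comp_apply, hx]
      simp [hcX]
    have h5 := congrArg (fun L : U →L[ℝ] E => L v)
      ((h2.congr_of_eventuallyEq h4.symm).unique h3)
    simpa using h5
  have e3 : leftMC (E := E) φ (0, u) (1, 0) = Ad (g u)⁻¹ X := by
    rw [heq.self_of_nhds]
    simp [hcX]
  have e4 : leftMC (E := E) φ (0, u) (0, v) = leftMC g u v := by
    rw [heq.self_of_nhds]
    simp
  rw [curv, e1, e2, e3, e4, zero_sub, lieBilin_anti] at hmc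
  rw [← sub_eq_zero, ← neg_eq_zero, ← hmc]
  abel

theorem leftMC_chartOneInv_zero :
    leftMC (E := E) (chartOneInv (G := G)) 0 = ContinuousLinearMap.id ℝ E := by
  rw [leftMC_eq_fderiv (mdifferentiableAt_of_contMDiffAt contMDiffAt_chartOneInv)]
  have : (fun w => chartOne (E := E) ((chartOneInv (0 : E) : G)⁻¹ * chartOneInv w)) =ᶠ[𝓝 (0 : E)] id := by
    filter_upwards [chartOne_chartOneInv (E := E) (G := G)] with w hw
    simpa using hw
  rw [this.fderiv_eq, fderiv_id]

/-- Right translation of `chartOneInv` by `g⁻¹` multiplies its Maurer-Cartan form by `Ad g`.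
Comparing the Maurer-Cartan equations of both maps at `0`, where the original form is the identity,
gives the claim. -/
theorem Ad_lieBilin (g : G) (X Y : E) :
    Ad g (lieBilin E G X Y) = lieBilin E G (Ad g X) (Ad g Y) := by
  have h := contMDiffAt_chartOneInv (E := E) (G := G)
  have h' : ContMDiffAt 𝓘(ℝ, E) 𝓘(ℝ, E) ∞ (fun x => chartOneInv (E := E) (G := G) x * g⁻¹) 0 :=
    h.mul contMDiffAt_const
  have e1 := curv_leftMC h X Y
  have e2 := curv_leftMC h' X Y
  have heq : leftMC (E := E) (fun x => chartOneInv (E := E) (G := G) x * g⁻¹) =ᶠ[𝓝 (0 : E)]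
      fun x : E => (Ad g).comp (leftMC (chartOneInv (E := E) (G := G)) x) := by
    filter_upwards [eventually_contMDiffAt h] with x hx
    rw [leftMC_mul_const _ hx, inv_inv]
  have hd := ((contDiffAt_leftMC h).differentiableAt (by simp)).hasFDerivAt
  have hd2 : fderiv ℝ (leftMC (E := E) (fun x => chartOneInv (E := E) (G := G) x * g⁻¹)) 0 =
      (ContinuousLinearMap.compL ℝ E E E (Ad g)).comp
        (fderiv ℝ (leftMC (chartOneInv (E := E) (G := G))) 0) := by
    rw [heq.fderiv_eq]
    exact ((ContinuousLinearMap.compL ℝ E E E (Ad g)).hasFDerivAt.comp 0 hd).fderiv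
  rw [curv, hd2, heq.self_of_nhds] at e2
  rw [curv] at e1
  simp only [leftMC_chartOneInv_zero, ContinuousLinearMap.comp_apply,
    ContinuousLinearMap.compL_apply, ContinuousLinearMap.id_apply] at e1 e2
  have e3 := congrArg (Ad g) e1
  rw [map_add, map_sub, map_zero] at e3
  exact add_left_cancel (e3.trans e2.symm)

/-! ### Gauge transformations of `𝔤`-valued one-forms -/

/-- The gauge transform `Ad(g⁻¹) b + g⁻¹dg`. -/
def gauge (g : U → G) (b : U → U →L[ℝ] E) (u : U) : U →L[ℝ] E :=
  (Ad (g u)⁻¹).comp (b u) + leftMC g u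

theorem contDiffAt_gauge {g : U → G} {b : U → U →L[ℝ] E} {u : U}
    (hg : ContMDiffAt 𝓘(ℝ, U) 𝓘(ℝ, E) ∞ g u) (hb : ContDiffAt ℝ ∞ b u) :
    ContDiffAt ℝ ∞ (gauge g b) u :=
  ((contDiffAt_Ad hg.inv).clm_comp hb).add (contDiffAt_leftMC hg)

theorem differentiableAt_gauge {g : U → G} {b : U → U →L[ℝ] E} {u : U}
    (hg : ContMDiffAt 𝓘(ℝ, U) 𝓘(ℝ, E) ∞ g u) (hb : DifferentiableAt ℝ b u) :
    DifferentiableAt ℝ (gauge g b) u :=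
  (((contDiffAt_Ad hg.inv).differentiableAt (by simp)).clm_comp hb).add
    ((contDiffAt_leftMC hg).differentiableAt (by simp))

/-- The curvature of a gauge transform. -/
theorem curv_gauge {g : U → G} {b : U → U →L[ℝ] E} {u : U}
    (hg : ContMDiffAt 𝓘(ℝ, U) 𝓘(ℝ, E) ∞ g u) (hb : DifferentiableAt ℝ b u) (v w : U) :
    curv G (gauge g b) u v w = Ad (g u)⁻¹ (curv G b u v w) := by
  have hA : DifferentiableAt ℝ (fun w => Ad (E := E) (g w)⁻¹) u :=
    (contDiffAt_Ad hg.inv).differentiableAt (by simp)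
  have hG : DifferentiableAt ℝ (leftMC (E := E) g) u :=
    (contDiffAt_leftMC hg).differentiableAt (by simp)
  have hD := (hA.hasFDerivAt.clm_comp hb.hasFDerivAt).add hG.hasFDerivAt
  have hmc := curv_leftMC hg v w
  have hD' : HasFDerivAt (gauge g b) _ u := hD
  rw [curv] at hmc
  rw [curv, hD'.fderiv, curv]
  simp only [gauge, add_apply, ContinuousLinearMap.comp_apply, map_add, map_sub,
    ContinuousLinearMap.flip_apply, ContinuousLinearMap.compL_apply, fderiv_Ad_inv hg, Ad_lieBilin,
    LinearMap.add_apply]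
  have hc := lieBilin_anti (G := G) (leftMC (E := E) g u w) (Ad (g u)⁻¹ (b u v))
  -- The derivative of `Ad(g⁻¹)` cancels the mixed brackets of `Ad(g⁻¹)b` with `g⁻¹dg`. What is left
  -- besides `Ad(g⁻¹)` of the curvature is the Maurer-Cartan expression of `g`, which is zero.
  rw [hc, ← sub_eq_zero, ← hmc]
  abel_nf

end MaurerCartan

/-! ## Sums over permutations -/

section PermSums

open Equiv

/-- Permutations are grouped by the image `c` of `a`; the group belonging to `c` is the coset of the
stabilizer of `a` represented by `π c`. -/
theorem sum_perm_eq_sum_stabilizer {α M : Type*} [Fintype α] [DecidableEq α] [AddCommMonoid M]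
    (a : α) (π : α → Perm α) (hπ : ∀ c, π c a = c) (F : Perm α → M) :
    ∑ τ, F τ = ∑ c, ∑ τ : Perm α, if τ a = a then F (π c * τ) else 0 := by
  have h1 : ∀ τ, F τ = ∑ c, if τ a = c then F τ else 0 := fun τ => by simp
  rw [Fintype.sum_congr _ _ h1, Finset.sum_comm]
  refine Fintype.sum_congr _ _ fun c => ?_
  rw [← Equiv.sum_comp (Equiv.mulLeft (π c))]
  refine Fintype.sum_congr _ _ fun τ => ?_
  have : (π c * τ) a = c ↔ τ a = a := by
    rw [Perm.mul_apply, ← Equiv.eq_symm_apply, Equiv.eq_symm_apply]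
    constructor
    · intro h
      exact (π c).injective (h.trans (hπ c).symm)
    · intro h
      rw [h, hπ]
  simp only [Equiv.coe_mulLeft, this]

/-- The representative taking `0` to `i` is chosen to list the other indices in increasing order.
This matches the omission of the `i`-th vector in the exterior derivative, and its sign is `(-1)^i`.
-/
theorem sum_perm_fin_succ {N : ℕ} {M : Type*} [AddCommMonoid M] (F : Perm (Fin (N + 1)) → M) :
    ∑ τ, F τ = ∑ i, ∑ σ : Perm (Fin N), F ((Fin.cycleRange i).symm * Perm.decomposeFin.symm (0, σ)) := by
  rw [sum_perm_eq_sum_stabilizer 0 (fun i : Fin (N + 1) => i.cycleRange.symm)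
    (fun i => by simp)]
  refine Fintype.sum_congr _ _ fun i => ?_
  rw [← Equiv.sum_comp Perm.decomposeFin.symm, Fintype.sum_prod_type, Fin.sum_univ_succ]
  simp

end PermSums

/-! ## Alternating maps -/

section Alternating

variable {U : Type*} [NormedAddCommGroup U] [NormedSpace ℝ U] [FiniteDimensional ℝ U]
  {W : Type*} [NormedAddCommGroup W] [NormedSpace ℝ W] [FiniteDimensional ℝ W]
  {X : Type*} [NormedAddCommGroup X] [NormedSpace ℝ X]

/-- An alternating map is determined linearly by its finitely many values on tuples of basis
vectors; a linear left inverse of this evaluation recovers it smoothly from them. -/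
theorem contDiffAt_alternating {N : ℕ} {ζ : X → U [⋀^Fin N]→L[ℝ] W} {x : X}
    (h : ∀ v, ContDiffAt ℝ ∞ (fun y => ζ y v) x) : ContDiffAt ℝ ∞ ζ x := by
  let b := Module.finBasis ℝ U
  let L : (U [⋀^Fin N]→L[ℝ] W) →ₗ[ℝ] ((Fin N → Fin (Module.finrank ℝ U)) → W) :=
    { toFun := fun η s => η fun i => b (s i)
      map_add' := fun _ _ => rfl
      map_smul' := fun _ _ => rfl }
  have hL : LinearMap.ker L = ⊥ := by
    rw [LinearMap.ker_eq_bot]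
    intro η η' hη
    have h1 : (η.toMultilinearMap) = η'.toMultilinearMap :=
      Module.Basis.ext_multilinear (fun _ => b) fun s => congrFun hη s
    ext v
    exact congrArg (fun m : MultilinearMap ℝ (fun _ : Fin N => U) W => m v) h1
  obtain ⟨R, hR⟩ := L.exists_leftInverse_of_injective hL
  have h1 : ζ = fun y => R.toContinuousLinearMap (L (ζ y)) := by
    funext y
    exact (congrArg (fun T : _ →ₗ[ℝ] _ => T (ζ y)) hR).symm
  rw [h1]
  refine R.toContinuousLinearMap.contDiff.contDiffAt.comp x ?_
  rw [contDiffAt_pi]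
  exact fun s => h _

theorem contDiff_alternating {N : ℕ} {ζ : X → U [⋀^Fin N]→L[ℝ] W}
    (h : ∀ v, ContDiff ℝ ∞ (fun y => ζ y v)) : ContDiff ℝ ∞ ζ :=
  contDiff_iff_contDiffAt.2 fun _ => contDiffAt_alternating fun v => (h v).contDiffAt

theorem contDiffAt_alternating_apply {N : ℕ} {ζ : X → U [⋀^Fin N]→L[ℝ] W} {x : X}
    (h : ContDiffAt ℝ ∞ ζ x) (v : Fin N → U) : ContDiffAt ℝ ∞ (fun y => ζ y v) x :=
  (ContinuousAlternatingMap.apply ℝ U W v).contDiff.contDiffAt.comp x h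

end Alternating

/-! ### Multilinear functions evaluated on vector valued forms -/

section FormEval

variable {U V W : Type*} [NormedAddCommGroup U] [NormedSpace ℝ U]
  [NormedAddCommGroup V] [NormedSpace ℝ V] [NormedAddCommGroup W] [NormedSpace ℝ W]
  {U' : Type*} [NormedAddCommGroup U'] [NormedSpace ℝ U']

theorem formEval_apply {k : ℕ} {q : Fin k → ℕ}
    (f : ContinuousMultilinearMap ℝ (fun _ : Fin k => V) W)
    (η : ∀ i, U [⋀^Fin (q i)]→L[ℝ] V) {N : ℕ} (hN : ∑ i, q i = N) (v : Fin N → U) :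
    formEval f η hN v = (∏ i, ((q i).factorial : ℝ))⁻¹ • ∑ σ : Equiv.Perm (Fin N),
      Equiv.Perm.sign σ •
        f fun i => η i fun j => v (σ (finSigmaFinEquiv.trans (finCongr hN) ⟨i, j⟩)) := by
  simp only [formEval, ContinuousAlternatingMap.smul_apply,
    ContinuousMultilinearMap.alternatization_apply_apply]
  rfl

theorem formEval_compContinuousLinearMap {k : ℕ} {q : Fin k → ℕ}
    (f : ContinuousMultilinearMap ℝ (fun _ : Fin k => V) W)
    (η : ∀ i, U [⋀^Fin (q i)]→L[ℝ] V) {N : ℕ} (hN : ∑ i, q i = N) (L : U' →L[ℝ] U) :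
    formEval f (fun i => (η i).compContinuousLinearMap L) hN =
      (formEval f η hN).compContinuousLinearMap L := by
  ext v
  simp only [formEval_apply, ContinuousAlternatingMap.compContinuousLinearMap_apply]
  rfl

theorem contDiffAt_formEval [FiniteDimensional ℝ U] [FiniteDimensional ℝ V] [FiniteDimensional ℝ W]
    {k : ℕ} {q : Fin k → ℕ}
    (f : ContinuousMultilinearMap ℝ (fun _ : Fin k => V) W)
    {η : U' → ∀ i, U [⋀^Fin (q i)]→L[ℝ] V} {N : ℕ} (hN : ∑ i, q i = N) {x : U'}
    (h : ∀ i, ContDiffAt ℝ ∞ (fun y => η y i) x) :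
    ContDiffAt ℝ ∞ (fun y => formEval f (η y) hN) x := by
  refine contDiffAt_alternating fun v => ?_
  simp only [formEval_apply]
  refine contDiffAt_const.smul (ContDiffAt.sum fun σ _ => ?_)
  refine ContDiffAt.const_smul _ (f.contDiff.contDiffAt.comp x ?_)
  rw [contDiffAt_pi]
  exact fun i => contDiffAt_alternating_apply (h i) _

theorem formEval_two (f : ContinuousMultilinearMap ℝ (fun _ : Fin 2 => V) W)
    (η : Fin 2 → U [⋀^Fin 1]→L[ℝ] V) (h : ∑ _i : Fin 2, 1 = 2) (v : Fin 2 → U) :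
    formEval (q := fun _ => 1) f η h v =
      f (fun i => η i fun _ => v i) - f (fun i => η i fun _ => v (1 - i)) := by
  have he : ∀ (i : Fin 2) (j : Fin 1),
      finSigmaFinEquiv.trans (finCongr h) (⟨i, j⟩ : (_ : Fin 2) × Fin 1) = i := by
    intro i j
    apply Fin.ext
    fin_cases i <;> fin_cases j <;> simp [finSigmaFinEquiv_apply]
  rw [formEval_apply, ← Equiv.sum_comp Equiv.Perm.decomposeFin.symm, Fintype.sum_prod_type,
    Fin.sum_univ_two]
  simp only [he, Finset.univ_unique, Finset.sum_singleton, Equiv.Perm.default_eq,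
    Equiv.Perm.decomposeFin.symm_sign, Equiv.Perm.decomposeFin_symm_of_one]
  simp [sub_eq_add_neg]
  congr 2
  funext i
  congr 1
  funext j
  fin_cases i <;> simp

end FormEval

/-! ## Curvature and Chern-Weil forms of one-forms on vector spaces -/

section ChernWeil

variable {E : Type*} [NormedAddCommGroup E] [NormedSpace ℝ E] [FiniteDimensional ℝ E]
  {G : Type*} [TopologicalSpace G] [ChartedSpace E G] [Group G] [LieGroup 𝓘(ℝ, E) ∞ G]
  {U : Type*} [NormedAddCommGroup U] [NormedSpace ℝ U]

variable (G) in
/-- The curvature `db + ½[b, b]` of a `𝔤`-valued `1`-form. -/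
def curvForm (b : U → U →L[ℝ] E) (u : U) : U [⋀^Fin 2]→L[ℝ] E :=
  extDeriv (fun w => ContinuousAlternatingMap.ofSubsingleton ℝ U E (0 : Fin 1) (b w)) u +
    (1 / 2 : ℝ) • formEval (q := fun _ => 1) (bracket E G)
      (fun _ => ContinuousAlternatingMap.ofSubsingleton ℝ U E (0 : Fin 1) (b u)) (by simp)

/-- By antisymmetry `[b, b](v, w)` contains `[b(v), b(w)]` twice, which the factor `½` compensates.
-/
theorem curvForm_apply {b : U → U →L[ℝ] E} {u : U} (hb : DifferentiableAt ℝ b u) (v : Fin 2 → U) :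
    curvForm G b u v = curv G b u (v 0) (v 1) := by
  have hω : DifferentiableAt ℝ
      (fun w => ContinuousAlternatingMap.ofSubsingleton ℝ U E (0 : Fin 1) (b w)) u :=
    (ContinuousAlternatingMap.ofSubsingletonLIE (𝕜 := ℝ) (E := U) (F := E)
      (0 : Fin 1)).toContinuousLinearEquiv.differentiableAt.comp u hb
  have hf : ∀ x y : U, fderiv ℝ (fun w => b w x) u y = fderiv ℝ b u y x := fun x y => by
    rw [(hb.hasFDerivAt.clm_apply (hasFDerivAt_const x u)).fderiv]
    simp
  have hbr : ∀ x y : E, bracket E G ![x, y] = lieBilin E G x y := fun x y => rfl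
  rw [curvForm, ContinuousAlternatingMap.add_apply, extDeriv_apply hω,
    ContinuousAlternatingMap.smul_apply, formEval_two, curv]
  have h1 : (fun i : Fin 2 => ContinuousAlternatingMap.ofSubsingleton ℝ U E (0 : Fin 1) (b u)
      fun _ => v i) = ![b u (v 0), b u (v 1)] := by
    funext i; fin_cases i <;> rfl
  have h2 : (fun i : Fin 2 => ContinuousAlternatingMap.ofSubsingleton ℝ U E (0 : Fin 1) (b u)
      fun _ => v (1 - i)) = ![b u (v 1), b u (v 0)] := by
    funext i; fin_cases i <;> rfl
  have hh : ∀ x : E, (1 / 2 : ℝ) • (x + x) = x := fun x => by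
    rw [← two_smul ℝ x, smul_smul]
    norm_num
  rw [h1, h2, hbr, hbr, lieBilin_anti (b u (v 1)), sub_neg_eq_add, hh]
  simp [Fin.sum_univ_two, Fin.removeNth, hf, ← sub_eq_add_neg]

theorem curvForm_congr {b b' : U → U →L[ℝ] E} {u : U} (h : b =ᶠ[𝓝 u] b') :
    curvForm G b u = curvForm G b' u := by
  have h1 : (fun w => ContinuousAlternatingMap.ofSubsingleton ℝ U E (0 : Fin 1) (b w)) =ᶠ[𝓝 u]
      fun w => ContinuousAlternatingMap.ofSubsingleton ℝ U E (0 : Fin 1) (b' w) := by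
    filter_upwards [h] with w hw
    rw [hw]
  rw [curvForm, curvForm, h1.extDeriv_eq, h.self_of_nhds]

theorem contDiffAt_curvForm [FiniteDimensional ℝ U] {b : U → U →L[ℝ] E} {u : U}
    (hb : ContDiffAt ℝ ∞ b u) : ContDiffAt ℝ ∞ (curvForm G b) u := by
  have hω : ContDiffAt ℝ ∞
      (fun w => ContinuousAlternatingMap.ofSubsingleton ℝ U E (0 : Fin 1) (b w)) u :=
    (ContinuousAlternatingMap.ofSubsingletonLIE (𝕜 := ℝ) (E := U) (F := E)
      (0 : Fin 1)).toContinuousLinearEquiv.contDiff.contDiffAt.comp u hb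
  refine ContDiffAt.add ?_ (ContDiffAt.const_smul _ (contDiffAt_formEval _ _ fun _ => hω))
  exact (ContinuousAlternatingMap.alternatizeUncurryFinCLM ℝ U E).contDiff.contDiffAt.comp u
    (hω.fderiv_right (m := ∞) (by simp))

/-- The Chern-Weil form `f(F, …, F)` of a `𝔤`-valued `1`-form with curvature `F`. -/
def cwForm {k : ℕ} (f : InvPoly E G k) (b : U → U →L[ℝ] E) (u : U) : U [⋀^Fin (2 * k)]→L[ℝ] ℝ :=
  formEval (q := fun _ => 2) f.toFun (fun _ => curvForm G b u) (by simp [mul_comm])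

theorem cwForm_congr {k : ℕ} (f : InvPoly E G k) {b b' : U → U →L[ℝ] E} {u : U}
    (h : b =ᶠ[𝓝 u] b') : cwForm f b u = cwForm f b' u := by
  rw [cwForm, cwForm, curvForm_congr h]

theorem contDiffAt_cwForm [FiniteDimensional ℝ U] {k : ℕ} (f : InvPoly E G k)
    {b : U → U →L[ℝ] E} {u : U} (hb : ContDiffAt ℝ ∞ b u) : ContDiffAt ℝ ∞ (cwForm f b) u :=
  contDiffAt_formEval _ _ fun _ => contDiffAt_curvForm hb

/-- The curvature changes by `Ad(g⁻¹)` in every slot at once, and `f` does not see this. -/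
theorem cwForm_gauge {k : ℕ} (f : InvPoly E G k) {b : U → U →L[ℝ] E} {g : U → G} {u : U}
    (hg : ContMDiffAt 𝓘(ℝ, U) 𝓘(ℝ, E) ∞ g u) (hb : DifferentiableAt ℝ b u) :
    cwForm f (gauge g b) u = cwForm f b u := by
  have hc : ∀ v, curvForm G (gauge g b) u v = Ad (g u)⁻¹ (curvForm G b u v) := fun v => by
    rw [curvForm_apply (differentiableAt_gauge hg hb), curvForm_apply hb, curv_gauge hg hb]
  ext v
  simp only [cwForm, formEval_apply, hc, f.inv]

end ChernWeil

/-! ## Chern-Weil forms are closed -/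

section Closed

/-- Merges the alternating sum of `d` over the differentiated direction with the sum over
permutations in `formEval` into one sum over `S_{N+1}`, with position `0` reserved for the
direction. -/
theorem sum_alternating_slot {U : Type*} {N : ℕ} (H : U → (Fin N → U) → ℝ) (v : Fin (N + 1) → U) :
    ∑ i : Fin (N + 1), (-1 : ℝ) ^ (i : ℕ) * ∑ σ : Equiv.Perm (Fin N), Equiv.Perm.sign σ •
        H (v i) (fun k => i.removeNth v (σ k)) =
      ∑ τ : Equiv.Perm (Fin (N + 1)), Equiv.Perm.sign τ • H (v (τ 0)) fun k => v (τ k.succ) := by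
  rw [sum_perm_fin_succ]
  refine Fintype.sum_congr _ _ fun i => ?_
  rw [Finset.mul_sum]
  refine Fintype.sum_congr _ _ fun σ => ?_
  have h0 : ((Fin.cycleRange i).symm * Equiv.Perm.decomposeFin.symm (0, σ)) 0 = i := by simp
  have h1 : ∀ k : Fin N, ((Fin.cycleRange i).symm * Equiv.Perm.decomposeFin.symm (0, σ)) k.succ =
      i.succAbove (σ k) := fun k => by simp
  have hs : Equiv.Perm.sign ((Fin.cycleRange i).symm * Equiv.Perm.decomposeFin.symm (0, σ)) =
      (-1) ^ (i : ℕ) * Equiv.Perm.sign σ := by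
    rw [Equiv.Perm.sign_mul, Equiv.Perm.sign_symm, Fin.sign_cycleRange,
      Equiv.Perm.decomposeFin.symm_sign]
    simp
  rw [hs]
  simp only [h0, h1, Fin.removeNth, Units.smul_def, zsmul_eq_mul, ← mul_assoc]
  push_cast
  rfl

/-- The direction of differentiation and the two arguments of the `j`-th block can be permuted
cyclically without affecting the sign or the other blocks. Averaging over this 3-cycle produces the
cyclic sum in `hD`. -/
theorem sum_perm_cyclic_eq_zero {U V : Type*} [NormedAddCommGroup V] [NormedSpace ℝ V]
    {k N : ℕ} (f : ContinuousMultilinearMap ℝ (fun _ : Fin k => V) ℝ)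
    (e : (_ : Fin k) × Fin 2 ≃ Fin N) (F : (Fin 2 → U) → V) (D : U → (Fin 2 → U) → V)
    (hD : ∀ x y z, D x ![y, z] + D y ![z, x] + D z ![x, y] = 0) (j : Fin k) (v : Fin (N + 1) → U) :
    ∑ τ : Equiv.Perm (Fin (N + 1)), Equiv.Perm.sign τ •
      f (Function.update (fun i => F fun l => v (τ (e ⟨i, l⟩).succ)) j
        (D (v (τ 0)) fun l => v (τ (e ⟨j, l⟩).succ))) = 0 := by
  set G : Equiv.Perm (Fin (N + 1)) → ℝ := fun τ => Equiv.Perm.sign τ •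
      f (Function.update (fun i => F fun l => v (τ (e ⟨i, l⟩).succ)) j
        (D (v (τ 0)) fun l => v (τ (e ⟨j, l⟩).succ))) with hG
  set a := (e ⟨j, 0⟩).succ with ha
  set b := (e ⟨j, 1⟩).succ with hb
  have hab : a ≠ b := by simp [ha, hb, Fin.succ_inj]
  have ha0 : a ≠ 0 := Fin.succ_ne_zero _
  have hb0 : b ≠ 0 := Fin.succ_ne_zero _
  -- The even permutation `0 ↦ a ↦ b ↦ 0`, where `a` and `b` are the positions of the `j`-th block,
  -- shifted by one because of the direction in position `0`.
  set c : Equiv.Perm (Fin (N + 1)) := Equiv.swap 0 a * Equiv.swap a b with hc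
  have c0 : c 0 = a := by
    rw [hc, Equiv.Perm.mul_apply, Equiv.swap_apply_of_ne_of_ne ha0.symm hb0.symm,
      Equiv.swap_apply_left]
  have ca : c a = b := by
    rw [hc, Equiv.Perm.mul_apply, Equiv.swap_apply_left,
      Equiv.swap_apply_of_ne_of_ne hb0 hab.symm]
  have cb : c b = 0 := by
    rw [hc, Equiv.Perm.mul_apply, Equiv.swap_apply_right, Equiv.swap_apply_right]
  have co : ∀ i, i ≠ j → ∀ l, c (e ⟨i, l⟩).succ = (e ⟨i, l⟩).succ := by
    intro i hi l
    have h1 : (e ⟨i, l⟩).succ ≠ a := by simp [ha, Fin.succ_inj, hi]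
    have h2 : (e ⟨i, l⟩).succ ≠ b := by simp [hb, Fin.succ_inj, hi]
    rw [hc, Equiv.Perm.mul_apply, Equiv.swap_apply_of_ne_of_ne h1 h2,
      Equiv.swap_apply_of_ne_of_ne (Fin.succ_ne_zero _) h1]
  have hsc : Equiv.Perm.sign c = 1 := by
    rw [hc, Equiv.Perm.sign_mul, Equiv.Perm.sign_swap ha0.symm, Equiv.Perm.sign_swap hab]
    rfl
  have hl : ∀ τ : Equiv.Perm (Fin (N + 1)), (fun l => v (τ (e ⟨j, l⟩).succ)) = ![v (τ a), v (τ b)] := by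
    intro τ
    funext l
    fin_cases l <;> rfl
  have hG1 : ∀ τ, G τ = Equiv.Perm.sign τ • f (Function.update
      (fun i => F fun l => v (τ (e ⟨i, l⟩).succ)) j (D (v (τ 0)) ![v (τ a), v (τ b)])) := by
    intro τ
    rw [hG, ← hl]
  have hupd : ∀ (τ τ' : Equiv.Perm (Fin (N + 1))) (x : V),
      (∀ i, i ≠ j → ∀ l, τ (e ⟨i, l⟩).succ = τ' (e ⟨i, l⟩).succ) →
      Function.update (fun i => F fun l => v (τ (e ⟨i, l⟩).succ)) j x =
        Function.update (fun i => F fun l => v (τ' (e ⟨i, l⟩).succ)) j x := by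
    intro τ τ' x h
    funext i
    by_cases hi : i = j
    · subst hi; simp
    · simp only [Function.update_of_ne hi]
      congr 1
      funext l
      rw [h i hi l]
  have hG2 : ∀ τ, G (τ * c) = Equiv.Perm.sign τ • f (Function.update
      (fun i => F fun l => v (τ (e ⟨i, l⟩).succ)) j (D (v (τ a)) ![v (τ b), v (τ 0)])) := by
    intro τ
    rw [hG1, Equiv.Perm.sign_mul, hsc, mul_one, hupd (τ * c) τ _ fun i hi l => by
      rw [Equiv.Perm.mul_apply, co i hi l]]
    simp only [Equiv.Perm.mul_apply, c0, ca, cb]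
  have hG3 : ∀ τ, G (τ * c * c) = Equiv.Perm.sign τ • f (Function.update
      (fun i => F fun l => v (τ (e ⟨i, l⟩).succ)) j (D (v (τ b)) ![v (τ 0), v (τ a)])) := by
    intro τ
    rw [hG2, Equiv.Perm.sign_mul, hsc, mul_one, hupd (τ * c) τ _ fun i hi l => by
      rw [Equiv.Perm.mul_apply, co i hi l]]
    simp only [Equiv.Perm.mul_apply, c0, ca, cb]
  have hz : ∀ τ, G τ + G (τ * c) + G (τ * c * c) = 0 := by
    intro τ
    rw [hG1, hG2, hG3, ← smul_add, ← smul_add, ← f.map_update_add, ← f.map_update_add, hD,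
      f.map_coord_zero j (by simp), smul_zero]
  have e1 : ∑ τ, G (τ * c) = ∑ τ, G τ := Equiv.sum_comp (Equiv.mulRight c) G
  have e2 : ∑ τ, G (τ * c * c) = ∑ τ, G τ :=
    (Equiv.sum_comp (Equiv.mulRight c) fun τ => G (τ * c)).trans e1
  have e3 := Fintype.sum_congr _ _ hz
  rw [Finset.sum_add_distrib, Finset.sum_add_distrib, e1, e2, Finset.sum_const_zero] at e3
  linarith

variable {E : Type*} [NormedAddCommGroup E] [NormedSpace ℝ E] [FiniteDimensional ℝ E]
  {G : Type*} [TopologicalSpace G] [ChartedSpace E G] [Group G] [LieGroup 𝓘(ℝ, E) ∞ G]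
  {U : Type*} [NormedAddCommGroup U] [NormedSpace ℝ U] [FiniteDimensional ℝ U]

/-- A multilinear function of a form satisfying the Bianchi identity at a point is closed there. -/
theorem extDeriv_formEval_eq_zero {V : Type*} [NormedAddCommGroup V] [NormedSpace ℝ V]
    [FiniteDimensional ℝ V] {k N : ℕ}
    (f : ContinuousMultilinearMap ℝ (fun _ : Fin k => V) ℝ) (hN : ∑ _i : Fin k, 2 = N)
    {F : U → U [⋀^Fin 2]→L[ℝ] V} {u : U} (hF : ContDiffAt ℝ ∞ F u)
    (hD : ∀ x y z, fderiv ℝ F u x ![y, z] + fderiv ℝ F u y ![z, x] + fderiv ℝ F u z ![x, y] = 0) :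
    extDeriv (fun w => formEval (q := fun _ => 2) f (fun _ => F w) hN) u = 0 := by
  have hFd : ∀ v : Fin 2 → U, HasFDerivAt (fun w => F w v)
      ((ContinuousAlternatingMap.apply ℝ U V v).comp (fderiv ℝ F u)) u := fun v =>
    (ContinuousAlternatingMap.apply ℝ U V v).hasFDerivAt.comp u
      (hF.differentiableAt (by simp)).hasFDerivAt
  set e := (finSigmaFinEquiv (n := fun _ : Fin k => 2)).trans (finCongr hN) with he
  have hsm : ContDiffAt ℝ ∞ (fun w => formEval (q := fun _ => 2) f (fun _ => F w) hN) u :=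
    contDiffAt_formEval _ _ fun _ => hF
  have hder : ∀ (x : U) (w : Fin N → U),
      fderiv ℝ (fun y => formEval (q := fun _ => 2) f (fun _ => F y) hN w) u x =
        (∏ _i : Fin k, (Nat.factorial 2 : ℝ))⁻¹ * ∑ σ : Equiv.Perm (Fin N), Equiv.Perm.sign σ •
          ∑ j, f (Function.update (fun i => F u fun l => w (σ (e ⟨i, l⟩))) j
            (fderiv ℝ F u x fun l => w (σ (e ⟨j, l⟩)))) := by
    intro x w
    have h1 : ∀ σ : Equiv.Perm (Fin N), HasFDerivAt
        (fun y => f fun i => F y fun l => w (σ (e ⟨i, l⟩))) _ u := fun σ =>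
      (f.hasFDerivAt (fun i => F u fun l => w (σ (e ⟨i, l⟩)))).comp u
        (hasFDerivAt_pi.2 fun i => hFd fun l => w (σ (e ⟨i, l⟩)))
    have h2 : ∀ σ : Equiv.Perm (Fin N), HasFDerivAt (fun y => ((Equiv.Perm.sign σ : ℤ) : ℝ) *
        f fun i => F y fun l => w (σ (e ⟨i, l⟩))) _ u := fun σ =>
      (h1 σ).const_mul ((Equiv.Perm.sign σ : ℤ) : ℝ)
    have h3 := (HasFDerivAt.fun_sum (u := Finset.univ) fun σ _ => h2 σ).const_mul
      (∏ _i : Fin k, (Nat.factorial 2 : ℝ))⁻¹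
    have h4 : (fun y => formEval (q := fun _ => 2) f (fun _ => F y) hN w) = fun y =>
        (∏ _i : Fin k, (Nat.factorial 2 : ℝ))⁻¹ * ∑ σ : Equiv.Perm (Fin N),
          ((Equiv.Perm.sign σ : ℤ) : ℝ) * f fun i => F y fun l => w (σ (e ⟨i, l⟩)) := by
      funext y
      simp only [formEval_apply, Units.smul_def, zsmul_eq_mul, smul_eq_mul, he]
    rw [h4, h3.fderiv]
    simp [ContinuousMultilinearMap.linearDeriv_apply, Units.smul_def]
  ext v
  rw [extDeriv_apply (hsm.differentiableAt (by simp))]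
  simp only [hder]
  have h3 : ∀ (i : Fin (N + 1)) (c x : ℝ), (-1 : ℤ) ^ (i : ℕ) • (c * x) =
      c * ((-1 : ℝ) ^ (i : ℕ) * x) := fun i c x => by
    simp only [zsmul_eq_mul]
    push_cast
    ring
  simp only [h3]
  -- After merging the sums, each slot `j` selected by the product rule contributes zero separately.
  rw [← Finset.mul_sum,
    sum_alternating_slot (fun x w => ∑ j, f (Function.update (fun i' => F u fun l => w (e ⟨i', l⟩)) j
      (fderiv ℝ F u x fun l => w (e ⟨j, l⟩)))) v]
  simp only [Finset.smul_sum]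
  rw [Finset.sum_comm, Finset.sum_eq_zero, mul_zero]
  · rfl
  · intro j _
    exact sum_perm_cyclic_eq_zero f e (F u) (fun x y => fderiv ℝ F u x y) hD j v

/-- Around every point a one-form has a gauge in which it vanishes at the point. -/
theorem exists_gauge_eq_zero (G : Type*) [TopologicalSpace G] [ChartedSpace E G] [Group G]
    [LieGroup 𝓘(ℝ, E) ∞ G] (b : U → U →L[ℝ] E) (u : U) :
    ∃ g : U → G, (∀ᶠ w in 𝓝 u, ContMDiffAt 𝓘(ℝ, U) 𝓘(ℝ, E) ∞ g w) ∧ gauge g b u = 0 := by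
  -- The Maurer-Cartan form of `chartOneInv ∘ ℓ` at `u` is the derivative of `ℓ`, so this choice
  -- contributes `-b(u)`; the `Ad` factor is trivial at `u` because `ℓ(u) = 0`.
  let ℓ : U → E := fun w => -(b u (w - u))
  have hℓ : ContDiff ℝ ∞ ℓ := ((b u).contDiff.comp (contDiff_id.sub contDiff_const)).neg
  have hℓu : ℓ u = 0 := by simp [ℓ]
  have hev : ∀ᶠ w in 𝓝 u, ContMDiffAt 𝓘(ℝ, U) 𝓘(ℝ, E) ∞ (fun w => (chartOneInv (ℓ w) : G)) w := by
    have h1 : Filter.Tendsto ℓ (𝓝 u) (𝓝 0) := by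
      simpa [hℓu] using hℓ.continuous.tendsto u
    filter_upwards [h1.eventually (eventually_contMDiffAt_chartOneInv (E := E) (G := G))] with w hw
    exact ContMDiffAt.comp (I' := 𝓘(ℝ, E)) w (g := chartOneInv) hw hℓ.contMDiff.contMDiffAt
  refine ⟨fun w => chartOneInv (ℓ w), hev, ?_⟩
  have hd : fderiv ℝ ℓ u = -b u := by
    have h1 : HasFDerivAt (fun w => w - u) (ContinuousLinearMap.id ℝ U) u :=
      (hasFDerivAt_id u).sub_const u
    have h2 : HasFDerivAt ℓ _ u := ((b u).hasFDerivAt.comp u h1).neg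
    rw [h2.fderiv, ContinuousLinearMap.comp_id]
  have h3 : leftMC (E := E) (fun w => (chartOneInv (ℓ w) : G)) u = -b u := by
    rw [leftMC_comp (φ := chartOneInv) (by
      rw [hℓu]
      exact mdifferentiableAt_of_contMDiffAt contMDiffAt_chartOneInv)
      (hℓ.differentiable (by simp) u), hd, hℓu, leftMC_chartOneInv_zero,
      ContinuousLinearMap.id_comp]
  rw [gauge, h3, hℓu]
  simp [Ad_one]

/-- The bracket term is quadratic in `b`, so its derivative vanishes where `b` does, and only the
derivative of `db` remains. -/
theorem fderiv_curvForm_apply {b : U → U →L[ℝ] E} {u : U} (hb : ContDiffAt ℝ ∞ b u)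
    (h0 : b u = 0) (x : U) (v : Fin 2 → U) :
    fderiv ℝ (curvForm G b) u x v =
      fderiv ℝ (fderiv ℝ b) u x (v 0) (v 1) - fderiv ℝ (fderiv ℝ b) u x (v 1) (v 0) := by
  have hF := ((contDiffAt_curvForm (G := G) hb).differentiableAt (by simp)).hasFDerivAt
  have h1 : HasFDerivAt (fun w => curvForm G b w v) _ u :=
    (ContinuousAlternatingMap.apply ℝ U E v).hasFDerivAt.comp u hF
  have hev : ∀ᶠ w in 𝓝 u, DifferentiableAt ℝ b w :=
    (hb.of_le (m := 1) (by simp)).eventually (by simp) |>.mono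
      fun y hy => hy.differentiableAt (by simp)
  have heq : (fun w => curvForm G b w v) =ᶠ[𝓝 u] fun w => curv G b w (v 0) (v 1) := by
    filter_upwards [hev] with w hw
    exact curvForm_apply hw v
  have hdb := (hb.differentiableAt (by simp)).hasFDerivAt
  have hddb := ((hb.fderiv_right (m := ∞) (by simp)).differentiableAt (by simp)).hasFDerivAt
  have hA : ∀ y z : U, HasFDerivAt (fun w => fderiv ℝ b w y z) _ u := fun y z =>
    (hddb.clm_apply (hasFDerivAt_const y u)).clm_apply (hasFDerivAt_const z u)
  have hB : ∀ y : U, HasFDerivAt (fun w => b w y) _ u := fun y =>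
    hdb.clm_apply (hasFDerivAt_const y u)
  have hL : HasFDerivAt (fun w => (lieBilin E G).toContinuousBilinearMap (b w (v 0)) (b w (v 1)))
      _ u := ((lieBilin E G).toContinuousBilinearMap.hasFDerivAt.comp u (hB (v 0))).clm_apply
        (hB (v 1))
  have h2 : HasFDerivAt (fun w => curv G b w (v 0) (v 1)) _ u :=
    ((hA (v 0) (v 1)).sub (hA (v 1) (v 0))).add hL
  have h3 := congrArg (fun L : U →L[ℝ] E => L x) ((h1.congr_of_eventuallyEq heq.symm).unique h2)
  simpa [h0] using h3

/-- Chern-Weil forms are closed. -/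
theorem extDeriv_cwForm {k : ℕ} (f : InvPoly E G k) {b : U → U →L[ℝ] E} {u : U}
    (hb : ContDiffAt ℝ ∞ b u) : extDeriv (cwForm f b) u = 0 := by
  obtain ⟨g, hg, h0⟩ := exists_gauge_eq_zero G b u
  have hbs : ∀ᶠ w in 𝓝 u, DifferentiableAt ℝ b w :=
    (hb.of_le (m := 1) (by simp)).eventually (by simp) |>.mono
      fun y hy => hy.differentiableAt (by simp)
  have heq : cwForm f b =ᶠ[𝓝 u] cwForm f (gauge g b) := by
    filter_upwards [hg, hbs] with w hw hbw
    exact (cwForm_gauge f hw hbw).symm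
  rw [heq.extDeriv_eq]
  have hb' : ContDiffAt ℝ ∞ (gauge g b) u := contDiffAt_gauge hg.self_of_nhds hb
  refine extDeriv_formEval_eq_zero _ _ (contDiffAt_curvForm hb') fun x y z => ?_
  have hs := hb'.isSymmSndFDerivAt (by simpa using (WithTop.coe_le_coe.2 le_top :
    ((2 : ℕ∞) : WithTop ℕ∞) ≤ ((⊤ : ℕ∞) : WithTop ℕ∞)))
  simp only [fderiv_curvForm_apply hb' h0, Matrix.cons_val_zero, Matrix.cons_val_one]
  -- The cyclic sum consists of six second derivatives of the gauge transform of `b`, which cancel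
  -- in pairs by symmetry.
  rw [hs.eq x y, hs.eq x z, hs.eq y z]
  abel

end Closed

/-! ## Calculus of differential forms on diffeological spaces -/

section DForms

variable {X Y Z : Type*} [DiffeologicalSpace X] [DiffeologicalSpace Y] [DiffeologicalSpace Z] {k : ℕ}
  {V : Type*} [NormedAddCommGroup V] [NormedSpace ℝ V]

theorem DForm.ext' {η ξ : DForm X k V}
    (h : ∀ (n : ℕ) (p : Eu n → X) (hp : IsPlot p) u, η.on p hp u = ξ.on p hp u) : η = ξ :=
  Subtype.ext (funext fun n => funext fun p => funext fun u => h n p.1 p.2 u)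

theorem DForm.contDiff_on (η : DForm X k V) {n : ℕ} {p : Eu n → X} (hp : IsPlot p) :
    ContDiff ℝ ∞ (η.on p hp) := η.2.1 n ⟨p, hp⟩

theorem DForm.on_comp (η : DForm X k V) {n m : ℕ} {p : Eu n → X} (hp : IsPlot p)
    {ψ : Eu m → Eu n} (hψ : ContDiff ℝ ∞ ψ) (hp' : IsPlot (p ∘ ψ)) (u : Eu m) :
    η.on (p ∘ ψ) hp' u = (η.on p hp (ψ u)).compContinuousLinearMap (fderiv ℝ ψ u) :=
  η.2.2 n m ⟨p, hp⟩ ψ hψ u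

theorem DForm.on_eq_of_eq (η : DForm X k V) {n : ℕ} {p p' : Eu n → X} (hp : IsPlot p)
    (hp' : IsPlot p') (h : p = p') (u : Eu n) : η.on p hp u = η.on p' hp' u := by
  subst h; rfl

@[simp] theorem DForm.on_add (η ξ : DForm X k V) {n : ℕ} (p : Eu n → X) (hp : IsPlot p) (u : Eu n) :
    (η + ξ).on p hp u = η.on p hp u + ξ.on p hp u := rfl

@[simp] theorem DForm.on_sub (η ξ : DForm X k V) {n : ℕ} (p : Eu n → X) (hp : IsPlot p) (u : Eu n) :
    (η - ξ).on p hp u = η.on p hp u - ξ.on p hp u := rfl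

@[simp] theorem DForm.on_smul (c : ℝ) (η : DForm X k V) {n : ℕ} (p : Eu n → X) (hp : IsPlot p)
    (u : Eu n) : (c • η).on p hp u = c • η.on p hp u := rfl

@[simp] theorem DForm.on_zero {n : ℕ} (p : Eu n → X) (hp : IsPlot p) (u : Eu n) :
    (0 : DForm X k V).on p hp u = 0 := rfl

theorem d_on (η : DForm X k V) {n : ℕ} (p : Eu n → X) (hp : IsPlot p) (u : Eu n) :
    (d X k V η).on p hp u = extDeriv (η.on p hp) u := rfl

/-- The retraction of `exists_smooth_retract`, for germs of plots. -/
theorem exists_retract_of_eventuallyEq {α : Type*} {n : ℕ} {p p' : Eu n → α} {u : Eu n}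
    (h : p =ᶠ[𝓝 u] p') :
    ∃ ρ : Eu n → Eu n, ContDiff ℝ ∞ ρ ∧ p ∘ ρ = p' ∘ ρ ∧ ρ =ᶠ[𝓝 u] id := by
  obtain ⟨s, hs, hos, hus⟩ := eventually_nhds_iff.mp h
  obtain ⟨ρ, hρ, hρs, hρu⟩ := exists_smooth_retract hos hus
  exact ⟨ρ, hρ, funext fun y => hs _ (hρs y), hρu⟩

theorem DForm.on_comp_retract (η : DForm X k V) {n : ℕ} {p : Eu n → X} (hp : IsPlot p)
    {ρ : Eu n → Eu n} (hρ : ContDiff ℝ ∞ ρ) {u : Eu n} (hρu : ρ =ᶠ[𝓝 u] id) :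
    η.on (p ∘ ρ) (isPlot_reparam hp hρ) u = η.on p hp u := by
  rw [η.on_comp hp hρ, hρu.fderiv_eq, fderiv_id, hρu.self_of_nhds]
  rfl

/-- The value of a form on a plot at a point depends only on the germ of the plot. -/
theorem DForm.on_congr (η : DForm X k V) {n : ℕ} {p p' : Eu n → X} (hp : IsPlot p)
    (hp' : IsPlot p') {u : Eu n} (h : p =ᶠ[𝓝 u] p') : η.on p hp u = η.on p' hp' u := by
  obtain ⟨ρ, hρ, hpp, hρu⟩ := exists_retract_of_eventuallyEq h
  rw [← η.on_comp_retract hp hρ hρu, ← η.on_comp_retract hp' hρ hρu]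
  exact η.on_eq_of_eq _ _ hpp u

/-- A form from its pull-backs along plots. -/
def DForm.mk (ζ : ∀ (n : ℕ) (p : Eu n → X), IsPlot p → Eu n → Eu n [⋀^Fin k]→L[ℝ] V)
    (hζ : ∀ n p hp, ContDiff ℝ ∞ (ζ n p hp))
    (hψ : ∀ (n m : ℕ) (p : Eu n → X) (hp : IsPlot p) (ψ : Eu m → Eu n) (hψ : ContDiff ℝ ∞ ψ) u,
      ζ m (p ∘ ψ) (isPlot_reparam hp hψ) u =
        (ζ n p hp (ψ u)).compContinuousLinearMap (fderiv ℝ ψ u)) : DForm X k V :=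
  ⟨fun n p => ζ n p.1 p.2, fun n p => hζ n p.1 p.2, fun n m p ψ h u => hψ n m p.1 p.2 ψ h u⟩

/-- The pull-back of a form along a smooth map. -/
def DForm.pullback (φ : X → Y) (hφ : DSmooth φ) (η : DForm Y k V) : DForm X k V :=
  DForm.mk (fun _ p hp => η.on (φ ∘ p) (hp.dSmooth_comp hφ)) (fun _ _ _ => η.contDiff_on _)
    fun _ _ _ hp _ hψ u => η.on_comp (hp.dSmooth_comp hφ) hψ _ u

theorem DForm.pullback_on (φ : X → Y) (hφ : DSmooth φ) (η : DForm Y k V) {n : ℕ} (p : Eu n → X)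
    (hp : IsPlot p) : (η.pullback φ hφ).on p hp = η.on (φ ∘ p) (hp.dSmooth_comp hφ) := rfl

theorem d_pullback (φ : X → Y) (hφ : DSmooth φ) (η : DForm Y k V) :
    d X k V (η.pullback φ hφ) = (d Y k V η).pullback φ hφ := rfl

theorem DForm.pullback_congr {φ φ' : X → Y} (hφ : DSmooth φ) (hφ' : DSmooth φ') (h : φ = φ')
    (η : DForm Y k V) : η.pullback φ hφ = η.pullback φ' hφ' := by
  subst h; rfl

/-- `q` has smooth local sections along plots. -/
def HasLocalLifts (q : Y → X) : Prop :=
  ∀ (n : ℕ) (x : Eu n → X), IsPlot x → ∀ u, ∃ r : Eu n → Y, IsPlot r ∧ q ∘ r =ᶠ[𝓝 u] x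

theorem DForm.eq_of_lifts {q : Y → X} (hq : DSmooth q) (hl : HasLocalLifts q) {η ξ : DForm X k V}
    (h : ∀ (n : ℕ) (r : Eu n → Y) (hr : IsPlot r) u,
      η.on (q ∘ r) (hr.dSmooth_comp hq) u = ξ.on (q ∘ r) (hr.dSmooth_comp hq) u) : η = ξ := by
  refine DForm.ext' fun n p hp u => ?_
  obtain ⟨r, hr, hrp⟩ := hl n p hp u
  rw [← η.on_congr (hr.dSmooth_comp hq) hp hrp, ← ξ.on_congr (hr.dSmooth_comp hq) hp hrp]
  exact h n r hr u

/-- A form on `Y` whose values depend only on the image in `X` is the pull-back of a form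
on `X`. -/
theorem DForm.exists_descend {q : Y → X} (hq : DSmooth q) (hl : HasLocalLifts q) (η : DForm Y k V)
    (hb : ∀ (n : ℕ) (r r' : Eu n → Y) (hr : IsPlot r) (hr' : IsPlot r'), q ∘ r = q ∘ r' →
      ∀ u, η.on r hr u = η.on r' hr' u) :
    ∃ ξ : DForm X k V, ∀ (n : ℕ) (r : Eu n → Y) (hr : IsPlot r) u,
      ξ.on (q ∘ r) (hr.dSmooth_comp hq) u = η.on r hr u := by
  -- The hypothesis compares plots that agree globally in `X`; precomposition with a retraction
  -- extends it to plots whose images agree only near `u`.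
  have hb' : ∀ (n : ℕ) (r r' : Eu n → Y) (hr : IsPlot r) (hr' : IsPlot r') (u : Eu n),
      q ∘ r =ᶠ[𝓝 u] q ∘ r' → η.on r hr u = η.on r' hr' u := by
    intro n r r' hr hr' u h
    obtain ⟨ρ, hρ, hpp, hρu⟩ := exists_retract_of_eventuallyEq h
    rw [← η.on_comp_retract hr hρ hρu, ← η.on_comp_retract hr' hρ hρu]
    exact hb n _ _ _ _ hpp u
  -- The value at `u` is read off from a lift chosen for `u` alone. Lifts chosen at neighbouring
  -- points need not fit together, but by `hb'` they give the same values, so smoothness can be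
  -- checked on one fixed lift.
  choose lift hlift hql using hl
  refine ⟨DForm.mk (fun n x hx u => η.on (lift n x hx u) (hlift n x hx u) u) ?_ ?_, ?_⟩
  · intro n x hx
    refine contDiff_iff_contDiffAt.2 fun u => ?_
    refine (η.contDiff_on (hlift n x hx u)).contDiffAt.congr_of_eventuallyEq ?_
    filter_upwards [(hql n x hx u).eventually_nhds] with w hw
    exact hb' n _ _ _ _ w ((hql n x hx w).trans (Filter.EventuallyEq.symm hw))
  · intro n m x hx ψ hψ u
    rw [← η.on_comp (hlift n x hx (ψ u)) hψ (isPlot_reparam (hlift n x hx (ψ u)) hψ)]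
    refine hb' m _ _ _ _ u ((hql m (x ∘ ψ) _ u).trans ?_)
    filter_upwards [hψ.continuous.continuousAt.eventually (hql n x hx (ψ u))] with w hw
    exact hw.symm
  · intro n r hr u
    exact hb' n _ _ _ _ u (hql n (q ∘ r) _ u)

end DForms

/-! ## Integration along an interval -/

section Integration

/-- On the compact product of a ball around `u` with the interval the partial derivative is bounded,
and this bound is the dominating function. -/
theorem hasFDerivAt_intervalIntegral {n : ℕ} {V : Type*} [NormedAddCommGroup V] [NormedSpace ℝ V]
    {F : Eu n × ℝ → V} (hF : ContDiff ℝ ∞ F) (a b : ℝ) (u : Eu n) :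
    HasFDerivAt (fun w => ∫ t in a..b, F (w, t))
      (∫ t in a..b, (fderiv ℝ F (u, t)).comp (ContinuousLinearMap.inl ℝ (Eu n) ℝ)) u := by
  have hc : Continuous fun x : Eu n × ℝ =>
      (fderiv ℝ F x).comp (ContinuousLinearMap.inl ℝ (Eu n) ℝ) :=
    ((hF.continuous_fderiv (by simp)).clm_comp continuous_const)
  obtain ⟨C, hC⟩ := ((isCompact_closedBall u 1).prod
    (isCompact_uIcc (a := a) (b := b))).exists_bound_of_continuousOn hc.continuousOn
  refine intervalIntegral.hasFDerivAt_integral_of_dominated_of_fderiv_le (𝕜 := ℝ)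
    (s := Metric.closedBall u 1) (bound := fun _ => C)
    (F' := fun w t => (fderiv ℝ F (w, t)).comp (ContinuousLinearMap.inl ℝ (Eu n) ℝ))
    (Metric.closedBall_mem_nhds u one_pos) ?_ ?_ ?_ ?_ ?_ ?_
  · exact Filter.Eventually.of_forall fun w =>
      (hF.continuous.comp (Continuous.prodMk_right w)).aestronglyMeasurable
  · exact (hF.continuous.comp (Continuous.prodMk_right u)).intervalIntegrable _ _
  · exact (hc.comp (Continuous.prodMk_right u)).aestronglyMeasurable
  · exact Filter.Eventually.of_forall fun t ht w hw =>
      hC (w, t) ⟨hw, Set.uIoc_subset_uIcc ht⟩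
  · exact intervalIntegrable_const
  · refine Filter.Eventually.of_forall fun t _ w _ => ?_
    exact (hF.differentiable (by simp) (w, t)).hasFDerivAt.comp w (hasFDerivAt_prodMk_left w t)

theorem contDiff_intervalIntegral {n : ℕ} {V : Type*} [NormedAddCommGroup V] [NormedSpace ℝ V]
    {F : Eu n × ℝ → V} (hF : ContDiff ℝ ∞ F) (a b : ℝ) :
    ContDiff ℝ ∞ (fun w => ∫ t in a..b, F (w, t)) := by
  refine contDiff_infty.2 fun m => ?_
  -- The derivative is again an integral of the same type, but with values in a space of linear
  -- maps, so `V` has to vary.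
  induction m generalizing V with
  | zero =>
    refine contDiff_zero.2 (continuous_iff_continuousAt.2 fun u => ?_)
    exact (hasFDerivAt_intervalIntegral hF a b u).continuousAt
  | succ m ih =>
    have h : ContDiff ℝ (m + 1) (fun w => ∫ t in a..b, F (w, t)) := by
      rw [contDiff_succ_iff_fderiv]
      refine ⟨fun u => (hasFDerivAt_intervalIntegral hF a b u).differentiableAt, by simp, ?_⟩
      have h1 : fderiv ℝ (fun w => ∫ t in a..b, F (w, t)) = fun u =>
          ∫ t in a..b, (fderiv ℝ F (u, t)).comp (ContinuousLinearMap.inl ℝ (Eu n) ℝ) :=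
        funext fun u => (hasFDerivAt_intervalIntegral hF a b u).fderiv
      rw [h1]
      exact ih (F := fun x => (fderiv ℝ F x).comp (ContinuousLinearMap.inl ℝ (Eu n) ℝ))
        ((hF.fderiv_right (m := ∞) (by simp)).clm_comp contDiff_const)
    exact_mod_cast h

/-- `snoc` as a continuous linear map. -/
def snocL (n : ℕ) : Eu n × ℝ →L[ℝ] Eu (n + 1) :=
  LinearMap.toContinuousLinearMap
    { toFun := fun x => snoc x.1 x.2
      map_add' := fun x y => by
        ext i
        refine Fin.lastCases ?_ (fun i => ?_) i <;> simp [snoc]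
      map_smul' := fun c x => by
        ext i
        refine Fin.lastCases ?_ (fun i => ?_) i <;> simp [snoc] }

@[simp] theorem snocL_apply {n : ℕ} (u : Eu n) (t : ℝ) : snocL n (u, t) = snoc u t := rfl

@[simp] theorem initial_snoc {n : ℕ} (u : Eu n) (t : ℝ) : initial (snoc u t) = u := by
  ext i
  simp [initial, snoc]

@[simp] theorem snoc_last {n : ℕ} (u : Eu n) (t : ℝ) : snoc u t (Fin.last n) = t := by
  simp [snoc]

/-- `initial` as a continuous linear map. -/
def initialL (n : ℕ) : Eu (n + 1) →L[ℝ] Eu n :=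
  LinearMap.toContinuousLinearMap
    { toFun := initial
      map_add' := fun _ _ => rfl
      map_smul' := fun _ _ => rfl }

@[simp] theorem initialL_apply {n : ℕ} (w : Eu (n + 1)) : initialL n w = initial w := rfl

/-- The inclusion `v ↦ (v, 0)`. -/
def inclL (n : ℕ) : Eu n →L[ℝ] Eu (n + 1) := (snocL n).comp (ContinuousLinearMap.inl ℝ (Eu n) ℝ)

@[simp] theorem inclL_apply {n : ℕ} (v : Eu n) : inclL n v = snoc v 0 := rfl

theorem hasFDerivAt_snoc {n : ℕ} (t : ℝ) (u : Eu n) :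
    HasFDerivAt (fun u => snoc u t) (inclL n) u :=
  ((snocL n).hasFDerivAt).comp u (hasFDerivAt_prodMk_left u t)

theorem contDiff_snoc {n : ℕ} (t : ℝ) : ContDiff ℝ ∞ (fun u : Eu n => snoc u t) :=
  (snocL n).contDiff.comp (contDiff_id.prodMk contDiff_const)

theorem hasDerivAt_snoc {n : ℕ} (t : ℝ) (u : Eu n) :
    HasDerivAt (fun t => snoc u t) (snoc 0 1) t := by
  have h : HasFDerivAt (fun t => snoc u t) _ t :=
    ((snocL n).hasFDerivAt).comp t (hasFDerivAt_prodMk_right u t)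
  have h2 := h.hasDerivAt
  simpa using h2

variable {V : Type*} [NormedAddCommGroup V] [NormedSpace ℝ V]

/-- The contraction of a form on `ℝⁿ × ℝ` with the last coordinate vector, restricted to `ℝⁿ`. -/
def contractLast {n j : ℕ} (ζ : Eu (n + 1) [⋀^Fin (j + 1)]→L[ℝ] V) : Eu n [⋀^Fin j]→L[ℝ] V :=
  (ζ.curryLeft (snoc 0 1)).compContinuousLinearMap (inclL n)

theorem contractLast_apply {n j : ℕ} (ζ : Eu (n + 1) [⋀^Fin (j + 1)]→L[ℝ] V) (v : Fin j → Eu n) :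
    contractLast ζ v = ζ (Matrix.vecCons (snoc 0 1) fun i => snoc (v i) 0) := rfl

/-- The plot `(u, t) ↦ (p(u), t)`. -/
def cylR {M : Type*} {n : ℕ} (p : Eu n → M) (w : Eu (n + 1)) : M × ℝ :=
  (p (initial w), w (Fin.last n))

variable {M : Type*} [DiffeologicalSpace M]

theorem isPlot_cylR {n : ℕ} {p : Eu n → M} (hp : IsPlot p) : IsPlot (cylR p) := by
  refine ⟨isPlot_reparam hp (f := initial) (initialL n).contDiff, ?_⟩
  show ContDiff ℝ ∞ fun w : Eu (n + 1) => w (Fin.last n)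
  fun_prop

variable [FiniteDimensional ℝ V]

theorem contDiff_contractLast {n j : ℕ} {X : Type*} [NormedAddCommGroup X] [NormedSpace ℝ X]
    {ζ : X → Eu (n + 1) [⋀^Fin (j + 1)]→L[ℝ] V} (hζ : ContDiff ℝ ∞ ζ) :
    ContDiff ℝ ∞ fun x => contractLast (ζ x) :=
  contDiff_alternating fun _ => contDiff_iff_contDiffAt.2 fun _ =>
    contDiffAt_alternating_apply hζ.contDiffAt _

theorem contDiff_contractLast_snoc {n j : ℕ} {ζ : Eu (n + 1) → Eu (n + 1) [⋀^Fin (j + 1)]→L[ℝ] V}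
    (hζ : ContDiff ℝ ∞ ζ) :
    ContDiff ℝ ∞ fun x : Eu n × ℝ => contractLast (ζ (snoc x.1 x.2)) :=
  contDiff_contractLast (hζ.comp (snocL n).contDiff)

theorem continuous_contractLast_snoc {n j : ℕ}
    {ζ : Eu (n + 1) → Eu (n + 1) [⋀^Fin (j + 1)]→L[ℝ] V} (hζ : ContDiff ℝ ∞ ζ) (u : Eu n) :
    Continuous fun t : ℝ => contractLast (ζ (snoc u t)) := by
  have h1 : ContDiff ℝ ∞ fun t : ℝ => ζ (snoc u t) :=
    hζ.comp ((snocL n).contDiff.comp (contDiff_const.prodMk contDiff_id))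
  exact (contDiff_contractLast h1).continuous

theorem intervalIntegral_alternating_apply {n j : ℕ} {ζ : ℝ → Eu n [⋀^Fin j]→L[ℝ] V}
    (hζ : Continuous ζ) (a b : ℝ) (v : Fin j → Eu n) :
    (∫ t in a..b, ζ t) v = ∫ t in a..b, ζ t v :=
  ((ContinuousAlternatingMap.apply ℝ (Eu n) V v).intervalIntegral_comp_comm
    (hζ.intervalIntegrable a b)).symm

theorem contractLast_comp {n m j : ℕ} (ζ : Eu (n + 1) [⋀^Fin (j + 1)]→L[ℝ] V)
    (L : Eu (m + 1) →L[ℝ] Eu (n + 1)) (D : Eu m →L[ℝ] Eu n) (h0 : ∀ v, L (snoc v 0) = snoc (D v) 0)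
    (h1 : L (snoc 0 1) = snoc 0 1) :
    contractLast (ζ.compContinuousLinearMap L) = (contractLast ζ).compContinuousLinearMap D := by
  ext v
  rw [ContinuousAlternatingMap.compContinuousLinearMap_apply, contractLast_apply,
    contractLast_apply, ContinuousAlternatingMap.compContinuousLinearMap_apply]
  congr 1
  funext i
  refine Fin.cases ?_ (fun i => ?_) i
  · simpa using h1
  · simpa using h0 (v i)

/-- The product of a change of parameters with the identity of `ℝ`. -/
def prodMap {n m : ℕ} (ψ : Eu m → Eu n) (w : Eu (m + 1)) : Eu (n + 1) :=
  snoc (ψ (initial w)) (w (Fin.last m))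

theorem contDiff_prodMap {n m : ℕ} {ψ : Eu m → Eu n} (hψ : ContDiff ℝ ∞ ψ) :
    ContDiff ℝ ∞ (prodMap ψ) :=
  (snocL n).contDiff.comp ((hψ.comp (initialL m).contDiff).prodMk
    (EuclideanSpace.proj (𝕜 := ℝ) (Fin.last m)).contDiff)

theorem hasFDerivAt_prodMap {n m : ℕ} {ψ : Eu m → Eu n} (hψ : ContDiff ℝ ∞ ψ) (u : Eu m) (t : ℝ) :
    HasFDerivAt (prodMap ψ) ((snocL n).comp (((fderiv ℝ ψ u).comp (initialL m)).prod
      (EuclideanSpace.proj (𝕜 := ℝ) (Fin.last m)))) (snoc u t) := by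
  have hψd : HasFDerivAt ψ (fderiv ℝ ψ u) (initialL m (snoc u t)) := by
    rw [initialL_apply, initial_snoc]
    exact (hψ.differentiable (by simp) u).hasFDerivAt
  have hlast : HasFDerivAt (fun w : Eu (m + 1) => w (Fin.last m))
      (EuclideanSpace.proj (𝕜 := ℝ) (Fin.last m)) (snoc u t) :=
    (EuclideanSpace.proj (𝕜 := ℝ) (Fin.last m)).hasFDerivAt
  exact (snocL n).hasFDerivAt.comp _ ((hψd.comp _ (initialL m).hasFDerivAt).prodMk hlast)

theorem cylR_comp {n m : ℕ} (p : Eu n → M) (ψ : Eu m → Eu n) :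
    cylR (p ∘ ψ) = cylR p ∘ prodMap ψ := by
  funext w
  simp [cylR, prodMap]

theorem DForm.contractLast_on_comp {j : ℕ} (c : DForm (M × ℝ) (j + 1) V) {n m : ℕ} {p : Eu n → M}
    (hp : IsPlot p) {ψ : Eu m → Eu n} (hψ : ContDiff ℝ ∞ ψ) (u : Eu m) (t : ℝ) :
    contractLast (c.on (cylR (p ∘ ψ)) (isPlot_cylR (isPlot_reparam hp hψ)) (snoc u t)) =
      (contractLast (c.on (cylR p) (isPlot_cylR hp) (snoc (ψ u) t))).compContinuousLinearMap
        (fderiv ℝ ψ u) := by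
  rw [c.on_eq_of_eq _ (isPlot_reparam (isPlot_cylR hp) (contDiff_prodMap hψ)) (cylR_comp p ψ),
    c.on_comp (isPlot_cylR hp) (contDiff_prodMap hψ), (hasFDerivAt_prodMap hψ u t).fderiv]
  rw [contractLast_comp _ _ (fderiv ℝ ψ u)]
  · simp [prodMap]
  · intro v
    simp [snocL_apply]
  · simp [snocL_apply]

/-- Integration over `[a, b]` of the contraction with the second coordinate vector of
`M × ℝ`. -/
def DForm.integrate {j : ℕ} (a b : ℝ) (c : DForm (M × ℝ) (j + 1) V) : DForm M j V :=
  DForm.mk (fun _ p hp u => ∫ t in a..b, contractLast (c.on (cylR p) (isPlot_cylR hp) (snoc u t)))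
    (fun n p hp => contDiff_intervalIntegral (contDiff_contractLast_snoc (c.contDiff_on _)) a b)
    (by
      intro n m p hp ψ hψ u
      ext v
      rw [ContinuousAlternatingMap.compContinuousLinearMap_apply,
        intervalIntegral_alternating_apply (continuous_contractLast_snoc (c.contDiff_on _) _),
        intervalIntegral_alternating_apply (continuous_contractLast_snoc (c.contDiff_on _) _)]
      congr 1
      funext t
      rw [c.contractLast_on_comp hp hψ]
      rfl)

theorem DForm.integrate_on {j : ℕ} (a b : ℝ) (c : DForm (M × ℝ) (j + 1) V) {n : ℕ} (p : Eu n → M)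
    (hp : IsPlot p) (u : Eu n) (v : Fin j → Eu n) :
    (c.integrate a b).on p hp u v = ∫ t in a..b,
      c.on (cylR p) (isPlot_cylR hp) (snoc u t) (Matrix.vecCons (snoc 0 1) fun i => snoc (v i) 0) :=
  intervalIntegral_alternating_apply (continuous_contractLast_snoc (c.contDiff_on _) u) a b v

theorem dSmooth_prodMk_right (t : ℝ) : DSmooth fun x : M => (x, t) :=
  fun _ _ hp => ⟨hp, isPlot_const⟩

theorem fderiv_alternating_apply {X : Type*} [NormedAddCommGroup X] [NormedSpace ℝ X] {n j : ℕ}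
    {ζ : X → Eu n [⋀^Fin j]→L[ℝ] V} {x : X} (hζ : DifferentiableAt ℝ ζ x) (v : X)
    (w : Fin j → Eu n) : fderiv ℝ (fun y => ζ y w) x v = fderiv ℝ ζ x v w := by
  have h : HasFDerivAt (fun y => ζ y w) _ x :=
    (ContinuousAlternatingMap.apply ℝ (Eu n) V w).hasFDerivAt.comp x hζ.hasFDerivAt
  rw [h.fderiv]
  rfl

/-- The term of `dζ` that differentiates in the last coordinate direction is separated from the
others, whose indices move by one; this is the source of the minus sign. -/
theorem contractLast_extDeriv {n j : ℕ} {ζ : Eu (n + 1) → Eu (n + 1) [⋀^Fin (j + 1)]→L[ℝ] V}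
    {x : Eu (n + 1)} (hζ : DifferentiableAt ℝ ζ x) (v : Fin (j + 1) → Eu n) :
    contractLast (extDeriv ζ x) v = fderiv ℝ ζ x (snoc 0 1) (fun i => snoc (v i) 0) -
      ∑ i : Fin (j + 1), (-1 : ℝ) ^ (i : ℕ) • fderiv ℝ ζ x (snoc (v i) 0)
        (Matrix.vecCons (snoc 0 1) fun l => snoc (i.removeNth v l) 0) := by
  rw [contractLast_apply, extDeriv_apply hζ, Fin.sum_univ_succ, sub_eq_add_neg,
    ← Finset.sum_neg_distrib]
  simp only [← Int.cast_smul_eq_zsmul ℝ, Int.cast_pow, Int.cast_neg, Int.cast_one]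
  congr 1
  · rw [Fin.val_zero, pow_zero, one_smul, fderiv_alternating_apply hζ]
    rfl
  · refine Fintype.sum_congr _ _ fun i => ?_
    have h3 : i.succ.removeNth (Matrix.vecCons (snoc 0 1) fun i => snoc (v i) 0) =
        Matrix.vecCons (snoc 0 1) fun l => snoc (i.removeNth v l) 0 := by
      funext l
      refine Fin.cases ?_ (fun l => ?_) l <;> simp [Fin.removeNth]
    rw [h3, fderiv_alternating_apply hζ, Fin.val_succ, pow_succ, mul_neg_one, neg_smul]
    rfl

/-- Differentiation under the integral sign gives the sum subtracted in `contractLast_extDeriv`. In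
the homotopy formula the two cancel, leaving the `t`-derivative to the fundamental theorem of
calculus. -/
theorem extDeriv_integral_contractLast {n j : ℕ}
    {ζ : Eu (n + 1) → Eu (n + 1) [⋀^Fin (j + 1)]→L[ℝ] V} (hζ : ContDiff ℝ ∞ ζ) (a b : ℝ) (u : Eu n)
    (v : Fin (j + 1) → Eu n) :
    extDeriv (fun u => ∫ t in a..b, contractLast (ζ (snoc u t))) u v =
      ∫ t in a..b, ∑ i : Fin (j + 1), (-1 : ℝ) ^ (i : ℕ) • fderiv ℝ ζ (snoc u t) (snoc (v i) 0)
        (Matrix.vecCons (snoc 0 1) fun l => snoc (i.removeNth v l) 0) := by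
  have hF := contDiff_contractLast_snoc hζ
  have hd : ∀ x w, fderiv ℝ (fun x : Eu n × ℝ => contractLast (ζ (snoc x.1 x.2))) x (w, 0) =
      contractLast (fderiv ℝ ζ (snoc x.1 x.2) (snoc w 0)) := by
    intro x w
    ext v
    have h1 : HasFDerivAt (fun x : Eu n × ℝ => ζ (snoc x.1 x.2)) _ x :=
      (hζ.differentiable (by simp) (snocL n x)).hasFDerivAt.comp x (snocL n).hasFDerivAt
    rw [← fderiv_alternating_apply (hF.differentiable (by simp) x)]
    simp only [contractLast_apply]
    rw [fderiv_alternating_apply h1.differentiableAt, h1.fderiv]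
    rfl
  rw [extDeriv_apply ((contDiff_intervalIntegral hF a b).differentiable (by simp) u),
    intervalIntegral.integral_finsetSum]
  · refine Fintype.sum_congr _ _ fun i => ?_
    rw [intervalIntegral.integral_smul, ← Int.cast_smul_eq_zsmul ℝ, Int.cast_pow, Int.cast_neg,
      Int.cast_one]
    congr 1
    rw [fderiv_alternating_apply ((contDiff_intervalIntegral hF a b).differentiable (by simp) u),
      (hasFDerivAt_intervalIntegral hF a b u).fderiv]
    have hc : Continuous fun t : ℝ =>
        (fderiv ℝ (fun x : Eu n × ℝ => contractLast (ζ (snoc x.1 x.2))) (u, t)).comp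
          (ContinuousLinearMap.inl ℝ (Eu n) ℝ) :=
      ((hF.continuous_fderiv (by simp)).comp (Continuous.prodMk_right u)).clm_comp continuous_const
    rw [ContinuousLinearMap.intervalIntegral_apply (hc.intervalIntegrable _ _),
      intervalIntegral_alternating_apply (hc.clm_apply continuous_const)]
    congr 1
    funext t
    rw [ContinuousLinearMap.comp_apply, ContinuousLinearMap.inl_apply, hd]
    rfl
  · intro i _
    have hc : Continuous fun t : ℝ => fderiv ℝ ζ (snoc u t) (snoc (v i) 0)
        (Matrix.vecCons (snoc 0 1) fun l => snoc (i.removeNth v l) 0) :=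
      (ContinuousAlternatingMap.apply ℝ (Eu (n + 1)) V _).continuous.comp
        (((hζ.continuous_fderiv (by simp)).comp
          ((snocL n).continuous.comp (Continuous.prodMk_right u))).clm_apply continuous_const)
    exact (hc.const_smul ((-1 : ℝ) ^ (i : ℕ))).intervalIntegrable _ _

/-- The homotopy formula on `ℝⁿ × ℝ`. -/
theorem extDeriv_integral_contractLast_add {n j : ℕ}
    {ζ : Eu (n + 1) → Eu (n + 1) [⋀^Fin (j + 1)]→L[ℝ] V} (hζ : ContDiff ℝ ∞ ζ) (a b : ℝ) (u : Eu n)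
    (v : Fin (j + 1) → Eu n) :
    extDeriv (fun u => ∫ t in a..b, contractLast (ζ (snoc u t))) u v +
      (∫ t in a..b, contractLast (extDeriv ζ (snoc u t)) v) =
      ζ (snoc u b) (fun i => snoc (v i) 0) - ζ (snoc u a) (fun i => snoc (v i) 0) := by
  have hζd : Differentiable ℝ ζ := hζ.differentiable (by simp)
  have hDc : ∀ (x : Eu (n + 1)) (w : Fin (j + 1) → Eu (n + 1)),
      Continuous fun t : ℝ => fderiv ℝ ζ (snoc u t) x w := fun x w =>
    (ContinuousAlternatingMap.apply ℝ (Eu (n + 1)) V w).continuous.comp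
      (((hζ.continuous_fderiv (by simp)).comp
        ((snocL n).continuous.comp (Continuous.prodMk_right u))).clm_apply continuous_const)
  simp only [contractLast_extDeriv (hζd _)]
  rw [extDeriv_integral_contractLast hζ, intervalIntegral.integral_sub, add_sub_cancel]
  · refine intervalIntegral.integral_eq_sub_of_hasDerivAt (f := fun t =>
      ζ (snoc u t) fun i => snoc (v i) 0) (fun t _ => ?_) ((hDc _ _).intervalIntegrable _ _)
    have h := ((hζd (snoc u t)).hasFDerivAt.comp_hasDerivAt t (hasDerivAt_snoc t u))
    exact (ContinuousAlternatingMap.apply ℝ (Eu (n + 1)) V _).hasFDerivAt.comp_hasDerivAt t h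
  · exact (hDc _ _).intervalIntegrable _ _
  · refine (continuous_finsetSum _ fun i _ => ?_).intervalIntegrable _ _
    exact (hDc _ _).const_smul ((-1 : ℝ) ^ (i : ℕ))

theorem pullback_prodMk_on {j : ℕ} (c : DForm (M × ℝ) j V) (t : ℝ) {n : ℕ} (p : Eu n → M)
    (hp : IsPlot p) (u : Eu n) (v : Fin j → Eu n) :
    (c.pullback _ (dSmooth_prodMk_right t)).on p hp u v =
      c.on (cylR p) (isPlot_cylR hp) (snoc u t) fun i => snoc (v i) 0 := by
  have h1 : (fun x : M => (x, t)) ∘ p = cylR p ∘ fun u => snoc u t := by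
    funext w
    simp [cylR]
  rw [DForm.pullback_on,
    c.on_eq_of_eq _ (isPlot_reparam (isPlot_cylR hp) (contDiff_snoc t)) h1,
    c.on_comp (isPlot_cylR hp) (contDiff_snoc t), (hasFDerivAt_snoc t u).fderiv]
  rfl

/-- The homotopy formula. -/
theorem d_integrate_add {j : ℕ} (a b : ℝ) (c : DForm (M × ℝ) (j + 1) V) :
    d M j V (c.integrate a b) + (d (M × ℝ) (j + 1) V c).integrate a b =
      c.pullback _ (dSmooth_prodMk_right b) - c.pullback _ (dSmooth_prodMk_right a) := by
  refine DForm.ext' fun n p hp u => ?_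
  ext v
  rw [DForm.on_add, DForm.on_sub, ContinuousAlternatingMap.add_apply,
    ContinuousAlternatingMap.sub_apply, pullback_prodMk_on, pullback_prodMk_on,
    DForm.integrate_on]
  exact extDeriv_integral_contractLast_add (c.contDiff_on (isPlot_cylR hp)) a b u v

/-! ### The fibre integral over the circle -/

theorem dSmooth_coe_circ : DSmooth fun x : M × ℝ => (x.1, (x.2 : Circ)) :=
  fun _ _ hp => ⟨hp.1, fun _ => ⟨_, hp.2, Filter.EventuallyEq.rfl⟩⟩

/-- The fibre integral has `∂_θ` in the last slot and `DForm.integrate` has it in the first; the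
sign comes from moving it past `j` vectors. -/
theorem isFibreIntegral_iff {j : ℕ} (c : DForm (M × Circ) (j + 1) ℝ) (η : DForm M j ℝ) :
    IsFibreIntegral c η ↔
      η = (-1 : ℝ) ^ j • (c.pullback _ dSmooth_coe_circ).integrate 0 (2 * Real.pi) := by
  have key : ∀ (n : ℕ) (p : Eu n → M) (hp : IsPlot p) (u : Eu n) (v : Fin j → Eu n),
      ((-1 : ℝ) ^ j • (c.pullback _ dSmooth_coe_circ).integrate 0 (2 * Real.pi)).on p hp u v =
        ∫ t in (0 : ℝ)..(2 * Real.pi), c.on (cylinder p) (isPlot_cylinder hp) (snoc u t)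
          (Fin.snoc (α := fun _ => Eu (n + 1)) (fun i => snoc (v i) 0) (snoc 0 1)) := by
    intro n p hp u v
    rw [DForm.on_smul, ContinuousAlternatingMap.smul_apply, DForm.integrate_on,
      ← intervalIntegral.integral_smul]
    congr 1
    funext t
    rw [← Fin.insertNth_last', ContinuousAlternatingMap.map_insertNth]
    simp
    rfl
  constructor
  · intro h
    refine DForm.ext' fun n p hp u => ?_
    ext v
    rw [key]
    exact h n p hp u v
  · rintro rfl n p hp u v
    exact key n p hp u v

/-- For closed `c` the homotopy formula expresses `dη`, up to sign, as the difference of the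
restrictions of `c` at `2π` and `0`, which are the same point of the circle. -/
theorem d_eq_zero_of_isFibreIntegral {j : ℕ} {c : DForm (M × Circ) (j + 1) ℝ} {η : DForm M j ℝ}
    (h : IsFibreIntegral c η) (hc : d (M × Circ) (j + 1) ℝ c = 0) : d M j ℝ η = 0 := by
  rw [(isFibreIntegral_iff c η).1 h, map_smul]
  have h1 := d_integrate_add 0 (2 * Real.pi) (c.pullback _ (dSmooth_coe_circ (M := M)))
  have h2 : (d (M × ℝ) (j + 1) ℝ (c.pullback _ dSmooth_coe_circ)).integrate 0 (2 * Real.pi) = 0 := by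
    rw [d_pullback, hc]
    refine DForm.ext' fun n p hp u => ?_
    ext v
    rw [DForm.integrate_on]
    simp [DForm.pullback_on]
  have hs : ∀ θ : Circ, DSmooth fun x : M => (x, θ) := fun θ _ _ hp => ⟨hp, isPlot_const⟩
  have h3 : (c.pullback _ (dSmooth_coe_circ (M := M))).pullback _
        (dSmooth_prodMk_right (2 * Real.pi)) =
      (c.pullback _ (dSmooth_coe_circ (M := M))).pullback _ (dSmooth_prodMk_right 0) := by
    refine DForm.pullback_congr (φ := fun x : M => (x, ((2 * Real.pi : ℝ) : Circ)))
      (φ' := fun x : M => (x, ((0 : ℝ) : Circ))) (hs _) (hs _) ?_ c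
    simp [Real.Angle.coe_two_pi]
  rw [h2, add_zero, h3, sub_self] at h1
  rw [h1, smul_zero]

end Integration

/-! ## The form `dθ` -/

theorem dTheta_congr {n : ℕ} {θ θ' : Eu n → Circ} {u : Eu n} (h : θ =ᶠ[𝓝 u] θ') :
    dTheta θ u = dTheta θ' u := by
  have h1 : (fun w => (θ w).sin) =ᶠ[𝓝 u] fun w => (θ' w).sin := h.fun_comp Real.Angle.sin
  have h2 : (fun w => (θ w).cos) =ᶠ[𝓝 u] fun w => (θ' w).cos := h.fun_comp Real.Angle.cos
  rw [dTheta, dTheta, h1.fderiv_eq, h2.fderiv_eq, h.self_of_nhds]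

theorem dTheta_coe {n : ℕ} {t : Eu n → ℝ} {u : Eu n} (ht : DifferentiableAt ℝ t u) :
    dTheta (fun w => (t w : Circ)) u = fderiv ℝ t u := by
  simp only [dTheta, Real.Angle.cos_coe, Real.Angle.sin_coe]
  rw [fderiv_sin ht, fderiv_cos ht, smul_smul, smul_smul, ← sub_smul]
  have : Real.cos (t u) * Real.cos (t u) - Real.sin (t u) * -Real.sin (t u) = 1 := by
    nlinarith [Real.sin_sq_add_cos_sq (t u)]
  rw [this, one_smul]

theorem exists_lift_circ {n : ℕ} {θ : Eu n → Circ} (hθ : IsPlot θ) (u : Eu n) :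
    ∃ t : Eu n → ℝ, ContDiff ℝ ∞ t ∧ θ =ᶠ[𝓝 u] fun w => (t w : Circ) := hθ u

theorem eventually_dTheta {n : ℕ} {θ : Eu n → Circ} {t : Eu n → ℝ} (ht : ContDiff ℝ ∞ t) {u : Eu n}
    (h : θ =ᶠ[𝓝 u] fun w => (t w : Circ)) : dTheta θ =ᶠ[𝓝 u] fderiv ℝ t := by
  filter_upwards [h.eventually_nhds] with w hw
  rw [dTheta_congr hw, dTheta_coe (ht.differentiable (by simp) w)]

theorem dTheta_comp {n m : ℕ} {θ : Eu n → Circ} (hθ : IsPlot θ) {ψ : Eu m → Eu n}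
    (hψ : ContDiff ℝ ∞ ψ) (u : Eu m) :
    dTheta (θ ∘ ψ) u = (dTheta θ (ψ u)).comp (fderiv ℝ ψ u) := by
  obtain ⟨t, ht, h⟩ := exists_lift_circ hθ (ψ u)
  have h1 : θ ∘ ψ =ᶠ[𝓝 u] fun w => ((t (ψ w) : ℝ) : Circ) := hψ.continuous.continuousAt.eventually h
  rw [(eventually_dTheta ht h).self_of_nhds, (eventually_dTheta (ht.comp hψ) h1).self_of_nhds]
  exact fderiv_comp u (ht.differentiable (by simp) _) (hψ.differentiable (by simp) _)

/-! ## Pairs of parameters -/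

/-- `ℝⁿ × ℝⁿ → ℝ²ⁿ`. -/
def pairL (n : ℕ) : Eu n × Eu n →L[ℝ] Eu (n + n) :=
  LinearMap.toContinuousLinearMap
    { toFun := fun x => WithLp.toLp 2 (Fin.append (α := ℝ) x.1 x.2)
      map_add' := fun x y => by
        ext i
        refine Fin.addCases (fun i => ?_) (fun i => ?_) i
        · simp
        · show Fin.append (α := ℝ) _ _ (Fin.natAdd n i) =
            Fin.append (α := ℝ) _ _ (Fin.natAdd n i) + Fin.append (α := ℝ) _ _ (Fin.natAdd n i)
          simp only [Fin.append_right]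
          rfl
      map_smul' := fun c x => by
        ext i
        refine Fin.addCases (fun i => ?_) (fun i => ?_) i
        · simp
        · show Fin.append (α := ℝ) _ _ (Fin.natAdd n i) =
            c * Fin.append (α := ℝ) _ _ (Fin.natAdd n i)
          simp only [Fin.append_right]
          rfl }

/-- The first half of the coordinates. -/
def firstL (n : ℕ) : Eu (n + n) →L[ℝ] Eu n :=
  LinearMap.toContinuousLinearMap
    { toFun := fun w => WithLp.toLp 2 fun i => w (Fin.castAdd n i)
      map_add' := fun _ _ => rfl
      map_smul' := fun _ _ => rfl }

/-- The second half of the coordinates. -/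
def secondL (n : ℕ) : Eu (n + n) →L[ℝ] Eu n :=
  LinearMap.toContinuousLinearMap
    { toFun := fun w => WithLp.toLp 2 fun i => w (Fin.natAdd n i)
      map_add' := fun _ _ => rfl
      map_smul' := fun _ _ => rfl }

@[simp] theorem firstL_pairL {n : ℕ} (x : Eu n × Eu n) : firstL n (pairL n x) = x.1 := by
  ext i
  exact Fin.append_left (α := ℝ) x.1 x.2 i

@[simp] theorem secondL_pairL {n : ℕ} (x : Eu n × Eu n) : secondL n (pairL n x) = x.2 := by
  ext i
  exact Fin.append_right (α := ℝ) x.1 x.2 i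

/-! ## The gauge action -/

section Gauge

variable {E : Type*} [NormedAddCommGroup E] [NormedSpace ℝ E]
  {G : Type*} [TopologicalSpace G] [ChartedSpace E G] [Group G] [LieGroup 𝓘(ℝ, E) ∞ G]
  {U : Type*} [NormedAddCommGroup U] [NormedSpace ℝ U]

theorem gauge_gauge {g h : U → G} {b : U → U →L[ℝ] E} {u : U}
    (hg : MDifferentiableAt 𝓘(ℝ, U) 𝓘(ℝ, E) g u) (hh : MDifferentiableAt 𝓘(ℝ, U) 𝓘(ℝ, E) h u) :
    gauge h (gauge g b) u = gauge (fun w => g w * h w) b u := by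
  simp only [gauge]
  rw [leftMC_mul hg hh, mul_inv_rev, Ad_mul, ContinuousLinearMap.comp_add, ← add_assoc]
  rfl

variable {U' : Type*} [NormedAddCommGroup U'] [NormedSpace ℝ U'] [FiniteDimensional ℝ E]

theorem ofSubsingleton_comp (L : U →L[ℝ] E) (D : U' →L[ℝ] U) :
    ContinuousAlternatingMap.ofSubsingleton ℝ U' E (0 : Fin 1) (L.comp D) =
      (ContinuousAlternatingMap.ofSubsingleton ℝ U E (0 : Fin 1) L).compContinuousLinearMap D := rfl

theorem contDiff_ofSubsingleton : ContDiff ℝ ∞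
    (fun L : U →L[ℝ] E => ContinuousAlternatingMap.ofSubsingleton ℝ U E (0 : Fin 1) L) :=
  (ContinuousAlternatingMap.ofSubsingletonLIE (𝕜 := ℝ) (E := U) (F := E)
    (0 : Fin 1)).toContinuousLinearEquiv.contDiff

theorem curvForm_comp {b : U → U →L[ℝ] E} {ψ : U' → U} {u : U'} (hb : DifferentiableAt ℝ b (ψ u))
    (hψ : ContDiff ℝ ∞ ψ) : curvForm G (fun w => (b (ψ w)).comp (fderiv ℝ ψ w)) u =
      (curvForm G b (ψ u)).compContinuousLinearMap (fderiv ℝ ψ u) := by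
  have h1 : DifferentiableAt ℝ
      (fun w => ContinuousAlternatingMap.ofSubsingleton ℝ U E (0 : Fin 1) (b w)) (ψ u) :=
    (contDiff_ofSubsingleton.differentiable (by simp) _).comp _ hb
  have h2 := extDeriv_pullback (r := ∞) h1 hψ.contDiffAt (by
    simpa using (WithTop.coe_le_coe.2 le_top : ((2:ℕ∞) : WithTop ℕ∞) ≤ ((⊤:ℕ∞): WithTop ℕ∞)))
  simp only [curvForm, ofSubsingleton_comp]
  rw [h2, formEval_compContinuousLinearMap]
  rfl

theorem cwForm_comp {k : ℕ} (f : InvPoly E G k) {b : U → U →L[ℝ] E} {ψ : U' → U} {u : U'}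
    (hb : DifferentiableAt ℝ b (ψ u)) (hψ : ContDiff ℝ ∞ ψ) :
    cwForm f (fun w => (b (ψ w)).comp (fderiv ℝ ψ w)) u =
      (cwForm f b (ψ u)).compContinuousLinearMap (fderiv ℝ ψ u) := by
  rw [cwForm, cwForm, curvForm_comp hb hψ, ← formEval_compContinuousLinearMap]

end Gauge

/-! ## The connection of the caloron transform -/

section CaloronForm

variable {E : Type*} [NormedAddCommGroup E] [NormedSpace ℝ E]
  {G : Type*} [TopologicalSpace G] [ChartedSpace E G] [Group G] [LieGroup 𝓘(ℝ, E) ∞ G]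
  {P : OmegaSpace E G} {A : PreConnection P} {Φ : P.Total → Circ → E}

theorem isPlot_loop_iff {n : ℕ} {γ : Eu n → LoopGroup E G} : IsPlot γ ↔
    ContMDiff 𝓘(ℝ, Eu n × ℝ) 𝓘(ℝ, E) ∞ fun x : Eu n × ℝ => (γ x.1).1 (x.2 : Circ) := Iff.rfl

theorem contMDiff_loop_eval {n : ℕ} {γ : Eu n → LoopGroup E G} (hγ : IsPlot γ) {θ : Eu n → Circ}
    (hθ : IsPlot θ) : ContMDiff 𝓘(ℝ, Eu n) 𝓘(ℝ, E) ∞ fun w => (γ w).1 (θ w) := by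
  intro u
  obtain ⟨t, ht, h⟩ := exists_lift_circ hθ u
  have h1 : ContMDiff 𝓘(ℝ, Eu n) 𝓘(ℝ, E) ∞ fun w => (γ w).1 (t w : Circ) :=
    ContMDiff.comp (I' := 𝓘(ℝ, Eu n × ℝ)) (isPlot_loop_iff.1 hγ)
      (contDiff_id.prodMk ht).contMDiff
  refine (h1 u).congr_of_eventuallyEq ?_
  filter_upwards [h] with w hw
  rw [hw]

/-- The Maurer-Cartan form along `w ↦ Q(φ(w), t(w))`. -/
theorem leftMC_prodMk {X U : Type*} [NormedAddCommGroup X] [NormedSpace ℝ X] [NormedAddCommGroup U]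
    [NormedSpace ℝ U] {Q : X × ℝ → G} {φ : U → X} {t : U → ℝ} {u : U}
    (hQ : MDifferentiableAt 𝓘(ℝ, X × ℝ) 𝓘(ℝ, E) Q (φ u, t u)) (hφ : DifferentiableAt ℝ φ u)
    (ht : DifferentiableAt ℝ t u) :
    leftMC (E := E) (fun w => Q (φ w, t w)) u = leftMC (fun w => Q (φ w, t u)) u +
      (fderiv ℝ t u).smulRight (logDeriv (fun s : ℝ => Q (φ u, s)) (t u)) := by
  have e1 := hφ.hasFDerivAt.prodMk ht.hasFDerivAt
  have e2 := hφ.hasFDerivAt.prodMk (hasFDerivAt_const (𝕜 := ℝ) (t u) u)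
  have e3 := hasFDerivAt_prodMk_right (𝕜 := ℝ) (φ u) (t u)
  have h2 := leftMC_comp (E := E) (φ := Q) (ψ := fun w => (φ w, t w)) (u := u) hQ
    e1.differentiableAt
  have h3 := leftMC_comp (E := E) (φ := Q) (ψ := fun w => (φ w, t u)) (u := u) hQ
    e2.differentiableAt
  have h4 := leftMC_comp (E := E) (φ := Q) (ψ := fun s => (φ u, s)) (u := t u) hQ
    e3.differentiableAt
  rw [e1.fderiv] at h2
  rw [e2.fderiv] at h3
  rw [e3.fderiv] at h4
  rw [logDeriv, h4, h2, h3]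
  ext v
  have e : ((fderiv ℝ φ u v, fderiv ℝ t u v) : X × ℝ) =
      (fderiv ℝ φ u v, 0) + fderiv ℝ t u v • ((0 : X), (1 : ℝ)) := by
    simp
  simp only [ContinuousLinearMap.comp_apply, ContinuousLinearMap.prod_apply,
    add_apply, ContinuousLinearMap.smulRight_apply, ContinuousLinearMap.inr_apply]
  rw [e, map_add, map_smul]
  rfl

/-- Partial derivatives in the parameter and in the angle. The second one is the term `γ⁻¹∂γ dθ`
that the Higgs field has to reproduce. -/
theorem leftMC_loop_eval {n : ℕ} {γ : Eu n → LoopGroup E G} (hγ : IsPlot γ) {θ : Eu n → Circ}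
    {t : Eu n → ℝ} (ht : ContDiff ℝ ∞ t) {u : Eu n} (h : θ =ᶠ[𝓝 u] fun w => (t w : Circ)) :
    leftMC (E := E) (fun w => (γ w).1 (θ w)) u = leftMC (fun w => (γ w).1 (θ u)) u +
      (dTheta θ u).smulRight (logDeriv (fun s : ℝ => (γ u).1 (s : Circ)) (t u)) := by
  have h1 : leftMC (E := E) (fun w => (γ w).1 (θ w)) u =
      leftMC (fun w => (γ w).1 (t w : Circ)) u := leftMC_congr (by
    filter_upwards [h] with w hw
    rw [hw])
  rw [h1, (eventually_dTheta ht h).self_of_nhds, h.self_of_nhds]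
  exact leftMC_prodMk (Q := fun x : Eu n × ℝ => (γ x.1).1 (x.2 : Circ)) (φ := fun w => w)
    ((isPlot_loop_iff.1 hγ).mdifferentiable (by simp) _) differentiableAt_fun_id
    (ht.differentiable (by simp) u)

/-- The axioms cover a fixed loop acting on a varying point and a varying loop acting on a fixed
point. The plot `(w, w') ↦ p(w) γ(w')` contains both as its partial maps, and the derivative of the
diagonal adds their contributions. -/
theorem IsConnection.act (hA : IsConnection P A) {n : ℕ} {p : Eu n → P.Total} (hp : IsPlot p)
    {γ : Eu n → LoopGroup E G} (hγ : IsPlot γ) (u : Eu n) (θ : Circ) :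
    A n (fun w => P.act (p w) (γ w)) u θ =
      (Ad ((γ u).1 θ)⁻¹).comp (A n p u θ) + leftMC (fun w => (γ w).1 θ) u := by
  let Q : Eu (n + n) → P.Total := fun w => P.act (p (firstL n w)) (γ (secondL n w))
  have hQ : IsPlot Q := IsPlot.dSmooth_comp (f := fun x : P.Total × LoopGroup E G => P.act x.1 x.2)
    (p := fun w => (p (firstL n w), γ (secondL n w)))
    ⟨isPlot_reparam hp (firstL n).contDiff, isPlot_reparam hγ (secondL n).contDiff⟩ P.act_smooth
  have e1 := (pairL n).hasFDerivAt.comp u ((hasFDerivAt_id u).prodMk (hasFDerivAt_id u))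
  have e2 := (pairL n).hasFDerivAt.comp u (hasFDerivAt_prodMk_left (𝕜 := ℝ) u u)
  have e3 := (pairL n).hasFDerivAt.comp u (hasFDerivAt_prodMk_right (𝕜 := ℝ) u u)
  have h1 := hA.natural _ _ Q hQ (pairL n ∘ fun w => (w, w))
    ((pairL n).contDiff.comp (contDiff_id.prodMk contDiff_id)) u θ
  have h2 := hA.natural _ _ Q hQ (pairL n ∘ fun w => (w, u))
    ((pairL n).contDiff.comp (contDiff_id.prodMk contDiff_const)) u θ
  have h3 := hA.natural _ _ Q hQ (pairL n ∘ fun w => (u, w))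
    ((pairL n).contDiff.comp (contDiff_const.prodMk contDiff_id)) u θ
  have g1 : Q ∘ (pairL n ∘ fun w => (w, w)) = fun w => P.act (p w) (γ w) := by
    funext w
    simp [Q]
  have g2 : Q ∘ (pairL n ∘ fun w => (w, u)) = fun w => P.act (p w) (γ u) := by
    funext w
    simp [Q]
  have g3 : Q ∘ (pairL n ∘ fun w => (u, w)) = fun w => P.act (p u) (γ w) := by
    funext w
    simp [Q]
  rw [g1, show fderiv ℝ (pairL n ∘ fun w => (w, w)) u = _ from e1.fderiv] at h1
  rw [g2, e2.fderiv, hA.equivariant n p hp] at h2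
  rw [g3, e3.fderiv, hA.vertical n (p u) γ hγ] at h3
  rw [h1, h2, h3]
  ext v
  simp only [ContinuousLinearMap.comp_apply, ContinuousLinearMap.prod_apply,
    add_apply, Function.comp_apply,
    ContinuousLinearMap.inl_apply, ContinuousLinearMap.inr_apply, ContinuousLinearMap.id_apply]
  rw [← map_add, ← map_add]
  simp

/-- The pull-back of `A(θ) + Φ dθ` along the plot `(p, θ)` of `P × S¹`. -/
def caloronForm (A : PreConnection P) (Φ : P.Total → Circ → E) {n : ℕ} (p : Eu n → P.Total)
    (θ : Eu n → Circ) (u : Eu n) : Eu n →L[ℝ] E :=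
  A n p u (θ u) + (dTheta θ u).smulRight (Φ (p u) (θ u))

theorem contDiff_caloronForm (hA : IsConnection P A) (hΦ : IsHiggs P Φ) {n : ℕ}
    {p : Eu n → P.Total} (hp : IsPlot p) {θ : Eu n → Circ} (hθ : IsPlot θ) :
    ContDiff ℝ ∞ (caloronForm A Φ p θ) := by
  refine contDiff_iff_contDiffAt.2 fun u => ?_
  obtain ⟨t, ht, h⟩ := exists_lift_circ hθ u
  have hs : ContDiff ℝ ∞ fun w : Eu n => (w, t w) := contDiff_id.prodMk ht
  have h1 : ContDiff ℝ ∞ fun w => A n p w (t w : Circ) +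
      (fderiv ℝ t w).smulRight (Φ (p w) (t w : Circ)) :=
    ((hA.smooth n p hp).comp hs).add
      ((ht.fderiv_right (m := ∞) (by simp)).smulRight ((hΦ.smooth n p hp).comp hs))
  refine h1.contDiffAt.congr_of_eventuallyEq ?_
  filter_upwards [h, eventually_dTheta ht h] with w hw hw'
  rw [caloronForm, hw, hw']

theorem caloronForm_comp (hA : IsConnection P A) {n m : ℕ} {p : Eu n → P.Total} (hp : IsPlot p)
    {θ : Eu n → Circ} (hθ : IsPlot θ) {ψ : Eu m → Eu n} (hψ : ContDiff ℝ ∞ ψ) (u : Eu m) :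
    caloronForm A Φ (p ∘ ψ) (θ ∘ ψ) u = (caloronForm A Φ p θ (ψ u)).comp (fderiv ℝ ψ u) := by
  rw [caloronForm, caloronForm, hA.natural n m p hp ψ hψ, dTheta_comp hθ hψ]
  rfl

/-- The `M`-directions are handled by `IsConnection.act`. In the `θ`-direction the inhomogeneous
term of the Higgs field completes the Maurer-Cartan form of `γ(θ)`. -/
theorem caloronForm_act (hA : IsConnection P A) (hΦ : IsHiggs P Φ) {n : ℕ} {p : Eu n → P.Total}
    (hp : IsPlot p) {θ : Eu n → Circ} (hθ : IsPlot θ) {γ : Eu n → LoopGroup E G} (hγ : IsPlot γ) :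
    caloronForm A Φ (fun w => P.act (p w) (γ w)) θ =
      gauge (fun w => (γ w).1 (θ w)) (caloronForm A Φ p θ) := by
  funext u
  obtain ⟨t, ht, h⟩ := exists_lift_circ hθ u
  rw [caloronForm, gauge, caloronForm, leftMC_loop_eval hγ ht h, hA.act hp hγ, h.self_of_nhds,
    hΦ.equivariant]
  ext v
  simp only [ContinuousLinearMap.comp_apply, add_apply, ContinuousLinearMap.smulRight_apply,
    map_add, map_smul, smul_add]
  abel

variable [FiniteDimensional ℝ E]

/-- `P × G × S¹`. -/
def Triple (P : OmegaSpace E G) : Type _ := P.Total × G × Circ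

instance (P : OmegaSpace E G) : DiffeologicalSpace (Triple P) := tripleDiffeology P

/-- The projection `P × G × S¹ → 𝒞(P)`. -/
def Triple.toCaloron (x : Triple P) : Caloron P := Quot.mk (caloronRel P) x

theorem Triple.dSmooth_toCaloron : DSmooth (Triple.toCaloron (P := P)) :=
  fun _ p hp _ => ⟨p, hp, Filter.EventuallyEq.rfl⟩

theorem Triple.hasLocalLifts_toCaloron : HasLocalLifts (Triple.toCaloron (P := P)) := by
  intro n x hx u
  obtain ⟨r, hr, h⟩ := hx u
  exact ⟨r, hr, h.symm⟩

theorem caloronRel_equivalence (P : OmegaSpace E G) : Equivalence (caloronRel P) where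
  refl x := ⟨1, by simp [P.act_one]⟩
  symm := by
    rintro x y ⟨γ, rfl⟩
    refine ⟨γ⁻¹, ?_⟩
    simp [P.act_mul, P.act_one]
  trans := by
    rintro x y z ⟨γ, rfl⟩ ⟨δ, rfl⟩
    refine ⟨γ * δ, ?_⟩
    simp [P.act_mul, mul_assoc]

theorem OmegaSpace.IsBundle.act_injective (hP : P.IsBundle) {p : P.Total} {γ δ : LoopGroup E G}
    (h : P.act p γ = P.act p δ) : γ = δ := by
  have h1 := hP.free p (γ * δ⁻¹) (by rw [← P.act_mul, h, P.act_mul, mul_inv_cancel, P.act_one])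
  exact mul_inv_eq_one.1 h1

/-- Plots of `P × G × S¹` with the same image in `𝒞(P)` differ by a plot of `ΩG`. -/
theorem exists_loop_of_toCaloron_eq (hP : P.IsBundle) {n : ℕ} {r r' : Eu n → Triple P}
    (hr : IsPlot r) (hr' : IsPlot r') (h : Triple.toCaloron ∘ r = Triple.toCaloron ∘ r') :
    ∃ γ : Eu n → LoopGroup E G, IsPlot γ ∧ ∀ u,
      r' u = (P.act (r u).1 (γ u), ((γ u).1 (r u).2.2)⁻¹ * (r u).2.1, (r u).2.2) := by
  have h1 : ∀ u, caloronRel P (r u) (r' u) := fun u =>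
    (caloronRel_equivalence P).eqvGen_iff.1 (Quot.eqvGen_exact (congrFun h u))
  obtain ⟨γ, hγ, h2⟩ := hP.transitive n (fun u => (r u).1) (fun u => (r' u).1) hr.1 hr'.1
    (fun u => by
      obtain ⟨δ, hδ⟩ := h1 u
      rw [hδ]
      exact (P.proj_act _ _).symm)
  refine ⟨γ, hγ, fun u => ?_⟩
  obtain ⟨δ, hδ⟩ := h1 u
  have h3 : γ u = δ := hP.act_injective ((h2 u).symm.trans (congrArg Prod.fst hδ))
  rw [h3, hδ]

/-- On `P × G × S¹` the form is the gauge transform of `caloronForm` by `g`. Moving along an orbit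
transforms `caloronForm` by `γ(θ)` and replaces `g` by `γ(θ)⁻¹ g`, so the composite gauge
transformation does not change. -/
theorem exists_isCaloronConnection (hP : P.IsBundle) (hA : IsConnection P A) (hΦ : IsHiggs P Φ) :
    ∃ B, IsCaloronConnection P A Φ B := by
  let b : ∀ (n : ℕ) (r : Eu n → Triple P) (u : Eu n), Eu n →L[ℝ] E := fun n r =>
    gauge (fun u => (r u).2.1) (caloronForm A Φ (fun u => (r u).1) fun u => (r u).2.2)
  have hcalo : ∀ (n : ℕ) (r : Eu n → Triple P), IsPlot r → ContDiff ℝ ∞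
      (caloronForm A Φ (fun u => (r u).1) fun u => (r u).2.2) := fun n r hr =>
    contDiff_caloronForm hA hΦ hr.1 hr.2.2
  have hg : ∀ (n : ℕ) (r : Eu n → Triple P), IsPlot r →
      ContMDiff 𝓘(ℝ, Eu n) 𝓘(ℝ, E) ∞ fun u => (r u).2.1 := fun n r hr => hr.2.1
  obtain ⟨B, hB⟩ := DForm.exists_descend (V := E) Triple.dSmooth_toCaloron
    (Triple.hasLocalLifts_toCaloron (P := P))
    (DForm.mk (fun n r _ u => ContinuousAlternatingMap.ofSubsingleton ℝ (Eu n) E (0 : Fin 1)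
      (b n r u))
    (fun n r hr => contDiff_ofSubsingleton.comp (contDiff_iff_contDiffAt.2 fun u =>
      contDiffAt_gauge (hg n r hr u) (hcalo n r hr).contDiffAt))
    (fun n m r hr ψ hψ u => by
      rw [← ofSubsingleton_comp]
      congr 1
      have h1 := caloronForm_comp (Φ := Φ) hA hr.1 hr.2.2 hψ u
      have h2 := leftMC_comp (E := E) (φ := fun u => (r u).2.1) (ψ := ψ) (u := u)
        ((hg n r hr).mdifferentiable (by simp) _) (hψ.differentiable (by simp) _)
      show (Ad _).comp (caloronForm A Φ ((fun u => (r u).1) ∘ ψ) ((fun u => (r u).2.2) ∘ ψ) u) +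
        leftMC (fun w => (r (ψ w)).2.1) u =
          (gauge (fun u => (r u).2.1) (caloronForm A Φ (fun u => (r u).1) fun u => (r u).2.2)
            (ψ u)).comp (fderiv ℝ ψ u)
      rw [h1, h2]
      rfl))
    (fun n r r' hr hr' h u => by
      obtain ⟨γ, hγ, hrr⟩ := exists_loop_of_toCaloron_eq hP hr hr' h
      have e1 : (fun u => (r' u).1) = fun u => P.act (r u).1 (γ u) :=
        funext fun u => by rw [hrr]
      have e2 : (fun u => (r' u).2.1) = fun u => ((γ u).1 (r u).2.2)⁻¹ * (r u).2.1 :=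
        funext fun u => by rw [hrr]
      have e3 : (fun u => (r' u).2.2) = fun u => (r u).2.2 :=
        funext fun u => by rw [hrr]
      have hγθ := contMDiff_loop_eval hγ hr.2.2
      show ContinuousAlternatingMap.ofSubsingleton ℝ (Eu n) E (0 : Fin 1)
        (gauge (fun u => (r u).2.1) (caloronForm A Φ (fun u => (r u).1) fun u => (r u).2.2) u) =
        ContinuousAlternatingMap.ofSubsingleton ℝ (Eu n) E (0 : Fin 1)
        (gauge (fun u => (r' u).2.1) (caloronForm A Φ (fun u => (r' u).1) fun u => (r' u).2.2) u)
      congr 1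
      rw [e1, e2, e3, caloronForm_act hA hΦ hr.1 hr.2.2 hγ, gauge_gauge]
      · simp
      · exact hγθ.mdifferentiable (by simp) _
      · exact ((hγθ.inv.mul (hg n r hr)).mdifferentiable (by simp) _))
  refine ⟨B, fun n p g θ hp hg hθ u v => ?_⟩
  refine (congrArg (fun ζ : Eu n [⋀^Fin 1]→L[ℝ] E => ζ fun _ => v)
    (hB n (fun w => (p w, g w, θ w)) ⟨hp, hg, hθ⟩ u)).trans ?_
  show (Ad _) (A n p u (θ u) v + dTheta θ u v • Φ (p u) (θ u)) + leftMC g u v = _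
  rw [map_add, map_smul]
  abel

end CaloronForm

/-! ## The Chern-Weil form of the caloron transform -/

section ChernWeil

variable {E : Type*} [NormedAddCommGroup E] [NormedSpace ℝ E] [FiniteDimensional ℝ E]
  {G : Type*} [TopologicalSpace G] [ChartedSpace E G] [Group G] [LieGroup 𝓘(ℝ, E) ∞ G]
  {P : OmegaSpace E G} {A : PreConnection P} {Φ : P.Total → Circ → E} {k : ℕ}

/-- The map `P × S¹ → M × S¹`. -/
def OmegaSpace.projCirc (P : OmegaSpace E G) (x : P.Total × Circ) : P.Base × Circ :=
  (P.proj x.1, x.2)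

theorem OmegaSpace.dSmooth_projCirc (P : OmegaSpace E G) : DSmooth P.projCirc :=
  fun _ _ hp => ⟨hp.1.dSmooth_comp P.proj_smooth, hp.2⟩

theorem OmegaSpace.IsBundle.hasLocalLifts (hP : P.IsBundle) : HasLocalLifts P.projCirc := by
  intro n x hx u
  obtain ⟨p, hp, h⟩ := hP.local_lift n (fun w => (x w).1) hx.1 u
  refine ⟨fun w => (p w, (x w).2), ⟨hp, hx.2⟩, ?_⟩
  filter_upwards [h] with w hw
  exact Prod.ext hw rfl

/-- `c` is the form `f(F, …, F)` with `F` the curvature of `A(θ) + Φ dθ`. -/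
def IsLocalChernWeilForm (A : PreConnection P) (Φ : P.Total → Circ → E) (f : InvPoly E G k)
    (c : DForm (P.Base × Circ) (2 * k) ℝ) : Prop :=
  ∀ (n : ℕ) (r : Eu n → P.Total × Circ) (hr : IsPlot r) (u : Eu n),
    c.on (P.projCirc ∘ r) (hr.dSmooth_comp P.dSmooth_projCirc) u =
      cwForm f (caloronForm A Φ (fun w => (r w).1) fun w => (r w).2) u

/-- Two plots of `P × S¹` over the same plot of `M × S¹` differ by a plot of loops, that is, by a
gauge transformation. -/
theorem exists_isLocalChernWeilForm (hP : P.IsBundle) (hA : IsConnection P A) (hΦ : IsHiggs P Φ)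
    (f : InvPoly E G k) : ∃ c, IsLocalChernWeilForm A Φ f c := by
  have hb : ∀ (n : ℕ) (r : Eu n → P.Total × Circ), IsPlot r → ContDiff ℝ ∞
      (caloronForm A Φ (fun w => (r w).1) fun w => (r w).2) := fun n r hr =>
    contDiff_caloronForm hA hΦ hr.1 hr.2
  refine DForm.exists_descend P.dSmooth_projCirc hP.hasLocalLifts
    (DForm.mk (fun n r _ => cwForm f (caloronForm A Φ (fun w => (r w).1) fun w => (r w).2))
      (fun n r hr => contDiff_iff_contDiffAt.2 fun u => contDiffAt_cwForm f (hb n r hr).contDiffAt)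
      (fun n m r hr ψ hψ u => ?_)) (fun n r r' hr hr' h u => ?_)
  · rw [← cwForm_comp f ((hb n r hr).differentiable (by simp) _) hψ]
    exact congrArg (fun b => cwForm f b u)
      (funext fun w => caloronForm_comp (Φ := Φ) hA hr.1 hr.2 hψ w)
  · obtain ⟨γ, hγ, h1⟩ := hP.transitive n (fun w => (r w).1) (fun w => (r' w).1) hr.1 hr'.1
      fun w => congrArg Prod.fst (congrFun h w)
    have h2 : (fun w => (r' w).2) = fun w => (r w).2 :=
      funext fun w => (congrArg Prod.snd (congrFun h w)).symm
    have h3 : (fun w => (r' w).1) = fun w => P.act (r w).1 (γ w) := funext h1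
    show cwForm f (caloronForm A Φ (fun w => (r w).1) fun w => (r w).2) u =
      cwForm f (caloronForm A Φ (fun w => (r' w).1) fun w => (r' w).2) u
    rw [h2, h3, caloronForm_act hA hΦ hr.1 hr.2 hγ,
      cwForm_gauge f (contMDiff_loop_eval hγ hr.2 u) ((hb n r hr).differentiable (by simp) _)]

theorem IsLocalChernWeilForm.unique (hP : P.IsBundle) {f : InvPoly E G k}
    {c c' : DForm (P.Base × Circ) (2 * k) ℝ} (h : IsLocalChernWeilForm A Φ f c)
    (h' : IsLocalChernWeilForm A Φ f c') : c = c' :=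
  DForm.eq_of_lifts P.dSmooth_projCirc hP.hasLocalLifts fun n r hr u =>
    (h n r hr u).trans (h' n r hr u).symm

theorem IsLocalChernWeilForm.closed (hP : P.IsBundle) (hA : IsConnection P A) (hΦ : IsHiggs P Φ)
    {f : InvPoly E G k} {c : DForm (P.Base × Circ) (2 * k) ℝ}
    (h : IsLocalChernWeilForm A Φ f c) : d (P.Base × Circ) (2 * k) ℝ c = 0 := by
  refine DForm.eq_of_lifts P.dSmooth_projCirc hP.hasLocalLifts fun n r hr u => ?_
  rw [d_on, DForm.on_zero, show c.on (P.projCirc ∘ r) _ = _ from funext (h n r hr)]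
  exact extDeriv_cwForm f (contDiff_caloronForm hA hΦ hr.1 hr.2).contDiffAt

theorem IsCaloronConnection.on_mk {B : DForm (Caloron P) 1 E} (hB : IsCaloronConnection P A Φ B)
    {n : ℕ} {r : Eu n → Triple P} (hr : IsPlot r) :
    B.on (Triple.toCaloron ∘ r) (hr.dSmooth_comp Triple.dSmooth_toCaloron) =
      fun u => ContinuousAlternatingMap.ofSubsingleton ℝ (Eu n) E (0 : Fin 1)
        (gauge (fun w => (r w).2.1)
          (caloronForm A Φ (fun w => (r w).1) fun w => (r w).2.2) u) := by
  funext u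
  ext v
  have hv : v = fun _ => v 0 := funext fun i => congrArg v (Subsingleton.elim i 0)
  rw [hv]
  refine (hB n (fun w => (r w).1) (fun w => (r w).2.1) (fun w => (r w).2.2) hr.1 hr.2.1 hr.2.2
    u (v 0)).trans ?_
  show _ = Ad (E := E) ((r u).2.1)⁻¹ (A n (fun w => (r w).1) u ((r u).2.2) (v 0) +
      dTheta (fun w => (r w).2.2) u (v 0) • Φ (r u).1 (r u).2.2) +
    leftMC (fun w => (r w).2.1) u (v 0)
  rw [map_add, map_smul]
  abel

theorem curvature_congr {X : Type*} [DiffeologicalSpace X] (B : DForm X 1 E) {n : ℕ}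
    {p p' : Eu n → X} (hp : IsPlot p) (hp' : IsPlot p') {u : Eu n} (h : p =ᶠ[𝓝 u] p') :
    curvature (G := G) B p hp u = curvature (G := G) B p' hp' u := by
  rw [curvature, curvature, (d X 1 E B).on_congr hp hp' h, B.on_congr hp hp' h]

theorem IsCaloronConnection.formEval_curvature_on_mk {B : DForm (Caloron P) 1 E}
    (hB : IsCaloronConnection P A Φ B) (hA : IsConnection P A) (hΦ : IsHiggs P Φ)
    (f : InvPoly E G k) {n : ℕ} {r : Eu n → Triple P} (hr : IsPlot r) (u : Eu n) :
    formEval (q := fun _ => 2) f.toFun (fun _ => curvature (G := G) B (Triple.toCaloron ∘ r)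
        (hr.dSmooth_comp Triple.dSmooth_toCaloron) u) (by simp [mul_comm] : _ = 2 * k) =
      cwForm f (caloronForm A Φ (fun w => (r w).1) fun w => (r w).2.2) u := by
  have hg : ContMDiff 𝓘(ℝ, Eu n) 𝓘(ℝ, E) ∞ fun w => (r w).2.1 := hr.2.1
  rw [← cwForm_gauge f (hg u)
    ((contDiff_caloronForm hA hΦ hr.1 hr.2.2).differentiable (by simp) _), cwForm]
  congr 1
  funext _
  rw [curvature, curvForm, d_on, hB.on_mk hr]

/-- A plot of `P × S¹` becomes a plot of `𝒞(P)` by taking `g = 1`. Conversely, every plot of `𝒞(P)`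
lifts locally to `P × G × S¹`, where the `G`-coordinate acts only as a gauge transformation. This
description of `c` does not mention `B`. -/
theorem isChernWeilForm_iff (hA : IsConnection P A) (hΦ : IsHiggs P Φ)
    {B : DForm (Caloron P) 1 E} (hB : IsCaloronConnection P A Φ B) (f : InvPoly E G k)
    (c : DForm (P.Base × Circ) (2 * k) ℝ) :
    IsChernWeilForm P B f c ↔ IsLocalChernWeilForm A Φ f c := by
  constructor
  · intro h n r hr u
    have hr' : IsPlot fun w => (show Triple P from ((r w).1, (1 : G), (r w).2)) :=
      ⟨hr.1, contMDiff_const, hr.2⟩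
    exact (h n _ (hr'.dSmooth_comp Triple.dSmooth_toCaloron) u).trans
      (hB.formEval_curvature_on_mk hA hΦ f hr' u)
  · intro h n p hp u
    obtain ⟨r, hr, hrp⟩ := Triple.hasLocalLifts_toCaloron n p hp u
    have h1 := h n (fun w => ((r w).1, (r w).2.2)) ⟨hr.1, hr.2.2⟩ u
    rw [← curvature_congr B (hr.dSmooth_comp Triple.dSmooth_toCaloron) hp hrp,
      hB.formEval_curvature_on_mk hA hΦ f hr u]
    refine Eq.trans (c.on_congr _ _ ?_) h1
    filter_upwards [hrp] with w hw
    rw [Function.comp_apply, ← hw]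
    rfl

theorem isStringForm_iff (hP : P.IsBundle) (hA : IsConnection P A) (hΦ : IsHiggs P Φ) {m : ℕ}
    (f : InvPoly E G (m + 1)) (η : DForm P.Base (2 * m + 1) ℝ) :
    IsStringForm P A Φ f η ↔ ∃ c : DForm (P.Base × Circ) (2 * (m + 1)) ℝ,
      IsLocalChernWeilForm A Φ f c ∧ IsFibreIntegral (j := 2 * m + 1) c η := by
  constructor
  · rintro ⟨B, c, hB, hc, hη⟩
    exact ⟨c, (isChernWeilForm_iff hA hΦ hB f c).1 hc, hη⟩
  · rintro ⟨c, hc, hη⟩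
    obtain ⟨B, hB⟩ := exists_isCaloronConnection hP hA hΦ
    exact ⟨B, c, hB, (isChernWeilForm_iff hA hΦ hB f c).2 hc, hη⟩

theorem exists_isStringForm (hP : P.IsBundle) (hA : IsConnection P A) (hΦ : IsHiggs P Φ) {m : ℕ}
    (f : InvPoly E G (m + 1)) : ∃ η, IsStringForm P A Φ f η := by
  obtain ⟨c, hc⟩ := exists_isLocalChernWeilForm hP hA hΦ f
  exact ⟨_, (isStringForm_iff hP hA hΦ f _).2
    ⟨c, hc, (isFibreIntegral_iff (j := 2 * m + 1) c _).2 rfl⟩⟩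

theorem IsStringForm.unique (hP : P.IsBundle) (hA : IsConnection P A) (hΦ : IsHiggs P Φ) {m : ℕ}
    {f : InvPoly E G (m + 1)} {η η' : DForm P.Base (2 * m + 1) ℝ} (h : IsStringForm P A Φ f η)
    (h' : IsStringForm P A Φ f η') : η = η' := by
  obtain ⟨c, hc, hη⟩ := (isStringForm_iff hP hA hΦ f _).1 h
  obtain ⟨c', hc', hη'⟩ := (isStringForm_iff hP hA hΦ f _).1 h'
  obtain rfl := hc.unique hP hc'
  exact ((isFibreIntegral_iff (j := 2 * m + 1) c η).1 hη).trans
    ((isFibreIntegral_iff (j := 2 * m + 1) c η').1 hη').symm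

theorem IsStringForm.closed (hP : P.IsBundle) (hA : IsConnection P A) (hΦ : IsHiggs P Φ) {m : ℕ}
    {f : InvPoly E G (m + 1)} {η : DForm P.Base (2 * m + 1) ℝ} (h : IsStringForm P A Φ f η) :
    d P.Base (2 * m + 1) ℝ η = 0 := by
  obtain ⟨c, hc, hη⟩ := (isStringForm_iff hP hA hΦ f _).1 h
  exact d_eq_zero_of_isFibreIntegral (j := 2 * m + 1) hη (hc.closed hP hA hΦ)

end ChernWeil

/-! ## Independence of the connection and the Higgs field -/

section Interpolation

variable {E : Type*} [NormedAddCommGroup E] [NormedSpace ℝ E]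
  {G : Type*} [TopologicalSpace G] [ChartedSpace E G] [Group G] [LieGroup 𝓘(ℝ, E) ∞ G]
  {P : OmegaSpace E G} {A₀ A₁ : PreConnection P} {Φ₀ Φ₁ : P.Total → Circ → E}

/-- `P × ℝ → M × ℝ`. -/
def OmegaSpace.prodReal (P : OmegaSpace E G) : OmegaSpace E G where
  Base := P.Base × ℝ
  Total := P.Total × ℝ
  proj x := (P.proj x.1, x.2)
  act x γ := (P.act x.1 γ, x.2)
  proj_smooth := show DSmooth fun x : P.Total × ℝ => (P.proj x.1, x.2) from
    fun _ _ hp => ⟨hp.1.dSmooth_comp P.proj_smooth, hp.2⟩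
  act_smooth := show DSmooth fun x : (P.Total × ℝ) × LoopGroup E G => (P.act x.1.1 x.2, x.1.2) from
    fun n p hp => ⟨IsPlot.dSmooth_comp (f := fun x : P.Total × LoopGroup E G => P.act x.1 x.2)
      (p := fun w => ((p w).1.1, (p w).2)) ⟨hp.1.1, hp.2⟩ P.act_smooth, hp.1.2⟩
  act_one p := by simp [P.act_one]
  act_mul p γ δ := by simp [P.act_mul]
  proj_act p γ := by simp [P.proj_act]

theorem OmegaSpace.IsBundle.prodReal (hP : P.IsBundle) : P.prodReal.IsBundle where
  free p γ h := hP.free p.1 γ (congrArg Prod.fst h)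
  transitive n p p' hp hp' h := by
    obtain ⟨γ, hγ, h1⟩ := hP.transitive n (fun w => (p w).1) (fun w => (p' w).1) hp.1 hp'.1
      fun w => congrArg Prod.fst (h w)
    exact ⟨γ, hγ, fun w => Prod.ext (h1 w) (congrArg Prod.snd (h w)).symm⟩
  local_lift n x hx u := by
    obtain ⟨p, hp, h⟩ := hP.local_lift n (fun w => (x w).1) hx.1 u
    refine ⟨fun w => (p w, (x w).2), ⟨hp, hx.2⟩, ?_⟩
    filter_upwards [h] with w hw
    exact Prod.ext hw rfl

/-- The connection `(1 - s) A₀ + s A₁` of `P × ℝ`. -/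
def interpolateConnection (A₀ A₁ : PreConnection P) : PreConnection P.prodReal :=
  fun n (p : _ → P.Total × ℝ) u θ => (1 - (p u).2) • A₀ n (fun w => (p w).1) u θ +
    (p u).2 • A₁ n (fun w => (p w).1) u θ

/-- The Higgs field `(1 - s) Φ₀ + s Φ₁` of `P × ℝ`. -/
def interpolateHiggs (Φ₀ Φ₁ : P.Total → Circ → E) : P.prodReal.Total → Circ → E :=
  fun (p : P.Total × ℝ) θ => (1 - p.2) • Φ₀ p.1 θ + p.2 • Φ₁ p.1 θ

/-- Connections form an affine space: the coefficients `1 - s` and `s` add up to one, which is what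
the vertical condition needs. They depend on the point of `P × ℝ`, but multiply values only and are
not differentiated. -/
theorem isConnection_interpolate (h₀ : IsConnection P A₀) (h₁ : IsConnection P A₁) :
    IsConnection P.prodReal (interpolateConnection A₀ A₁) where
  smooth n p hp := by
    have hs : ContDiff ℝ ∞ fun x : Eu n × ℝ => (p x.1).2 :=
      (show ContDiff ℝ ∞ fun w => (p w).2 from hp.2).comp contDiff_fst
    exact ((contDiff_const.sub hs).smul (h₀.smooth n _ hp.1)).add (hs.smul (h₁.smooth n _ hp.1))
  natural n m p hp ψ hψ u θ := by
    have e0 := h₀.natural n m _ hp.1 ψ hψ u θ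
    have e1 := h₁.natural n m _ hp.1 ψ hψ u θ
    show (1 - (p (ψ u)).2) • A₀ m ((fun w => (p w).1) ∘ ψ) u θ +
      (p (ψ u)).2 • A₁ m ((fun w => (p w).1) ∘ ψ) u θ = _
    rw [e0, e1]
    rfl
  based n p hp u := by
    simp [interpolateConnection, h₀.based n _ hp.1, h₁.based n _ hp.1]
  equivariant n p hp γ u θ := by
    have e0 := h₀.equivariant n _ hp.1 γ u θ
    have e1 := h₁.equivariant n _ hp.1 γ u θ
    show (1 - (p u).2) • A₀ n (fun w => P.act (p w).1 γ) u θ +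
      (p u).2 • A₁ n (fun w => P.act (p w).1 γ) u θ = (Ad (γ.1 θ)⁻¹).comp
        ((1 - (p u).2) • A₀ n (fun w => (p w).1) u θ + (p u).2 • A₁ n (fun w => (p w).1) u θ)
    rw [e0, e1, ContinuousLinearMap.comp_add,
      ContinuousLinearMap.comp_smul, ContinuousLinearMap.comp_smul]
  vertical n p γ hγ u θ := by
    show (1 - p.2) • A₀ n (fun w => P.act p.1 (γ w)) u θ +
      p.2 • A₁ n (fun w => P.act p.1 (γ w)) u θ = _
    rw [h₀.vertical n p.1 γ hγ, h₁.vertical n p.1 γ hγ, ← add_smul, sub_add_cancel, one_smul]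

theorem isHiggs_interpolate (h₀ : IsHiggs P Φ₀) (h₁ : IsHiggs P Φ₁) :
    IsHiggs P.prodReal (interpolateHiggs Φ₀ Φ₁) where
  smooth n p hp := by
    have hs : ContDiff ℝ ∞ fun x : Eu n × ℝ => (p x.1).2 :=
      (show ContDiff ℝ ∞ fun w => (p w).2 from hp.2).comp contDiff_fst
    exact ((contDiff_const.sub hs).smul (h₀.smooth n _ hp.1)).add (hs.smul (h₁.smooth n _ hp.1))
  equivariant p γ t := by
    show (1 - p.2) • Φ₀ (P.act p.1 γ) t + p.2 • Φ₁ (P.act p.1 γ) t =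
      Ad (γ.1 t)⁻¹ ((1 - p.2) • Φ₀ p.1 t + p.2 • Φ₁ p.1 t) + _
    rw [h₀.equivariant, h₁.equivariant, map_add, map_smul, map_smul]
    module

variable [FiniteDimensional ℝ E] {m : ℕ} {f : InvPoly E G (m + 1)}

/-- If `A` and `Φ` on `P × ℝ` restrict to `A'` and `Φ'` over `s`, so does the string form. -/
theorem isStringForm_pullback (hP : P.IsBundle) {A : PreConnection P.prodReal}
    {Φ : P.prodReal.Total → Circ → E} (hA : IsConnection P.prodReal A) (hΦ : IsHiggs P.prodReal Φ)
    {A' : PreConnection P} {Φ' : P.Total → Circ → E} (hA' : IsConnection P A') (hΦ' : IsHiggs P Φ')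
    (s : ℝ) (hAA : ∀ (n : ℕ) (p : Eu n → P.Total) u θ,
      A n (fun w => ((p w, s) : P.Total × ℝ)) u θ = A' n p u θ)
    (hΦΦ : ∀ p θ, Φ ((p, s) : P.Total × ℝ) θ = Φ' p θ) {η : DForm P.prodReal.Base (2 * m + 1) ℝ}
    (h : IsStringForm P.prodReal A Φ f η) :
    IsStringForm P A' Φ' f
      (DForm.pullback (Y := P.Base × ℝ) (fun x => (x, s)) (dSmooth_prodMk_right s) η) := by
  obtain ⟨c, hc, hη⟩ := (isStringForm_iff hP.prodReal hA hΦ f η).1 h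
  have hι : DSmooth fun x : P.Base × Circ => (((x.1, s), x.2) : (P.Base × ℝ) × Circ) :=
    fun _ _ hp => ⟨⟨hp.1, isPlot_const⟩, hp.2⟩
  refine (isStringForm_iff hP hA' hΦ' f _).2
    ⟨DForm.pullback (Y := (P.Base × ℝ) × Circ) _ hι c, fun n r hr u => ?_, fun n p hp u v => ?_⟩
  · have h1 := hc n (fun w => (((r w).1, s), (r w).2)) ⟨⟨hr.1, isPlot_const⟩, hr.2⟩ u
    refine h1.trans (congrArg (fun b => cwForm f b u) (funext fun w => ?_))
    show A n (fun w => (((r w).1, s) : P.Total × ℝ)) w (r w).2 +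
      (dTheta (fun w => (r w).2) w).smulRight (Φ (((r w).1, s) : P.Total × ℝ) (r w).2) = _
    rw [hAA, hΦΦ]
    rfl
  · exact hη n (fun w => ((p w, s) : P.Base × ℝ)) ⟨hp, isPlot_const⟩ u v

/-- The string form of the interpolated data on `M × ℝ` is closed and restricts to the two given
forms at `0` and `1`, so its integral over `[0, 1]` is a primitive of their difference. -/
theorem deRhamClass_eq_of_isStringForm (hP : P.IsBundle) (hA₀ : IsConnection P A₀)
    (hΦ₀ : IsHiggs P Φ₀) (hA₁ : IsConnection P A₁) (hΦ₁ : IsHiggs P Φ₁)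
    {η₀ η₁ : DForm P.Base (2 * m + 1) ℝ} (h₀ : IsStringForm P A₀ Φ₀ f η₀)
    (h₁ : IsStringForm P A₁ Φ₁ f η₁) :
    deRhamClass η₁ (h₁.closed hP hA₁ hΦ₁) = deRhamClass η₀ (h₀.closed hP hA₀ hΦ₀) := by
  have hA := isConnection_interpolate hA₀ hA₁
  have hΦ := isHiggs_interpolate hΦ₀ hΦ₁
  obtain ⟨η, hη⟩ := exists_isStringForm hP.prodReal hA hΦ f
  have hd := hη.closed hP.prodReal hA hΦ
  have e₀ := (isStringForm_pullback hP hA hΦ hA₀ hΦ₀ 0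
    (fun n p u θ => by simp [interpolateConnection]) (fun p θ => by simp [interpolateHiggs])
    hη).unique hP hA₀ hΦ₀ h₀
  have e₁ := (isStringForm_pullback hP hA hΦ hA₁ hΦ₁ 1
    (fun n p u θ => by simp [interpolateConnection]) (fun p θ => by simp [interpolateHiggs])
    hη).unique hP hA₁ hΦ₁ h₁
  have h := d_integrate_add (M := P.Base) (j := 2 * m) 0 1 η
  have h2 : (d (P.Base × ℝ) (2 * m + 1) ℝ η).integrate 0 1 = 0 := by
    rw [show d (P.Base × ℝ) (2 * m + 1) ℝ η = 0 from hd]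
    refine DForm.ext' fun n p hp u => ?_
    ext v
    rw [DForm.integrate_on]
    simp
  rw [h2, add_zero, e₀, e₁] at h
  exact (Submodule.Quotient.eq _).2 ⟨_, h⟩

/-- The class of a string form is the string class. -/
theorem isStringClass_of_isStringForm (hP : P.IsBundle) (hA₀ : IsConnection P A₀)
    (hΦ₀ : IsHiggs P Φ₀) {η₀ : DForm P.Base (2 * m + 1) ℝ} (h₀ : IsStringForm P A₀ Φ₀ f η₀) :
    IsStringClass P f (deRhamClass η₀ (h₀.closed hP hA₀ hΦ₀)) := fun _ _ hA hΦ =>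
  ⟨exists_isStringForm hP hA hΦ f, fun _ h =>
    ⟨h.closed hP hA hΦ, deRhamClass_eq_of_isStringForm hP hA₀ hΦ₀ hA hΦ h₀ h⟩⟩

end Interpolation

/-! ## The integer part of an angle -/

/-- The integer part of `t / 2π`. -/
def turns (t : ℝ) : ℤ := toIcoDiv Real.two_pi_pos 0 t

theorem angleRep_coe (t : ℝ) : angleRep (t : Circ) = t - turns t * (2 * Real.pi) := by
  show t - toIcoDiv Real.two_pi_pos 0 t • (2 * Real.pi) = _
  rw [zsmul_eq_mul]
  rfl

theorem angleRep_mem (t : ℝ) : angleRep (t : Circ) ∈ Set.Ico 0 (2 * Real.pi) :=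
  toIcoMod_mem_Ico' Real.two_pi_pos t

theorem coe_angleRep (θ : Circ) : (angleRep θ : Circ) = θ := by
  induction θ using Real.Angle.induction_on with
  | h t =>
    rw [angleRep_coe, Real.Angle.angle_eq_iff_two_pi_dvd_sub]
    exact ⟨-turns t, by push_cast; ring⟩

theorem turns_eq {t : ℝ} {j : ℤ} (h0 : j * (2 * Real.pi) ≤ t) (h1 : t < (j + 1) * (2 * Real.pi)) :
    turns t = j := by
  refine toIcoDiv_eq_of_sub_zsmul_mem_Ico _ ?_
  rw [zsmul_eq_mul]
  constructor <;> linarith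

theorem turns_mul_le (t : ℝ) : turns t * (2 * Real.pi) ≤ t := by
  have h := (angleRep_mem t).1
  rw [angleRep_coe] at h
  linarith

theorem lt_turns_mul (t : ℝ) : t < (turns t + 1) * (2 * Real.pi) := by
  have h := (angleRep_mem t).2
  rw [angleRep_coe] at h
  linarith

theorem turns_zero : turns 0 = 0 := turns_eq (by simp) (by simp [Real.pi_pos])

theorem turns_add (t : ℝ) : turns (t + 2 * Real.pi) = turns t + 1 := toIcoDiv_add_right _ _ _

theorem angleRep_zero : angleRep 0 = 0 := by
  have h := angleRep_coe 0
  rw [turns_zero] at h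
  simpa using h

theorem angleRep_add (t : ℝ) : angleRep ((t + 2 * Real.pi : ℝ) : Circ) = angleRep t := by
  rw [angleRep_coe, angleRep_coe, turns_add]
  push_cast
  ring

/-- The integer part jumps at multiples of `2π`. The inequalities record on which side `t` lies, so
that cut-off functions that are constant on one side can bridge the jump. -/
theorem eventually_turns (s : ℝ) : ∀ᶠ t in 𝓝 s,
    (turns t = turns s ∧ turns s * (2 * Real.pi) ≤ t) ∨
      (turns t = turns s - 1 ∧ t ≤ turns s * (2 * Real.pi)) := by
  have hp := Real.two_pi_pos
  have h1 : (turns s - 1) * (2 * Real.pi) < s := by linarith [turns_mul_le s]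
  filter_upwards [lt_mem_nhds h1, gt_mem_nhds (lt_turns_mul s)] with t ht1 ht2
  rcases le_or_gt (turns s * (2 * Real.pi)) t with h | h
  · exact Or.inl ⟨turns_eq h ht2, h⟩
  · refine Or.inr ⟨turns_eq (by push_cast; exact ht1.le) (by push_cast; linarith), h.le⟩

section PathFibrationForms

variable {E : Type*} [NormedAddCommGroup E] [NormedSpace ℝ E]
  {G : Type*} [TopologicalSpace G] [ChartedSpace E G] [Group G] [LieGroup 𝓘(ℝ, E) ∞ G]

/-! ## Paths with vanishing logarithmic derivative -/

theorem mfderiv_eq_zero_of_leftMC {U : Type*} [NormedAddCommGroup U] [NormedSpace ℝ U] {φ : U → G}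
    {u : U} (h : leftMC (E := E) φ u = 0) :
    (mfderiv 𝓘(ℝ, U) 𝓘(ℝ, E) φ u : U →L[ℝ] E) = 0 := by
  ext v
  have e := mfderiv_comp_apply_of_eq (I := 𝓘(ℝ, E)) (x := φ u) (y := 1)
    (f := fun x => (φ u)⁻¹ * x) (g := fun x => φ u * x) (mdiff_mul_left _ _) (mdiff_mul_left _ _)
    (by simp) (mfderiv 𝓘(ℝ, U) 𝓘(ℝ, E) φ u v : E)
  have e3 : (fun x : G => φ u * x) ∘ (fun x => (φ u)⁻¹ * x) = id := by
    funext x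
    simp
  rw [e3, mfderiv_id] at e
  have e4 : (maurerCartan (E := E) (φ u) (mfderiv 𝓘(ℝ, U) 𝓘(ℝ, E) φ u v : E) : E) = 0 :=
    congrArg (fun L : U →L[ℝ] E => L v) h
  refine Eq.trans (b := _) e ?_
  exact (congrArg (mfderiv 𝓘(ℝ, E) 𝓘(ℝ, E) (fun x : G => φ u * x) 1 : E →L[ℝ] E) e4).trans
    (map_zero _)

/-- The derivative of `φ` vanishes, so in a chart around any value `φ` is constant on a small ball;
local constancy on the connected line suffices. -/
theorem eq_of_leftMC_eq_zero {φ : ℝ → G} (hφ : ContMDiff 𝓘(ℝ, ℝ) 𝓘(ℝ, E) ∞ φ)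
    (h : ∀ t, leftMC (E := E) φ t = 0) (s t : ℝ) : φ s = φ t := by
  have := topologicalGroup_of_lieGroup 𝓘(ℝ, E) ∞ (G := G)
  refine (IsLocallyConstant.iff_eventually_eq φ).2 (fun t => ?_) |>.apply_eq_of_preconnectedSpace s t
  let N : ℝ → G := fun s => (φ t)⁻¹ * φ s
  have hN : ContMDiff 𝓘(ℝ, ℝ) 𝓘(ℝ, E) ∞ N := contMDiff_const.mul hφ
  have hN0 : ∀ s, (mfderiv 𝓘(ℝ, ℝ) 𝓘(ℝ, E) N s : ℝ →L[ℝ] E) = 0 := fun s =>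
    mfderiv_eq_zero_of_leftMC (by
      rw [leftMC_const_mul _ (hφ.mdifferentiable (by simp) s), h])
  have hNt : Filter.Tendsto N (𝓝 t) (𝓝 1) := by
    have := hN.continuous.tendsto t
    simpa [N] using this
  have hs := hNt.eventually ((chartOneInv_chartOne (E := E) (G := G)).and
    (extChartAt_source_mem_nhds (I := 𝓘(ℝ, E)) (1 : G)))
  obtain ⟨r, hr, hball⟩ := Metric.eventually_nhds_iff_ball.1 hs
  have hd : ∀ s ∈ Metric.ball t r, HasFDerivAt (fun s : ℝ => chartOne (E := E) (N s)) (0 : ℝ →L[ℝ] E) s := by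
    intro s hs
    have h1 := (contMDiffAt_chartOne (hball s hs).2).mdifferentiableAt (by simp)
    have h2 := mfderiv_comp s h1 (hN.mdifferentiable (by simp) s)
    have h3 : MDifferentiableAt 𝓘(ℝ, ℝ) 𝓘(ℝ, E) (fun s => chartOne (E := E) (N s)) s :=
      h1.comp s (hN.mdifferentiable (by simp) s)
    have h4 : fderiv ℝ (fun s => chartOne (E := E) (N s)) s = 0 := by
      rw [← mfderiv_eq_fderiv]
      refine h2.trans ?_
      exact (congrArg (fun L : ℝ →L[ℝ] E =>
        (mfderiv 𝓘(ℝ, E) 𝓘(ℝ, E) (chartOne (E := E)) (N s) : E →L[ℝ] E).comp L) (hN0 s)).trans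
        (ContinuousLinearMap.comp_zero _)
    rw [← h4]
    exact h3.differentiableAt.hasFDerivAt
  filter_upwards [Metric.ball_mem_nhds t hr] with s hs
  have e := (convex_ball t r).is_const_of_fderivWithin_eq_zero (𝕜 := ℝ)
    (fun x hx => (hd x hx).differentiableAt.differentiableWithinAt)
    (fun x hx => by rw [fderivWithin_of_isOpen Metric.isOpen_ball hx, (hd x hx).fderiv]) hs
    (Metric.mem_ball_self hr)
  have e2 : N s = N t := by
    rw [← (hball s hs).1, e, (hball t (Metric.mem_ball_self hr)).1]
  exact mul_left_cancel e2

/-- By periodicity of `p⁻¹∂p` the quotient `p(t + 2π) p(t)⁻¹` has vanishing Maurer-Cartan form. It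
is therefore constant, with its value read off at `t = 0`. -/
theorem PathSpace.apply_add_two_pi (p : PathSpace E G) (t : ℝ) :
    p.1 (t + 2 * Real.pi) = p.1 (2 * Real.pi) * p.1 t := by
  have hp := p.2.1
  have hsh : ContMDiff 𝓘(ℝ, ℝ) 𝓘(ℝ, E) ∞ fun s => p.1 (s + 2 * Real.pi) :=
    hp.comp (contDiff_id.add contDiff_const).contMDiff
  have hd : MDifferentiable 𝓘(ℝ, ℝ) 𝓘(ℝ, E) p.1 := hp.mdifferentiable (by simp)
  have hshd : MDifferentiable 𝓘(ℝ, ℝ) 𝓘(ℝ, E) fun s => p.1 (s + 2 * Real.pi) :=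
    hsh.mdifferentiable (by simp)
  have h := eq_of_leftMC_eq_zero (E := E) (φ := fun s => p.1 (s + 2 * Real.pi) * (p.1 s)⁻¹)
    (hsh.mul hp.inv) (fun s => by
      have e : leftMC (E := E) (fun s => p.1 (s + 2 * Real.pi)) s = leftMC p.1 s :=
        ContinuousLinearMap.ext_ring (by
          show logDeriv (E := E) (fun s => p.1 (s + 2 * Real.pi)) s = logDeriv p.1 s
          rw [logDeriv_add_const hd, p.2.2.2])
      rw [leftMC_mul (hshd s) (mdifferentiableAt_inv (hd s)), leftMC_inv (hd s), e, inv_inv,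
        add_neg_cancel]) t 0
  simp only [zero_add, p.2.2.1, inv_one, mul_one] at h
  exact mul_inv_eq_iff_eq_mul.1 h

theorem isPlot_path_iff {n : ℕ} {p : Eu n → PathSpace E G} : IsPlot p ↔
    ContMDiff 𝓘(ℝ, Eu n × ℝ) 𝓘(ℝ, E) ∞ fun x : Eu n × ℝ => (p x.1).1 x.2 := Iff.rfl

theorem IsPlot.contMDiff_path {n : ℕ} {p : Eu n → PathSpace E G} (hp : IsPlot p) {X : Type*}
    [NormedAddCommGroup X] [NormedSpace ℝ X] {φ : X → Eu n} (hφ : ContDiff ℝ ∞ φ) {τ : X → ℝ}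
    (hτ : ContDiff ℝ ∞ τ) : ContMDiff 𝓘(ℝ, X) 𝓘(ℝ, E) ∞ fun x => (p (φ x)).1 (τ x) :=
  (isPlot_path_iff.1 hp).comp (hφ.prodMk hτ).contMDiff

/-! ## The standard Higgs field -/

theorem isHiggs_stdHiggs : IsHiggs (pathFibration E G) (stdHiggs E G) where
  smooth := fun n (p : Eu n → PathSpace E G) hp => by
    have h1 : ContDiff ℝ ∞ fun x : Eu n × ℝ =>
        leftMC (E := E) (fun x : Eu n × ℝ => (p x.1).1 x.2) x ((0 : Eu n), (1 : ℝ)) :=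
      contDiff_iff_contDiffAt.2 fun x =>
        (contDiffAt_leftMC (isPlot_path_iff.1 hp x)).clm_apply contDiffAt_const
    refine (funext fun x => ?_ : _ = fun x : Eu n × ℝ => stdHiggs E G (p x.1) (x.2 : Circ)) ▸ h1
    have e := hasFDerivAt_prodMk_right (𝕜 := ℝ) x.1 x.2
    have h2 := leftMC_comp (E := E) (φ := fun x : Eu n × ℝ => (p x.1).1 x.2)
      (ψ := fun s => (x.1, s)) (u := x.2) ((isPlot_path_iff.1 hp).mdifferentiable (by simp) _)
      e.differentiableAt
    rw [e.fderiv] at h2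
    exact (congrArg (fun L : ℝ →L[ℝ] E => L 1) h2).symm
  equivariant p γ t :=
    logDeriv_mul (p.2.1.mdifferentiable (by simp) t) (γ.2.1.mdifferentiable (by simp) t)

/-! ## The standard connection -/

/-- `Θ - s Ad(p⁻¹) π^*Θ̂` at the time `t`. -/
def pathConnection {n : ℕ} (p : Eu n → PathSpace E G) (s t : ℝ) (u : Eu n) : Eu n →L[ℝ] E :=
  leftMC (fun w => (p w).1 t) u -
    s • (Ad ((p u).1 t)⁻¹).comp (rightMC (fun w => (p w).1 (2 * Real.pi)) u)

theorem stdConnection_apply (α : ℝ → ℝ) {n : ℕ} (p : Eu n → PathSpace E G) (u : Eu n) (θ : Circ) :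
    stdConnection α n p u θ = pathConnection p (α (angleRep θ)) (angleRep θ) u := rfl

theorem mdifferentiable_path {n : ℕ} {p : Eu n → PathSpace E G} (hp : IsPlot p) (t : ℝ) (u : Eu n) :
    MDifferentiableAt 𝓘(ℝ, Eu n) 𝓘(ℝ, E) (fun w => (p w).1 t) u :=
  (IsPlot.contMDiff_path hp contDiff_id contDiff_const).mdifferentiable (by simp) u

theorem contDiff_leftMC_path {n : ℕ} {p : Eu n → PathSpace E G} (hp : IsPlot p) :
    ContDiff ℝ ∞ fun x : Eu n × ℝ => leftMC (E := E) (fun w => (p w).1 x.2) x.1 := by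
  have h1 : ∀ x : Eu n × ℝ, leftMC (E := E) (fun w => (p w).1 x.2) x.1 =
      (leftMC (fun x : Eu n × ℝ => (p x.1).1 x.2) x).comp (ContinuousLinearMap.inl ℝ (Eu n) ℝ) := by
    intro x
    have e := hasFDerivAt_prodMk_left (𝕜 := ℝ) x.1 x.2
    have h2 := leftMC_comp (E := E) (φ := fun x : Eu n × ℝ => (p x.1).1 x.2)
      (ψ := fun w => (w, x.2)) (u := x.1) ((isPlot_path_iff.1 hp).mdifferentiable (by simp) _)
      e.differentiableAt
    rw [e.fderiv] at h2
    exact h2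
  simp only [h1]
  exact contDiff_iff_contDiffAt.2 fun x =>
    (contDiffAt_leftMC (isPlot_path_iff.1 hp x)).clm_comp contDiffAt_const

/-- For `s = 1` the right-hand side is the connection at time `t` with cut-off value `0`: the end of
one period, where `α = 1`, fits the start of the next, where `α = 0`. -/
theorem pathConnection_add_two_pi {n : ℕ} {p : Eu n → PathSpace E G} (hp : IsPlot p) (s t : ℝ)
    (u : Eu n) : pathConnection p s (t + 2 * Real.pi) u = leftMC (fun w => (p w).1 t) u +
      (1 - s) • (Ad ((p u).1 t)⁻¹).comp (leftMC (fun w => (p w).1 (2 * Real.pi)) u) := by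
  simp only [pathConnection, PathSpace.apply_add_two_pi]
  rw [leftMC_mul (mdifferentiable_path hp _ u) (mdifferentiable_path hp _ u), rightMC_eq,
    mul_inv_rev, Ad_mul]
  have h : (((Ad ((p u).1 t)⁻¹).comp (Ad ((p u).1 (2 * Real.pi))⁻¹)).comp
      ((Ad ((p u).1 (2 * Real.pi))).comp (leftMC (fun w => (p w).1 (2 * Real.pi)) u)) :
        Eu n →L[ℝ] E) = (Ad ((p u).1 t)⁻¹).comp (leftMC (fun w => (p w).1 (2 * Real.pi)) u) := by
    ext v
    simp [Ad_inv_apply_Ad]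
  rw [h]
  module

/-- One smooth formula valid on both sides of a jump. With `τ` the time since the multiple of `2π`,
the extra term vanishes for `τ ≥ 0` because `α(τ + 2π) = 1`, while for `τ ≤ 0` one has `α(τ) = 0`
and the formula is that of the previous period. -/
theorem eventually_stdConnection {α : ℝ → ℝ} (hα0 : ∀ t ≤ 0, α t = 0)
    (hα1 : ∀ t, 2 * Real.pi ≤ t → α t = 1) {n : ℕ} {p : Eu n → PathSpace E G} (hp : IsPlot p)
    (s : ℝ) : ∀ᶠ t : ℝ in 𝓝 s, ∀ u, stdConnection α n p u (t : Circ) =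
      pathConnection p (α (t - turns s * (2 * Real.pi))) (t - turns s * (2 * Real.pi)) u +
        (1 - α (t - turns s * (2 * Real.pi) + 2 * Real.pi)) •
          (Ad ((p u).1 (t - turns s * (2 * Real.pi)))⁻¹).comp
            (leftMC (fun w => (p w).1 (2 * Real.pi)) u) := by
  filter_upwards [eventually_turns s] with t ht u
  rw [stdConnection_apply, angleRep_coe]
  rcases ht with ⟨h1, h2⟩ | ⟨h1, h2⟩
  · rw [h1, hα1 (t - turns s * (2 * Real.pi) + 2 * Real.pi) (by linarith), sub_self, zero_smul,
      add_zero]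
  · have h3 : t - turns t * (2 * Real.pi) = t - turns s * (2 * Real.pi) + 2 * Real.pi := by
      rw [h1]
      push_cast
      ring
    rw [h3, pathConnection_add_two_pi hp, hα0 (t - turns s * (2 * Real.pi)) (by linarith),
      pathConnection, zero_smul, sub_zero]

theorem contDiff_stdConnection {α : ℝ → ℝ} (hα : ContDiff ℝ ∞ α) (hα0 : ∀ t ≤ 0, α t = 0)
    (hα1 : ∀ t, 2 * Real.pi ≤ t → α t = 1) {n : ℕ} {p : Eu n → PathSpace E G} (hp : IsPlot p) :
    ContDiff ℝ ∞ fun x : Eu n × ℝ => stdConnection α n p x.1 (x.2 : Circ) := by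
  have h2π : ContMDiff 𝓘(ℝ, Eu n) 𝓘(ℝ, E) ∞ fun w => (p w).1 (2 * Real.pi) :=
    IsPlot.contMDiff_path hp contDiff_id contDiff_const
  have hl : ContDiff ℝ ∞ fun w => leftMC (E := E) (fun w => (p w).1 (2 * Real.pi)) w :=
    contDiff_iff_contDiffAt.2 fun w => contDiffAt_leftMC (h2π w)
  have hr : ContDiff ℝ ∞ fun w => rightMC (E := E) (fun w => (p w).1 (2 * Real.pi)) w := by
    simp only [rightMC_eq]
    exact contDiff_iff_contDiffAt.2 fun w =>
      (contDiffAt_Ad (h2π w)).clm_comp (contDiffAt_leftMC (h2π w))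
  refine contDiff_iff_contDiffAt.2 fun ⟨u, s⟩ => ?_
  have hτ : ContDiff ℝ ∞ fun x : Eu n × ℝ => x.2 - turns s * (2 * Real.pi) :=
    contDiff_snd.sub contDiff_const
  have hAd : ContDiff ℝ ∞ fun x : Eu n × ℝ =>
      Ad (E := E) ((p x.1).1 (x.2 - turns s * (2 * Real.pi)))⁻¹ :=
    contDiff_iff_contDiffAt.2 fun x =>
      contDiffAt_Ad ((IsPlot.contMDiff_path hp contDiff_fst hτ).inv x)
  have h : ContDiff ℝ ∞ fun x : Eu n × ℝ =>
      pathConnection p (α (x.2 - turns s * (2 * Real.pi))) (x.2 - turns s * (2 * Real.pi)) x.1 +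
        (1 - α (x.2 - turns s * (2 * Real.pi) + 2 * Real.pi)) •
          (Ad ((p x.1).1 (x.2 - turns s * (2 * Real.pi)))⁻¹).comp
            (leftMC (fun w => (p w).1 (2 * Real.pi)) x.1) := by
    refine ContDiff.add (ContDiff.sub ?_ ?_) ?_
    · exact (contDiff_leftMC_path hp).comp (contDiff_fst.prodMk hτ)
    · exact (hα.comp hτ).smul (hAd.clm_comp (hr.comp contDiff_fst))
    · exact (contDiff_const.sub (hα.comp (hτ.add contDiff_const))).smul
        (hAd.clm_comp (hl.comp contDiff_fst))
  refine h.contDiffAt.congr_of_eventuallyEq ?_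
  filter_upwards [continuous_snd.continuousAt.eventually
    (eventually_stdConnection hα0 hα1 hp s)] with x hx
  exact hx x.1

/-- Based loops do not move the end point, so the correction term involving `Θ̂` is equivariant and
vanishes on vertical vectors. At `θ = 0` the path is constantly `1` and `α` is zero. -/
theorem isConnection_stdConnection {α : ℝ → ℝ} (hα : ContDiff ℝ ∞ α) (hα0 : ∀ t ≤ 0, α t = 0)
    (hα1 : ∀ t, 2 * Real.pi ≤ t → α t = 1) :
    IsConnection (pathFibration E G) (stdConnection α) where
  smooth _ _ hp := contDiff_stdConnection hα hα0 hα1 hp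
  natural := fun n m (p : Eu n → PathSpace E G) hp ψ hψ u θ => by
    have h1 : ∀ t, leftMC (E := E) (fun w => (p (ψ w)).1 t) u =
        (leftMC (fun w => (p w).1 t) (ψ u)).comp (fderiv ℝ ψ u) := fun t =>
      leftMC_comp (φ := fun w => (p w).1 t) (mdifferentiable_path hp t _)
        (hψ.differentiable (by simp) u)
    show pathConnection (p ∘ ψ) _ _ u = (pathConnection p _ _ (ψ u)).comp _
    simp only [pathConnection, rightMC_eq, Function.comp_apply, h1]
    rfl
  based := fun n (p : Eu n → PathSpace E G) hp u => by
    show pathConnection p (α (angleRep 0)) (angleRep 0) u = 0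
    rw [angleRep_zero, hα0 0 le_rfl, pathConnection]
    simp only [fun w => (p w).2.2.1, leftMC_const, zero_smul, sub_zero]
  equivariant := fun n (p : Eu n → PathSpace E G) hp γ u θ => by
    have h2π : ((2 * Real.pi : ℝ) : Circ) = 0 := Real.Angle.coe_two_pi
    show pathConnection (fun w => PathSpace.act (p w) γ) _ _ u =
      (Ad (γ.1 θ)⁻¹).comp (pathConnection p _ _ u)
    simp only [pathConnection, PathSpace.act, coe_angleRep, h2π, γ.2.2, mul_one]
    rw [leftMC_mul_const _ (mdifferentiable_path hp _ u), ContinuousLinearMap.comp_sub,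
      ContinuousLinearMap.comp_smul, mul_inv_rev, Ad_mul]
    rfl
  vertical := fun n (p : PathSpace E G) γ hγ u θ => by
    have h2π : ((2 * Real.pi : ℝ) : Circ) = 0 := Real.Angle.coe_two_pi
    show pathConnection (fun w => PathSpace.act p (γ w)) _ _ u = _
    simp only [pathConnection, PathSpace.act, coe_angleRep, h2π, fun w => (γ w).2.2, mul_one]
    rw [rightMC_const, ContinuousLinearMap.comp_zero, smul_zero, sub_zero]
    refine leftMC_const_mul _ ?_
    exact (contMDiff_loop_eval hγ (isPlot_const (x := θ))).mdifferentiable (by simp) u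

end PathFibrationForms

/-! ## The path fibration is a bundle -/

section PathFibrationBundle

variable {E : Type*} [NormedAddCommGroup E] [NormedSpace ℝ E]
  {G : Type*} [TopologicalSpace G] [ChartedSpace E G] [Group G] [LieGroup 𝓘(ℝ, E) ∞ G]

/-- A path from `1` to `g`, straight in the chart at `1`. -/
def chartPath (E : Type*) [NormedAddCommGroup E] [NormedSpace ℝ E] {G : Type*} [TopologicalSpace G]
    [ChartedSpace E G] [Group G] (g : G) (t : ℝ) : G :=
  chartOneInv (Real.smoothTransition (t / (2 * Real.pi)) • chartOne (E := E) g)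

theorem chartPath_of_nonpos (g : G) {t : ℝ} (ht : t ≤ 0) : chartPath E g t = 1 := by
  rw [chartPath, Real.smoothTransition.zero_of_nonpos
    (div_nonpos_of_nonpos_of_nonneg ht Real.two_pi_pos.le), zero_smul, chartOneInv_zero]

-- In a ball around the origin where `chartOneInv` is smooth, scaling by a factor in `[0, 1]` does
-- not leave the ball, so the straight paths depend smoothly on their end point.
variable (E G) in
theorem exists_nhds_chartPath : ∃ W ∈ 𝓝 (1 : G),
    (∀ g ∈ W, ∀ t, 2 * Real.pi ≤ t → chartPath E g t = g) ∧
    ∀ (n : ℕ) (x : Eu n → G), ContMDiff 𝓘(ℝ, Eu n) 𝓘(ℝ, E) ∞ x → (∀ w, x w ∈ W) →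
      ContMDiff 𝓘(ℝ, Eu n × ℝ) 𝓘(ℝ, E) ∞ fun y : Eu n × ℝ => chartPath E (x y.1) y.2 := by
  obtain ⟨r, hr, hball⟩ := Metric.eventually_nhds_iff_ball.1
    (eventually_contMDiffAt_chartOneInv (E := E) (G := G))
  have hc : Filter.Tendsto (chartOne (E := E) (G := G)) (𝓝 1) (𝓝 0) := by
    have := (contMDiffAt_chartOne_one (E := E) (G := G)).continuousAt.tendsto
    rwa [chartOne_one] at this
  refine ⟨_, (hc.eventually (Metric.ball_mem_nhds 0 hr)).and
    ((chartOneInv_chartOne (E := E) (G := G)).and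
      (extChartAt_source_mem_nhds (I := 𝓘(ℝ, E)) (1 : G))), fun g hg t ht => ?_,
    fun n x hx hxW y => ?_⟩
  · rw [chartPath, Real.smoothTransition.one_of_one_le ((one_le_div Real.two_pi_pos).2 ht),
      one_smul]
    exact hg.2.1
  · obtain ⟨h1, -, h3⟩ := hxW y.1
    have hx1 : ContMDiffAt 𝓘(ℝ, Eu n × ℝ) 𝓘(ℝ, E) ∞ (fun y : Eu n × ℝ => chartOne (E := E) (x y.1))
        y :=
      ContMDiffAt.comp (I' := 𝓘(ℝ, E)) y (g := chartOne (E := E)) (contMDiffAt_chartOne h3)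
        (ContMDiffAt.comp (I' := 𝓘(ℝ, Eu n)) y (hx y.1) contDiff_fst.contMDiff.contMDiffAt)
    have hs : ContDiff ℝ ∞ fun y : Eu n × ℝ => Real.smoothTransition (y.2 / (2 * Real.pi)) :=
      Real.smoothTransition.contDiff.comp (contDiff_snd.div_const _)
    have hx2 : ContDiffAt ℝ ∞ (fun y : Eu n × ℝ =>
        Real.smoothTransition (y.2 / (2 * Real.pi)) • chartOne (E := E) (x y.1)) y :=
      hs.contDiffAt.smul hx1.contDiffAt
    refine ContMDiffAt.comp (I' := 𝓘(ℝ, E)) y (g := chartOneInv) (hball _ ?_) hx2.contMDiffAt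
    rw [dist_zero_right] at h1
    rw [mem_ball_zero_iff, norm_smul, Real.norm_eq_abs, abs_of_nonneg (Real.smoothTransition.nonneg _)]
    exact (mul_le_of_le_one_left (norm_nonneg _) (Real.smoothTransition.le_one _)).trans_lt h1

variable (E G) in
/-- The group of the endpoints of smooth paths from `1`. -/
def reachable : Subgroup G where
  carrier := {g | ∃ c : ℝ → G, ContMDiff 𝓘(ℝ, ℝ) 𝓘(ℝ, E) ∞ c ∧ (∀ t ≤ 0, c t = 1) ∧
    ∀ t, 2 * Real.pi ≤ t → c t = g}
  one_mem' := ⟨fun _ => 1, contMDiff_const, fun _ _ => rfl, fun _ _ => rfl⟩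
  mul_mem' := by
    rintro a b ⟨c, hc, hc0, hc1⟩ ⟨c', hc', hc0', hc1'⟩
    exact ⟨fun t => c t * c' t, hc.mul hc', fun t ht => by simp [hc0 t ht, hc0' t ht],
      fun t ht => by simp [hc1 t ht, hc1' t ht]⟩
  inv_mem' := by
    rintro a ⟨c, hc, hc0, hc1⟩
    exact ⟨fun t => (c t)⁻¹, hc.inv, fun t ht => by simp [hc0 t ht],
      fun t ht => by simp [hc1 t ht]⟩

-- The reachable elements form a subgroup containing a neighbourhood of `1`. It is open, hence also
-- closed, hence everything.
variable (E) in
theorem exists_smooth_path [ConnectedSpace G] (g : G) : ∃ c : ℝ → G,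
    ContMDiff 𝓘(ℝ, ℝ) 𝓘(ℝ, E) ∞ c ∧ (∀ t ≤ 0, c t = 1) ∧ ∀ t, 2 * Real.pi ≤ t → c t = g := by
  have := topologicalGroup_of_lieGroup 𝓘(ℝ, E) ∞ (G := G)
  obtain ⟨W, hW, hW1, hW2⟩ := exists_nhds_chartPath E G
  have hsub : W ⊆ (reachable E G : Set G) := fun g hg =>
    ⟨chartPath E g, (hW2 0 (fun _ => g) contMDiff_const fun _ => hg).comp
      (contDiff_const.prodMk contDiff_id).contMDiff (f := fun t : ℝ => ((0 : Eu 0), t)),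
      fun t ht => chartPath_of_nonpos g ht, hW1 g hg⟩
  have hop : IsOpen (reachable E G : Set G) :=
    (reachable E G).isOpen_of_mem_nhds (Filter.mem_of_superset hW hsub)
  have hcl : IsClopen (reachable E G : Set G) := ⟨(reachable E G).isClosed_of_isOpen hop, hop⟩
  have huniv := hcl.eq_univ ⟨1, (reachable E G).one_mem⟩
  exact (huniv ▸ Set.mem_univ g : g ∈ (reachable E G : Set G))

theorem contMDiff_zpow {X : Type*} [NormedAddCommGroup X] [NormedSpace ℝ X] {y : X → G}
    (hy : ContMDiff 𝓘(ℝ, X) 𝓘(ℝ, E) ∞ y) (j : ℤ) :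
    ContMDiff 𝓘(ℝ, X) 𝓘(ℝ, E) ∞ fun w => y w ^ j := by
  induction j using Int.induction_on with
  | zero => simpa using contMDiff_const
  | succ i ih => 
    simp only [zpow_add_one]
    exact ih.mul hy
  | pred i ih => 
    simp only [zpow_sub_one]
    exact ih.mul hy.inv

/-- The extension of `c` from `[0, 2π)` to `ℝ` with `q(t + 2π) = g q(t)`. -/
def quasiPeriodic (g : G) (c : ℝ → G) (t : ℝ) : G := g ^ turns t * c (angleRep t)

theorem quasiPeriodic_add (g : G) (c : ℝ → G) (t : ℝ) :
    quasiPeriodic g c (t + 2 * Real.pi) = g * quasiPeriodic g c t := by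
  rw [quasiPeriodic, quasiPeriodic, turns_add, angleRep_add, zpow_add_one, ← mul_assoc]
  congr 1
  exact (Commute.zpow_left (Commute.refl g) _)

/-- Near time `s`, with `j = turns s` and `τ = t - 2πj`, the extension equals `y^(j-1) c(τ + 2π)
c(τ)` on both sides: for `τ ≥ 0` the middle factor is `y`, for `τ ≤ 0` the last one is `1`. -/
theorem contMDiff_quasiPeriodic {X : Type*} [NormedAddCommGroup X] [NormedSpace ℝ X] {y : X → G}
    (hy : ContMDiff 𝓘(ℝ, X) 𝓘(ℝ, E) ∞ y) {c : X → ℝ → G}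
    (hc : ContMDiff 𝓘(ℝ, X × ℝ) 𝓘(ℝ, E) ∞ fun x : X × ℝ => c x.1 x.2)
    (hc0 : ∀ w, ∀ t ≤ 0, c w t = 1) (hc1 : ∀ w t, 2 * Real.pi ≤ t → c w t = y w) :
    ContMDiff 𝓘(ℝ, X × ℝ) 𝓘(ℝ, E) ∞ fun x : X × ℝ => quasiPeriodic (y x.1) (c x.1) x.2 := by
  rintro ⟨u, s⟩
  have hτ : ContDiff ℝ ∞ fun x : X × ℝ => x.2 - turns s * (2 * Real.pi) :=
    contDiff_snd.sub contDiff_const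
  have h : ContMDiff 𝓘(ℝ, X × ℝ) 𝓘(ℝ, E) ∞ fun x : X × ℝ => y x.1 ^ (turns s - 1) *
      c x.1 (x.2 - turns s * (2 * Real.pi) + 2 * Real.pi) *
        c x.1 (x.2 - turns s * (2 * Real.pi)) := by
    refine ContMDiff.mul (ContMDiff.mul ?_ ?_) ?_
    · exact (contMDiff_zpow hy _).comp contDiff_fst.contMDiff
    · exact hc.comp (contDiff_fst.prodMk (hτ.add contDiff_const)).contMDiff
    · exact hc.comp (contDiff_fst.prodMk hτ).contMDiff
  refine (h (u, s)).congr_of_eventuallyEq ?_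
  filter_upwards [continuous_snd.continuousAt.eventually (eventually_turns s)] with x hx
  rw [quasiPeriodic, angleRep_coe]
  rcases hx with ⟨h1, h2⟩ | ⟨h1, h2⟩
  · rw [h1, hc1 x.1 (x.2 - turns s * (2 * Real.pi) + 2 * Real.pi) (by linarith),
      ← zpow_add_one, sub_add_cancel]
  · rw [h1, hc0 x.1 (x.2 - turns s * (2 * Real.pi)) (by linarith), mul_one]
    push_cast
    ring_nf

/-- The path with the given values on `[0, 2π]`. -/
theorem exists_pathSpace {g : G} {c : ℝ → G} (hc : ContMDiff 𝓘(ℝ, ℝ) 𝓘(ℝ, E) ∞ (quasiPeriodic g c))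
    (hc0 : c 0 = 1) : ∃ p : PathSpace E G, p.1 = quasiPeriodic g c ∧ p.1 (2 * Real.pi) = g := by
  have h0 : quasiPeriodic g c 0 = 1 := by
    have : angleRep ((0 : ℝ) : Circ) = 0 := angleRep_zero
    rw [quasiPeriodic, turns_zero, this, hc0, zpow_zero, mul_one]
  have hd : MDifferentiable 𝓘(ℝ, ℝ) 𝓘(ℝ, E) (quasiPeriodic g c) := hc.mdifferentiable (by simp)
  refine ⟨⟨quasiPeriodic g c, hc, h0, fun t => ?_⟩, rfl, ?_⟩
  · rw [← logDeriv_add_const hd]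
    simp only [quasiPeriodic_add]
    exact congrArg (fun L : ℝ →L[ℝ] E => L 1) (leftMC_const_mul g (hd t))
  · have h := quasiPeriodic_add g c 0
    rwa [zero_add, h0, mul_one] at h

theorem exists_plot_of_paths {n : ℕ} {y : Eu n → G} (hy : ContMDiff 𝓘(ℝ, Eu n) 𝓘(ℝ, E) ∞ y)
    {c : Eu n → ℝ → G} (hc : ContMDiff 𝓘(ℝ, Eu n × ℝ) 𝓘(ℝ, E) ∞ fun x : Eu n × ℝ => c x.1 x.2)
    (hc0 : ∀ w, ∀ t ≤ 0, c w t = 1) (hc1 : ∀ w t, 2 * Real.pi ≤ t → c w t = y w) :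
    ∃ p : Eu n → PathSpace E G, IsPlot p ∧ ∀ w, (p w).1 (2 * Real.pi) = y w := by
  have hq := contMDiff_quasiPeriodic hy hc hc0 hc1
  have hq1 : ∀ w, ContMDiff 𝓘(ℝ, ℝ) 𝓘(ℝ, E) ∞ (quasiPeriodic (y w) (c w)) := fun w =>
    ContMDiff.comp (I' := 𝓘(ℝ, Eu n × ℝ)) (f := fun t : ℝ => (w, t)) hq
      (contDiff_const.prodMk contDiff_id).contMDiff
  choose p hp hp' using fun w => exists_pathSpace (hq1 w) (hc0 w 0 le_rfl)
  refine ⟨p, isPlot_path_iff.2 ?_, hp'⟩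
  simp only [hp]
  exact hq

/-- A fixed path from `1` to `g`, multiplied by the short path from `1` to `g⁻¹ x(w)`, ends at
`x(w)` and depends smoothly on `w`. -/
theorem exists_path_lift_of_mem {n : ℕ} {W : Set G}
    (hW1 : ∀ g ∈ W, ∀ t, 2 * Real.pi ≤ t → chartPath E g t = g)
    (hW2 : ∀ z : Eu n → G, ContMDiff 𝓘(ℝ, Eu n) 𝓘(ℝ, E) ∞ z → (∀ w, z w ∈ W) →
      ContMDiff 𝓘(ℝ, Eu n × ℝ) 𝓘(ℝ, E) ∞ fun x : Eu n × ℝ => chartPath E (z x.1) x.2)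
    {g : G} {c : ℝ → G} (hc : ContMDiff 𝓘(ℝ, ℝ) 𝓘(ℝ, E) ∞ c) (hc0 : ∀ t ≤ 0, c t = 1)
    (hc1 : ∀ t, 2 * Real.pi ≤ t → c t = g) {x : Eu n → G}
    (hx : ContMDiff 𝓘(ℝ, Eu n) 𝓘(ℝ, E) ∞ x) (hxW : ∀ w, g⁻¹ * x w ∈ W) :
    ∃ p : Eu n → PathSpace E G, IsPlot p ∧ ∀ w, (p w).1 (2 * Real.pi) = x w := by
  have hz : ContMDiff 𝓘(ℝ, Eu n) 𝓘(ℝ, E) ∞ fun w => g⁻¹ * x w := contMDiff_const.mul hx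
  have hc' : ContMDiff 𝓘(ℝ, Eu n × ℝ) 𝓘(ℝ, E) ∞ fun y : Eu n × ℝ => c y.2 :=
    ContMDiff.comp (I' := 𝓘(ℝ, ℝ)) (g := c) (f := fun y : Eu n × ℝ => y.2) hc
      contDiff_snd.contMDiff
  have h2 := hW2 _ hz hxW
  have h : ContMDiff 𝓘(ℝ, Eu n × ℝ) 𝓘(ℝ, E) ∞
      fun y : Eu n × ℝ => c y.2 * chartPath E (g⁻¹ * x y.1) y.2 :=
    ContMDiff.mul hc' h2
  refine exists_plot_of_paths (c := fun w t => c t * chartPath E (g⁻¹ * x w) t) hx h ?_ ?_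
  · intro w t ht
    rw [hc0 t ht, chartPath_of_nonpos _ ht, one_mul]
  · intro w t ht
    rw [hc1 t ht, hW1 _ (hxW w) t ht, mul_inv_cancel_left]

theorem exists_smooth_restrict {n : ℕ} {x : Eu n → G} (hx : ContMDiff 𝓘(ℝ, Eu n) 𝓘(ℝ, E) ∞ x)
    {u : Eu n} {s : Set G} (hs : s ∈ 𝓝 (x u)) :
    ∃ y : Eu n → G, ContMDiff 𝓘(ℝ, Eu n) 𝓘(ℝ, E) ∞ y ∧ (∀ w, y w ∈ s) ∧ y =ᶠ[𝓝 u] x := by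
  obtain ⟨t, ht, hot, hut⟩ := eventually_nhds_iff.mp (hx.continuous.continuousAt.eventually hs)
  obtain ⟨ρ, hρ, hρt, hρu⟩ := exists_smooth_retract hot hut
  refine ⟨fun w => x (ρ w), ContMDiff.comp (I' := 𝓘(ℝ, Eu n)) hx hρ.contMDiff,
    fun w => ht _ (hρt w), ?_⟩
  filter_upwards [hρu] with w hw
  rw [hw, id]

theorem exists_path_lift [ConnectedSpace G] {n : ℕ} {x : Eu n → G}
    (hx : ContMDiff 𝓘(ℝ, Eu n) 𝓘(ℝ, E) ∞ x) (u : Eu n) :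
    ∃ p : Eu n → PathSpace E G, IsPlot p ∧ (fun w => (p w).1 (2 * Real.pi)) =ᶠ[𝓝 u] x := by
  obtain ⟨W, hW, hW1, hW2⟩ := exists_nhds_chartPath E G
  obtain ⟨c, hc, hc0, hc1⟩ := exists_smooth_path E (x u)
  have hs : {g : G | (x u)⁻¹ * g ∈ W} ∈ 𝓝 (x u) := by
    have h := (contMDiff_mul_left (I := 𝓘(ℝ, E)) (n := ∞) (a := (x u)⁻¹)).continuous.continuousAt
      (x := x u)
    refine h.preimage_mem_nhds ?_
    rwa [inv_mul_cancel]
  obtain ⟨y, hy, hys, hyx⟩ := exists_smooth_restrict hx hs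
  obtain ⟨p, hp, hpy⟩ := exists_path_lift_of_mem hW1 (hW2 n) hc hc0 hc1 hy hys
  exact ⟨p, hp, by simpa only [hpy] using hyx⟩

/-- For paths with equal end points, `p⁻¹ p'` is periodic by `PathSpace.apply_add_two_pi`, so it is
the loop relating them. -/
theorem isBundle_pathFibration [ConnectedSpace G] : (pathFibration E G).IsBundle where
  free := fun (p : PathSpace E G) γ h => by
    refine Subtype.ext (funext fun θ => ?_)
    have h1 := congrFun (congrArg Subtype.val h) (angleRep θ)
    have h2 : p.1 (angleRep θ) * γ.1 (angleRep θ : Circ) = p.1 (angleRep θ) := h1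
    rw [coe_angleRep] at h2
    exact mul_eq_left.1 h2
  transitive := fun n (p p' : Eu n → PathSpace E G) hp hp' h => by
    have hper : ∀ u, Function.Periodic (fun t => ((p u).1 t)⁻¹ * (p' u).1 t) (2 * Real.pi) := by
      intro u t
      have hu : (p u).1 (2 * Real.pi) = (p' u).1 (2 * Real.pi) := h u
      simp only [PathSpace.apply_add_two_pi, hu]
      group
    refine ⟨fun u => ⟨(hper u).lift, (p u).2.1.inv.mul (p' u).2.1, ?_⟩, ?_, fun u => ?_⟩
    · show ((p u).1 0)⁻¹ * (p' u).1 0 = 1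
      rw [(p u).2.2.1, (p' u).2.2.1, inv_one, one_mul]
    · exact (isPlot_path_iff.1 hp).inv.mul (isPlot_path_iff.1 hp')
    · refine Subtype.ext (funext fun t => ?_)
      show (p' u).1 t = (p u).1 t * (((p u).1 t)⁻¹ * (p' u).1 t)
      rw [mul_inv_cancel_left]
  local_lift _ _ hx u := exists_path_lift hx u

end PathFibrationBundle

/-! ## Contractions of the forms `f(F, …, F)` -/

section Contraction

open Equiv

/-- All cosets of the stabilizer of `0` contribute equally. Since `T` is invariant on the right
while the coset decomposition multiplies on the left, the sum is first reindexed by inversion. -/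
theorem sum_perm_eq_smul {N : ℕ} (T : Perm (Fin (N + 1)) → ℝ) (ρ : Fin (N + 1) → Perm (Fin (N + 1)))
    (hρ : ∀ a, ρ a 0 = a) (hT : ∀ a σ, T (σ * ρ a) = T σ) :
    ∑ σ, T σ = (N + 1 : ℝ) * ∑ σ : Perm (Fin N), T (Perm.decomposeFin.symm (0, σ)) := by
  have h1 : ∀ a τ, T (ρ a * τ)⁻¹ = T τ⁻¹ := fun a τ => by
    rw [← hT a, mul_inv_rev, inv_mul_cancel_right]
  have h2 : (∑ τ : Perm (Fin (N + 1)), if τ 0 = 0 then T τ⁻¹ else 0) =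
      ∑ τ : Perm (Fin (N + 1)), if τ 0 = 0 then T τ else 0 := by
    rw [← Equiv.sum_comp (Equiv.inv _)]
    refine Fintype.sum_congr _ _ fun τ => ?_
    have h : τ⁻¹ 0 = 0 ↔ τ 0 = 0 := by rw [Perm.inv_eq_iff_eq, eq_comm]
    simp only [Equiv.inv_apply, inv_inv, h]
  have h3 : (∑ τ : Perm (Fin (N + 1)), if τ 0 = 0 then T τ else 0) =
      ∑ σ : Perm (Fin N), T (Perm.decomposeFin.symm (0, σ)) := by
    rw [← Equiv.sum_comp Perm.decomposeFin.symm, Fintype.sum_prod_type, Fin.sum_univ_succ]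
    simp
  rw [← Equiv.sum_comp (Equiv.inv _), sum_perm_eq_sum_stabilizer 0 ρ hρ]
  simp only [Equiv.inv_apply, h1]
  rw [h2, h3, Finset.sum_const, Finset.card_univ, Fintype.card_fin, nsmul_eq_mul]
  push_cast
  rfl

/-- The exchange of the first block of two elements with the `i`-th one. -/
def blockSwap {k : ℕ} (i : Fin (k + 1)) : Perm ((_ : Fin (k + 1)) × Fin 2) :=
  swap ⟨0, 0⟩ ⟨i, 0⟩ * swap ⟨0, 1⟩ ⟨i, 1⟩

theorem blockSwap_apply {k : ℕ} (i l : Fin (k + 1)) (j : Fin 2) :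
    blockSwap i ⟨l, j⟩ = ⟨swap 0 i l, j⟩ := by
  fin_cases j <;> by_cases h0 : l = 0 <;> by_cases hi : l = i <;>
    simp_all [blockSwap, swap_apply_def]

theorem sign_blockSwap {k : ℕ} (i : Fin (k + 1)) : Perm.sign (blockSwap i) = 1 := by
  by_cases h : 0 = i
  · subst h
    simp [blockSwap]
  · rw [blockSwap, Perm.sign_mul, Perm.sign_swap (by simpa using h), Perm.sign_swap (by simpa using h)]
    rfl

variable {V : Type*} [NormedAddCommGroup V] [NormedSpace ℝ V]
  {U : Type*} [NormedAddCommGroup U] [NormedSpace ℝ U]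

/-- A permutation of the arguments that fixes `sgn(σ) f(F(v_{σ1}, v_{σ2}), …)`. -/
theorem exists_perm_of_symm {k N : ℕ} {f : ContinuousMultilinearMap ℝ (fun _ : Fin (k + 1) => V) ℝ}
    (hf : ∀ (σ : Perm (Fin (k + 1))) v, f (v ∘ σ) = f v) (F : U [⋀^Fin 2]→L[ℝ] V)
    (e : (_ : Fin (k + 1)) × Fin 2 ≃ Fin N) (v : Fin N → U) (a : Fin N) :
    ∃ ρ : Perm (Fin N), ρ (e ⟨0, 0⟩) = a ∧ ∀ σ : Perm (Fin N),
      (Perm.sign (σ * ρ) • f fun i => F fun j => v ((σ * ρ) (e ⟨i, j⟩))) =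
        Perm.sign σ • f fun i => F fun j => v (σ (e ⟨i, j⟩)) := by
  have hb : ∀ (i : Fin (k + 1)) (σ : Perm (Fin N)),
      (Perm.sign (σ * e.permCongr (blockSwap i)) •
        f fun l => F fun j => v ((σ * e.permCongr (blockSwap i)) (e ⟨l, j⟩))) =
        Perm.sign σ • f fun i => F fun j => v (σ (e ⟨i, j⟩)) := by
    intro i σ
    rw [Perm.sign_mul, Perm.sign_permCongr, sign_blockSwap, mul_one,
      ← hf (swap 0 i) fun i => F fun j => v (σ (e ⟨i, j⟩))]
    simp [permCongr_apply, blockSwap_apply, Function.comp_def]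
  -- Exchanging the two arguments of the first block changes both the sign of `F` and the sign of
  -- the permutation.
  have hs : ∀ (σ : Perm (Fin N)),
      (Perm.sign (σ * e.permCongr (swap ⟨0, 0⟩ ⟨0, 1⟩)) •
        f fun l => F fun j => v ((σ * e.permCongr (swap ⟨0, 0⟩ ⟨0, 1⟩)) (e ⟨l, j⟩))) =
        Perm.sign σ • f fun i => F fun j => v (σ (e ⟨i, j⟩)) := by
    intro σ
    have h1 : (fun l => F fun j => v ((σ * e.permCongr (swap ⟨0, 0⟩ ⟨0, 1⟩)) (e ⟨l, j⟩))) =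
        Function.update (fun i => F fun j => v (σ (e ⟨i, j⟩))) 0
          (-(F fun j => v (σ (e ⟨0, j⟩)))) := by
      funext l
      by_cases hl : l = 0
      · subst hl
        rw [Function.update_self]
        refine Eq.trans ?_ (F.toAlternatingMap.map_swap (fun j => v (σ (e ⟨0, j⟩)))
          (zero_ne_one (α := Fin 2)))
        show F _ = F _
        congr 1
        funext j
        fin_cases j <;> simp [permCongr_apply]
      · rw [Function.update_of_ne hl]
        congr 1
        funext j
        rw [Perm.mul_apply, permCongr_apply, symm_apply_apply, swap_apply_of_ne_of_ne]
        · simpa using fun h => absurd h hl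
        · simpa using fun h => absurd h hl
    rw [h1, ← neg_one_smul ℝ, f.map_update_smul, Function.update_eq_self, Perm.sign_mul,
      Perm.sign_permCongr, Perm.sign_swap (by simp)]
    simp
  -- The position `a` lies in some block `i`. Exchanging this block with block `0` reaches its first
  -- entry; the second entry needs the transposition within block `0` beforehand.
  obtain ⟨⟨i, j⟩, rfl⟩ := e.surjective a
  fin_cases j
  · refine ⟨e.permCongr (blockSwap i), ?_, hb i⟩
    simp [permCongr_apply, blockSwap_apply]
  · refine ⟨e.permCongr (blockSwap i) * e.permCongr (swap ⟨0, 0⟩ ⟨0, 1⟩), ?_, fun σ => ?_⟩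
    · simp [permCongr_apply, blockSwap_apply]
    · rw [← mul_assoc, hs, hb]

/-- `ι_x f(F, …, F) = k f(ι_x F, F, …, F)`. -/
theorem formEval_vecCons {m N : ℕ} {f : ContinuousMultilinearMap ℝ (fun _ : Fin (m + 1) => V) ℝ}
    (hf : ∀ (σ : Perm (Fin (m + 1))) v, f (v ∘ σ) = f v) (F : U [⋀^Fin 2]→L[ℝ] V)
    (hN : ∑ _i : Fin (m + 1), 2 = N + 1)
    (hN' : ∑ i, (Fin.cons 1 fun _ => 2 : Fin (m + 1) → ℕ) i = N) (x : U) (v : Fin N → U) :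
    formEval (q := fun _ => 2) f (fun _ => F) hN (Matrix.vecCons x v) =
      (m + 1 : ℝ) * formEval (q := Fin.cons 1 fun _ => 2) f
        (Fin.cases (motive := fun i =>
          U [⋀^Fin ((Fin.cons 1 fun _ => 2 : Fin (m + 1) → ℕ) i)]→L[ℝ] V) (F.curryLeft x)
            fun _ => F) hN' v := by
  have hNm : (N : ℝ) + 1 = 2 * (m + 1) := by
    have : N + 1 = 2 * (m + 1) := by rw [← hN]; simp [mul_comm]
    exact_mod_cast this
  set e := finSigmaFinEquiv.trans (finCongr hN) with he
  set e' := finSigmaFinEquiv.trans (finCongr hN') with he'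
  have hz : ∀ g : Fin ((0 : Fin (m + 1)) : ℕ) → ℕ, ∑ i, g i = 0 := fun g =>
    Finset.sum_eq_zero fun i _ => i.elim0
  have e0 : e ⟨0, 0⟩ = 0 := by
    apply Fin.ext
    rw [he, trans_apply, finCongr_apply, Fin.val_cast, finSigmaFinEquiv_apply, hz]
    rfl
  have e1 : e ⟨0, 1⟩ = (e' ⟨0, (0 : Fin 1)⟩).succ := by
    apply Fin.ext
    rw [he, he', trans_apply, finCongr_apply, Fin.val_cast, finSigmaFinEquiv_apply, hz, Fin.val_succ,
      trans_apply, finCongr_apply, Fin.val_cast, finSigmaFinEquiv_apply, hz]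
    rfl
  have e2 : ∀ (i : Fin m) (j : Fin 2), e ⟨i.succ, j⟩ = (e' ⟨i.succ, (j : Fin 2)⟩).succ := by
    intro i j
    apply Fin.ext
    simp [he, he', Fin.sum_univ_succ]
    ring
  choose ρ hρ hρ' using exists_perm_of_symm hf F e (Matrix.vecCons x v)
  -- By symmetry `x` may be put into the very first position, at the price of the factor `N + 1 =
  -- 2(m + 1)`. The normalisations `2^(m+1)` and `2^m` absorb the `2` and leave `m + 1`.
  rw [formEval_apply, formEval_apply, sum_perm_eq_smul _ ρ (fun a => e0 ▸ hρ a) fun a σ => hρ' a σ,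
    hNm]
  have h2 : (∏ i, (((Fin.cons 1 fun _ => 2 : Fin (m + 1) → ℕ) i).factorial : ℝ)) = 2 ^ m := by
    rw [Fin.prod_univ_succ]
    simp
  have h1 : (∏ _i : Fin (m + 1), ((2 : ℕ).factorial : ℝ)) = 2 ^ (m + 1) := by simp
  have h3 : ∀ σ : Perm (Fin N), (Perm.sign (Perm.decomposeFin.symm (0, σ)) •
      f fun i => F fun j => Matrix.vecCons x v ((Perm.decomposeFin.symm (0, σ)) (e ⟨i, j⟩))) =
      Perm.sign σ • f fun i => (Fin.cases (motive := fun i =>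
          U [⋀^Fin ((Fin.cons 1 fun _ => 2 : Fin (m + 1) → ℕ) i)]→L[ℝ] V) (F.curryLeft x)
            (fun _ => F) i) fun j => v (σ (e' ⟨i, j⟩)) := by
    intro σ
    rw [show Perm.sign (Perm.decomposeFin.symm (0, σ)) = Perm.sign σ by
      simp [Perm.decomposeFin.symm_sign]]
    congr 2
    funext i
    refine Fin.cases ?_ (fun i => ?_) i
    · show F _ = F (Matrix.vecCons x fun j => v (σ (e' ⟨0, j⟩)))
      congr 1
      funext j
      refine Fin.cases ?_ (fun j => ?_) j
      · rw [e0]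
        simp
      · rw [Subsingleton.elim j 0, Fin.succ_zero_eq_one, e1, Perm.decomposeFin_symm_apply_succ]
        simp
    · show F _ = F _
      congr 1
      funext j
      rw [e2, Perm.decomposeFin_symm_apply_succ]
      simp
  rw [Fintype.sum_congr _ _ h3, h1, h2, smul_eq_mul, smul_eq_mul, pow_succ]
  field_simp
  rfl

theorem formEval_smul {k : ℕ} {q : Fin k → ℕ} {W : Type*} [NormedAddCommGroup W] [NormedSpace ℝ W]
    (f : ContinuousMultilinearMap ℝ (fun _ : Fin k => V) W) (c : Fin k → ℝ)
    (η : ∀ i, U [⋀^Fin (q i)]→L[ℝ] V) {N : ℕ} (hN : ∑ i, q i = N) :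
    formEval f (fun i => c i • η i) hN = (∏ i, c i) • formEval f η hN := by
  ext v
  simp only [ContinuousAlternatingMap.smul_apply, formEval_apply, f.map_smul_univ]
  simp only [Finset.smul_sum, smul_comm (∏ i, c i)]

end Contraction

/-! ## The standard string form -/

/-- The Beta integral `B(m + 1, m + 1)`, evaluated by Gamma functions. -/
theorem integral_mul_one_sub_pow (m : ℕ) : ∫ x in (0 : ℝ)..1, (x * (1 - x)) ^ m =
    (m.factorial * m.factorial / (2 * m + 1).factorial : ℝ) := by
  have hm : 0 < ((m : ℂ) + 1).re := by
    rw [Complex.add_re, Complex.natCast_re, Complex.one_re]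
    positivity
  have h := Complex.betaIntegral_eq_Gamma_mul_div ((m : ℂ) + 1) (m + 1) hm hm
  have h2 : (m : ℂ) + 1 + (m + 1) = (2 * m + 1 : ℕ) + 1 := by
    push_cast
    ring
  rw [h2, Complex.Gamma_nat_eq_factorial, Complex.Gamma_nat_eq_factorial, Complex.betaIntegral,
    add_sub_cancel_right] at h
  have h3 : ∀ x : ℝ, (x : ℂ) ^ (m : ℂ) * (1 - (x : ℂ)) ^ (m : ℂ) = (((x * (1 - x)) ^ m : ℝ) : ℂ) := by
    intro x
    rw [Complex.cpow_natCast, Complex.cpow_natCast, ← mul_pow]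
    push_cast
    rfl
  simp only [h3] at h
  apply Complex.ofReal_injective
  rw [← intervalIntegral.integral_ofReal, h]
  push_cast
  rfl

theorem integral_deriv_mul_pow {α : ℝ → ℝ} (hα : ContDiff ℝ ∞ α) {a b : ℝ} (ha : α a = 0)
    (hb : α b = 1) (m : ℕ) : ∫ t in a..b, deriv α t * (α t * (1 - α t)) ^ m =
      (m.factorial * m.factorial / (2 * m + 1).factorial : ℝ) := by
  have h := intervalIntegral.integral_comp_mul_deriv (a := a) (b := b) (f := α) (f' := deriv α)
    (g := fun x => (x * (1 - x)) ^ m)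
    (fun x _ => (hα.differentiable (by simp) x).hasDerivAt)
    (hα.continuous_deriv (by simp)).continuousOn (by fun_prop)
  rw [ha, hb, integral_mul_one_sub_pow] at h
  rw [← h]
  simp only [Function.comp_apply, mul_comm]

section StandardForm

variable {E : Type*} [NormedAddCommGroup E] [NormedSpace ℝ E] [FiniteDimensional ℝ E]
  {G : Type*} [TopologicalSpace G] [ChartedSpace E G] [Group G] [LieGroup 𝓘(ℝ, E) ∞ G]
  {U : Type*} [NormedAddCommGroup U] [NormedSpace ℝ U]

theorem formEval_bracket (L : U →L[ℝ] E) (h : ∑ _i : Fin 2, 1 = 2) (v : Fin 2 → U) :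
    formEval (q := fun _ => 1) (bracket E G)
      (fun _ => ContinuousAlternatingMap.ofSubsingleton ℝ U E (0 : Fin 1) L) h v =
        (2 : ℝ) • lieBilin E G (L (v 0)) (L (v 1)) := by
  rw [formEval_two, two_smul]
  show lieBilin E G (L (v 0)) (L (v 1)) - lieBilin E G (L (v 1)) (L (v 0)) = _
  rw [lieBilin_anti (L (v 1)), sub_neg_eq_add]

/-- The Maurer-Cartan equation replaces `χ dΘ` by `-χ · ½[Θ, Θ]`, which combines with `χ² · ½[Θ,
Θ]`. -/
theorem curv_smul_leftMC {χ : U → ℝ} {x : U → G} {u : U} (hχ : DifferentiableAt ℝ χ u)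
    (hx : ContMDiffAt 𝓘(ℝ, U) 𝓘(ℝ, E) ∞ x u) (v w : U) :
    curv G (fun w => χ w • leftMC (E := E) x w) u v w =
      fderiv ℝ χ u v • leftMC (E := E) x u w - fderiv ℝ χ u w • leftMC (E := E) x u v +
        (χ u * (χ u - 1)) • lieBilin E G (leftMC x u v) (leftMC x u w) := by
  have hL : DifferentiableAt ℝ (leftMC (E := E) x) u := (contDiffAt_leftMC hx).differentiableAt (by simp)
  have h := curv_leftMC hx v w
  rw [curv] at h
  have hD : HasFDerivAt (fun w => χ w • leftMC (E := E) x w) _ u := hχ.hasFDerivAt.smul hL.hasFDerivAt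
  rw [curv, hD.fderiv]
  simp only [add_apply, smul_apply, ContinuousLinearMap.smulRight_apply,
    map_smul, LinearMap.smul_apply]
  have h' := eq_neg_of_add_eq_zero_left h
  rw [sub_eq_iff_eq_add] at h'
  rw [h']
  module

theorem gauge_smul_rightMC (s : U → ℝ) (x : U → G) (u : U) :
    gauge x (fun w => -s w • rightMC (E := E) x w) u = (1 - s u) • leftMC x u := by
  have h : ((Ad (x u)⁻¹).comp ((Ad (x u)).comp (leftMC x u)) : U →L[ℝ] E) = leftMC x u := by
    ext v
    simp [Ad_inv_apply_Ad]
  rw [gauge, rightMC_eq, ContinuousLinearMap.comp_smul, h]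
  module

/-- Both sides are Chern-Weil forms of gauge transforms of the same form `-s x^*Θ̂`, on the left by
`g` and on the right by `x`. This eliminates the path and leaves only its end point. -/
theorem cwForm_gauge_smul_rightMC {k : ℕ} (f : InvPoly E G k) {s : U → ℝ} {g x : U → G} {u : U}
    (hs : DifferentiableAt ℝ s u) (hg : ContMDiffAt 𝓘(ℝ, U) 𝓘(ℝ, E) ∞ g u)
    (hx : ContMDiffAt 𝓘(ℝ, U) 𝓘(ℝ, E) ∞ x u) :
    cwForm f (gauge g fun w => -s w • rightMC (E := E) x w) u =
      cwForm f (fun w => (1 - s w) • leftMC (E := E) x w) u := by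
  have hb : DifferentiableAt ℝ (fun w => -s w • rightMC (E := E) x w) u := by
    simp only [rightMC_eq]
    exact hs.neg.smul (((contDiffAt_Ad hx).clm_comp (contDiffAt_leftMC hx)).differentiableAt (by simp))
  rw [cwForm_gauge f hg hb, ← cwForm_gauge f hx hb]
  exact congrArg (fun b => cwForm f b u) (funext fun w => gauge_smul_rightMC s x w)

/-- With `χ = 1 - α(t)` the curvature contracts with `∂_t` to `-α' Θ` and restricts to `-½ α(1 -
α)[Θ, Θ]` on the slice. By `formEval_vecCons` the contraction hits one of the `m + 1` slots of `f`.
-/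
theorem contractLast_cwForm_smul_leftMC {m n : ℕ} (f : InvPoly E G (m + 1)) {α : ℝ → ℝ}
    (hα : ContDiff ℝ ∞ α) {y : Eu n → G} (hy : ContMDiff 𝓘(ℝ, Eu n) 𝓘(ℝ, E) ∞ y) (u : Eu n) (t : ℝ) :
    contractLast (j := 2 * m + 1) (cwForm f (fun w : Eu (n + 1) =>
      (1 - α (w (Fin.last n))) • leftMC (E := E) (fun w => y (initial w)) w) (snoc u t)) =
      (-((-1 / 2 : ℝ) ^ m * (m + 1)) * (deriv α t * (α t * (1 - α t)) ^ m)) • mcPolynomial f y u := by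
  set χ : Eu (n + 1) → ℝ := fun w => 1 - α (w (Fin.last n)) with hχ
  set x : Eu (n + 1) → G := fun w => y (initial w) with hx
  have hlast : HasFDerivAt (fun w : Eu (n + 1) => w (Fin.last n))
      (EuclideanSpace.proj (𝕜 := ℝ) (Fin.last n)) (snoc u t) :=
    (EuclideanSpace.proj (𝕜 := ℝ) (Fin.last n)).hasFDerivAt
  have hαt : HasDerivAt α (deriv α t) (snoc u t (Fin.last n)) := by
    rw [snoc_last]
    exact (hα.differentiable (by simp) t).hasDerivAt
  have hχd : HasFDerivAt χ (-(deriv α t • EuclideanSpace.proj (𝕜 := ℝ) (Fin.last n))) (snoc u t) :=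
    (hαt.comp_hasFDerivAt (snoc u t) hlast).const_sub 1
  have hxs : ContMDiff 𝓘(ℝ, Eu (n + 1)) 𝓘(ℝ, E) ∞ x :=
    ContMDiff.comp (I' := 𝓘(ℝ, Eu n)) hy (initialL n).contDiff.contMDiff
  have hL : leftMC (E := E) x (snoc u t) = (leftMC y u).comp (initialL n) := by
    have h := leftMC_comp (E := E) (φ := y) (ψ := initialL n) (u := snoc u t)
      (hy.mdifferentiable (by simp) _) (initialL n).differentiableAt
    rw [ContinuousLinearMap.fderiv, initialL_apply, initial_snoc] at h
    exact h
  have hb : DifferentiableAt ℝ (fun w => χ w • leftMC (E := E) x w) (snoc u t) :=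
    hχd.differentiableAt.smul ((contDiffAt_leftMC (hxs _)).differentiableAt (by simp))
  set F := curvForm G (fun w => χ w • leftMC (E := E) x w) (snoc u t) with hF
  have hFv : ∀ v, F v = _ := fun v =>
    (curvForm_apply hb v).trans (curv_smul_leftMC hχd.differentiableAt (hxs _) _ _)
  rw [hχd.fderiv, hL] at hFv
  have hχt : χ (snoc u t) = 1 - α t := by rw [hχ]; simp
  let Θ : Eu n [⋀^Fin 1]→L[ℝ] E :=
    ContinuousAlternatingMap.ofSubsingleton ℝ (Eu n) E (0 : Fin 1) (leftMC y u)
  let ΘΘ : Eu n [⋀^Fin 2]→L[ℝ] E :=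
    formEval (q := fun _ => 1) (bracket E G) (fun _ => Θ) (by simp)
  have hproj : ∀ v : Eu n, EuclideanSpace.proj (𝕜 := ℝ) (Fin.last n) (snoc v 0) = 0 := fun v =>
    snoc_last v 0
  have h1 : (F.curryLeft (snoc 0 1)).compContinuousLinearMap (inclL n) = (-deriv α t) • Θ := by
    ext v
    rw [ContinuousAlternatingMap.compContinuousLinearMap_apply]
    show F (Matrix.vecCons (snoc 0 1) fun i => snoc (v i) 0) = _
    rw [hFv]
    simp [Θ]
  have h2 : F.compContinuousLinearMap (inclL n) = (-(α t * (1 - α t)) / 2) • ΘΘ := by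
    ext v
    rw [ContinuousAlternatingMap.compContinuousLinearMap_apply, hFv, hχt,
      ContinuousAlternatingMap.smul_apply, formEval_bracket]
    simp only [Function.comp_apply, ContinuousLinearMap.comp_apply, inclL_apply, initialL_apply,
      initial_snoc, neg_apply, smul_apply, hproj]
    module
  ext v
  rw [contractLast_apply, cwForm,
    formEval_vecCons f.symm F (N := 2 * m + 1) (by simp [mul_comm]; ring)
      (by simp [Fin.sum_univ_succ]; ring)]
  have h3 := formEval_compContinuousLinearMap (q := Fin.cons 1 fun _ => 2) f.toFun
    (Fin.cases (motive := fun i =>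
      Eu (n + 1) [⋀^Fin ((Fin.cons 1 fun _ => 2 : Fin (m + 1) → ℕ) i)]→L[ℝ] E)
        (F.curryLeft (snoc 0 1)) fun _ => F) (N := 2 * m + 1) (by simp [Fin.sum_univ_succ]; ring)
    (inclL n)
  have h4 : (fun i => (Fin.cases (motive := fun i =>
      Eu (n + 1) [⋀^Fin ((Fin.cons 1 fun _ => 2 : Fin (m + 1) → ℕ) i)]→L[ℝ] E)
        (F.curryLeft (snoc 0 1)) (fun _ => F) i).compContinuousLinearMap (inclL n)) =
      fun i => (Fin.cons (-deriv α t) (fun _ => -(α t * (1 - α t)) / 2) : Fin (m + 1) → ℝ) i •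
        (Fin.cases (motive := fun i =>
          Eu n [⋀^Fin ((Fin.cons 1 fun _ => 2 : Fin (m + 1) → ℕ) i)]→L[ℝ] E) Θ (fun _ => ΘΘ) i) := by
    funext i
    exact Fin.cases h1 (fun _ => h2) i
  rw [h4, formEval_smul] at h3
  have h5 := congrArg (fun ζ : Eu n [⋀^Fin (2 * m + 1)]→L[ℝ] ℝ => ζ v) h3
  refine (congrArg ((m + 1 : ℝ) * ·) h5.symm).trans ?_
  show (m + 1 : ℝ) * ((∏ i, (Fin.cons (-deriv α t) (fun _ => -(α t * (1 - α t)) / 2) :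
    Fin (m + 1) → ℝ) i) * mcPolynomial f y u v) = _ * mcPolynomial f y u v
  have h6 : -(α t * (1 - α t)) / 2 = -1 / 2 * (α t * (1 - α t)) := by ring
  rw [Fin.prod_univ_succ]
  simp only [Fin.cons_zero, Fin.cons_succ, Finset.prod_const, Finset.card_univ, Fintype.card_fin,
    h6, mul_pow]
  ring

/-- The caloron connection of the standard connection and Higgs field: it is the gauge transform by
the paths of `-α` times the right invariant form of their end points. -/
theorem caloronForm_std (α : ℝ → ℝ) {n : ℕ} {p : Eu n → PathSpace E G} (hp : IsPlot p)
    {w : Eu (n + 1)} (h0 : 0 ≤ w (Fin.last n)) (h1 : w (Fin.last n) < 2 * Real.pi) :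
    caloronForm (P := pathFibration E G) (stdConnection α) (stdHiggs E G) (fun w => p (initial w))
      (fun w : Eu (n + 1) => (w (Fin.last n) : Circ)) w =
      gauge (fun w => (p (initial w)).1 (w (Fin.last n))) (fun w => -α (w (Fin.last n)) •
        rightMC (E := E) (fun w => (p (initial w)).1 (2 * Real.pi)) w) w := by
  have hd : DifferentiableAt ℝ (fun w : Eu (n + 1) => w (Fin.last n)) w :=
    (EuclideanSpace.proj (𝕜 := ℝ) (Fin.last n)).differentiableAt
  have hr : angleRep (w (Fin.last n) : Circ) = w (Fin.last n) := by
    rw [angleRep_coe, turns_eq (j := 0) (by simpa using h0) (by simpa using h1)]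
    simp
  have hQ := leftMC_prodMk (E := E) (Q := fun x : Eu n × ℝ => (p x.1).1 x.2) (φ := initialL n)
    (t := fun w : Eu (n + 1) => w (Fin.last n)) (u := w)
    ((isPlot_path_iff.1 hp).mdifferentiable (by simp) _) (initialL n).differentiableAt hd
  show pathConnection (fun w => p (initial w)) (α (angleRep (w (Fin.last n) : Circ)))
      (angleRep (w (Fin.last n) : Circ)) w +
    (dTheta (fun w : Eu (n + 1) => (w (Fin.last n) : Circ)) w).smulRight
      (logDeriv (p (initial w)).1 (w (Fin.last n))) = _
  rw [hr, dTheta_coe hd, pathConnection, gauge]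
  rw [show leftMC (E := E) (fun w : Eu (n + 1) => (p (initial w)).1 (w (Fin.last n))) w = _ from hQ]
  rw [ContinuousLinearMap.comp_smul, neg_smul]
  simp only [initialL_apply]
  abel

theorem contractLast_cwForm_caloronForm_std {m : ℕ} (f : InvPoly E G (m + 1)) {α : ℝ → ℝ}
    (hα : ContDiff ℝ ∞ α) {n : ℕ} {p : Eu n → PathSpace E G} (hp : IsPlot p) (u : Eu n) {t : ℝ}
    (h0 : 0 < t) (h1 : t < 2 * Real.pi) :
    contractLast (j := 2 * m + 1) (cwForm f (caloronForm (P := pathFibration E G) (stdConnection α)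
      (stdHiggs E G) (fun w => p (initial w)) (fun w : Eu (n + 1) => (w (Fin.last n) : Circ)))
        (snoc u t)) =
      (-((-1 / 2 : ℝ) ^ m * (m + 1)) * (deriv α t * (α t * (1 - α t)) ^ m)) •
        mcPolynomial f (fun w => (p w).1 (2 * Real.pi)) u := by
  have hlast : ContDiff ℝ ∞ fun w : Eu (n + 1) => w (Fin.last n) :=
    (EuclideanSpace.proj (𝕜 := ℝ) (Fin.last n)).contDiff
  have hy : ContMDiff 𝓘(ℝ, Eu n) 𝓘(ℝ, E) ∞ fun w => (p w).1 (2 * Real.pi) :=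
    IsPlot.contMDiff_path hp contDiff_id contDiff_const
  have hx : ContMDiff 𝓘(ℝ, Eu (n + 1)) 𝓘(ℝ, E) ∞
      fun w : Eu (n + 1) => (p (initial w)).1 (2 * Real.pi) :=
    IsPlot.contMDiff_path hp (initialL n).contDiff contDiff_const
  have hg : ContMDiff 𝓘(ℝ, Eu (n + 1)) 𝓘(ℝ, E) ∞
      fun w : Eu (n + 1) => (p (initial w)).1 (w (Fin.last n)) :=
    IsPlot.contMDiff_path hp (initialL n).contDiff hlast
  have hev : ∀ᶠ w : Eu (n + 1) in 𝓝 (snoc u t), w (Fin.last n) ∈ Set.Ioo 0 (2 * Real.pi) := by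
    refine hlast.continuous.continuousAt.eventually (Ioo_mem_nhds ?_ ?_) <;> simpa
  have hs : DifferentiableAt ℝ (fun w : Eu (n + 1) => α (w (Fin.last n))) (snoc u t) :=
    (hα.comp hlast).differentiable (by simp) _
  rw [← contractLast_cwForm_smul_leftMC f hα hy u t, ← cwForm_gauge_smul_rightMC f hs (hg _) (hx _)]
  congr 1
  refine cwForm_congr f ?_
  filter_upwards [hev] with w hw
  exact caloronForm_std α hp hw.1.le hw.2

/-- The odd sign from the fibre integral cancels the one of `-α'`, and `(m + 1) m!² = (m + 1)! m!`.
-/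
theorem integral_contractLast_std (m : ℕ) {α : ℝ → ℝ} (hα : ContDiff ℝ ∞ α) (ha : α 0 = 0)
    (hb : α (2 * Real.pi) = 1) :
    (-1 : ℝ) ^ (2 * m + 1) * ∫ t in (0 : ℝ)..(2 * Real.pi),
      -((-1 / 2 : ℝ) ^ m * (m + 1)) * (deriv α t * (α t * (1 - α t)) ^ m) =
        (-1 / 2 : ℝ) ^ m * ((m + 1).factorial * m.factorial) / (2 * m + 1).factorial := by
  rw [intervalIntegral.integral_const_mul, integral_deriv_mul_pow hα ha hb, Nat.factorial_succ m,
    pow_succ, pow_mul]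
  push_cast
  norm_num
  ring

theorem mcPolynomial_congr {m : ℕ} (f : InvPoly E G (m + 1)) {n : ℕ} {p p' : Eu n → G} {u : Eu n}
    (h : p =ᶠ[𝓝 u] p') : mcPolynomial f p u = mcPolynomial f p' u := by
  unfold mcPolynomial
  rw [leftMC_congr h]

theorem IsStringForm.std_on_proj [ConnectedSpace G] {m : ℕ} {f : InvPoly E G (m + 1)} {α : ℝ → ℝ}
    (hα : ContDiff ℝ ∞ α) (hα0 : ∀ t ≤ 0, α t = 0) (hα1 : ∀ t, 2 * Real.pi ≤ t → α t = 1)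
    {η : DForm (pathFibration E G).Base (2 * m + 1) ℝ}
    (h : IsStringForm (pathFibration E G) (stdConnection α) (stdHiggs E G) f η) {n : ℕ}
    {p : Eu n → (pathFibration E G).Total} (hp : IsPlot p) (u : Eu n) :
    η.on (fun w => (pathFibration E G).proj (p w))
        (hp.dSmooth_comp (pathFibration E G).proj_smooth) u =
      ((-1 / 2 : ℝ) ^ m * ((m + 1).factorial * m.factorial) / (2 * m + 1).factorial) •
        mcPolynomial f (fun w => (pathFibration E G).proj (p w)) u := by
  obtain ⟨c, hc, hη⟩ := (isStringForm_iff isBundle_pathFibration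
    (isConnection_stdConnection hα hα0 hα1) isHiggs_stdHiggs f η).1 h
  rw [(isFibreIntegral_iff (j := 2 * m + 1) c η).1 hη, DForm.on_smul]
  ext v
  have hr : IsPlot fun w : Eu (n + 1) => (p (initial w), (w (Fin.last n) : Circ)) :=
    isPlot_cylinder hp
  rw [ContinuousAlternatingMap.smul_apply, DForm.integrate_on, smul_eq_mul,
    ContinuousAlternatingMap.smul_apply, smul_eq_mul,
    ← integral_contractLast_std m hα (hα0 0 le_rfl) (hα1 _ le_rfl), mul_assoc,
    ← intervalIntegral.integral_mul_const]
  congr 1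
  -- The explicit formula requires a whole neighbourhood of `t` inside one period; the excluded end
  -- points do not affect the integral.
  refine intervalIntegral.integral_congr_Ioo_of_le Real.two_pi_pos.le fun t ht => ?_
  have h1 := hc (n + 1) (fun w : Eu (n + 1) => (p (initial w), (w (Fin.last n) : Circ))) hr
    (snoc u t)
  have h2 := contractLast_cwForm_caloronForm_std f hα hp u ht.1 ht.2
  have h3 := congrArg (fun ζ : Eu n [⋀^Fin (2 * m + 1)]→L[ℝ] ℝ => ζ v)
    ((congrArg (contractLast (j := 2 * m + 1)) h1).trans h2)
  exact h3

/-- Both sides depend only on the germ of the plot, and every germ lifts to `PG`. -/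
theorem IsStringForm.std_on [ConnectedSpace G] {m : ℕ} {f : InvPoly E G (m + 1)} {α : ℝ → ℝ}
    (hα : ContDiff ℝ ∞ α) (hα0 : ∀ t ≤ 0, α t = 0) (hα1 : ∀ t, 2 * Real.pi ≤ t → α t = 1)
    {η : DForm (pathFibration E G).Base (2 * m + 1) ℝ}
    (h : IsStringForm (pathFibration E G) (stdConnection α) (stdHiggs E G) f η) {n : ℕ}
    {x : Eu n → (pathFibration E G).Base} (hx : IsPlot x) (u : Eu n) :
    η.on x hx u =
      ((-1 / 2 : ℝ) ^ m * ((m + 1).factorial * m.factorial) / (2 * m + 1).factorial) •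
        mcPolynomial f x u := by
  obtain ⟨p, hp, hpx⟩ := isBundle_pathFibration.local_lift n x hx u
  rw [← η.on_congr (hp.dSmooth_comp (pathFibration E G).proj_smooth) hx hpx,
    ← mcPolynomial_congr f hpx]
  exact h.std_on_proj hα hα0 hα1 hp u

end StandardForm

end StringForm

end

/-! ### The theorem -/

open StringForm

theorem mainTheorem10 {E : Type*} [NormedAddCommGroup E] [NormedSpace ℝ E] [FiniteDimensional ℝ E]
    {G : Type*} [TopologicalSpace G] [ChartedSpace E G] [Group G] [LieGroup 𝓘(ℝ, E) ∞ G]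
    [T2Space G] [CompactSpace G] [ConnectedSpace G]
    (m : ℕ) (f : InvPoly E G (m + 1))
    (α : ℝ → ℝ) (hα : ContDiff ℝ ∞ α) (hα0 : ∀ t ≤ 0, α t = 0)
    (hα1 : ∀ t, 2 * Real.pi ≤ t → α t = 1) :
    (pathFibration E G).IsBundle ∧
    IsConnection (pathFibration E G) (stdConnection α) ∧
    IsHiggs (pathFibration E G) (stdHiggs E G) ∧
    ∃ τ : DForm (pathFibration E G).Base (2 * m + 1) ℝ,
      (∀ (n : ℕ) (p : Eu n → (pathFibration E G).Base) (hp : Diffeology.IsPlot p) (u : Eu n),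
        τ.on p hp u =
          ((-1 / 2 : ℝ) ^ m * ((m + 1).factorial * m.factorial) / (2 * m + 1).factorial) •
            mcPolynomial f p u) ∧
      (∀ η : DForm (pathFibration E G).Base (2 * m + 1) ℝ,
        IsStringForm (pathFibration E G) (stdConnection α) (stdHiggs E G) f η ↔ η = τ) ∧
      ∃ hτ : d (pathFibration E G).Base (2 * m + 1) ℝ τ = 0,
        IsStringClass (pathFibration E G) f (deRhamClass τ hτ) := by
  have hP := isBundle_pathFibration (E := E) (G := G)
  have hA := isConnection_stdConnection (E := E) (G := G) hα hα0 hα1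
  have hΦ := isHiggs_stdHiggs (E := E) (G := G)
  -- Taking `τ` from the general existence result means that the explicit expression never has to be
  -- shown to be smooth and natural; it is only evaluated on plots.
  obtain ⟨τ, hτ⟩ := exists_isStringForm hP hA hΦ f
  refine ⟨hP, hA, hΦ, τ, fun n p hp u => hτ.std_on hα hα0 hα1 hp u, fun η => ⟨fun h => ?_, ?_⟩,
    hτ.closed hP hA hΦ, isStringClass_of_isStringForm hP hA hΦ hτ⟩
  · exact h.unique hP hA hΦ hτ
  · rintro rfl
    exact hτ
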